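/- Let $M$ be a smooth $5$-manifold with frame bundle $F$, whose points are the linear isomorphisms $u\colon\mathbb{R}^5\to T_xM$; the group $\mathrm{GL}(5,\mathbb{R})$ acts on the right by $ug=u\circ g$. Let $\mathrm{SU}(2)\subset\mathrm{GL}(5,\mathbb{R})$ be the common stabilizer of $e^5$, $e^{12}+e^{34}$, $e^{13}+e^{42}$, $e^{14}+e^{23}$. An $\mathrm{SU}(2)$-structure is a smooth reduction $P\subset F$ to $\mathrm{SU}(2)$. It determines forms $\alpha,\omega_1,\omega_2,\omega_3$ on $M$, which correspond to these four elements under every $u\in P$, and it is called hypo if $\omega_1$, $\omega_2\wedge\alpha$ and $\omega_3\wedge\alpha$ are closed. The intrinsic torsion components $f,g$ (functions), $\beta$ (a $1$-form orthogonal to $\alpha$) and $\omega^-,\sigma_2^-,\sigma_3^-\in\Lambda^2_-(\ker\alpha)$ are defined by \[d\alpha=\alpha\wedge\beta+f\omega_1+f_2\omega_2+f_3\omega_3+\omega^-,\] \[d\omega_2=\gamma_2\wedge\omega_2+\alpha\wedge(\lambda\omega_2-g_3\omega_1+g\omega_3+\sigma_2^-),\qquad d\omega_3=\gamma_3\wedge\omega_3+\alpha\wedge(\lambda\omega_3-g\omega_2+g_2\omega_1+\sigma_3^-),\]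 where $\gamma_2,\gamma_3$ are orthogonal to $\alpha$; for a hypo structure $f_2=f_3=\lambda=g_2=g_3=0$ and $\gamma_2=\gamma_3=\beta$. At $u\in P$, with $\theta^1,\dots,\theta^5$ the coframe dual to $u$, write $\beta=\sum_{i\le 4}\beta_i\theta^i$, $J_1\beta=(-\beta_2,\beta_1,-\beta_4,\beta_3)^T$, and \[\omega^-=2\omega^-_a(\theta^{12}-\theta^{34})+2\omega^-_b(\theta^{13}-\theta^{42})+2\omega^-_c(\theta^{14}-\theta^{23}),\] and similarly for $\sigma_2^-,\sigma_3^-$. For $u\in P$ let \[Q_P(u)=\begin{pmatrix}-\frac f2\,\mathrm{id}+\tilde Q_P & J_1\beta\\ (J_1\beta)^T& f+g\end{pmatrix},\] where $\tilde Q_P$ is the symmetric $4\times4$ matrix with upper triangular part \[\begin{pmatrix} (\sigma_2^-)_c-(\sigma_3^-)_b-\omega^-_a & (\sigma_2^-)_b+(\sigma_3^-)_c & -(\sigma_2^-)_a-\omega^-_c & -(\sigma_3^-)_a+\omega^-_b\\ & -(\sigma_2^-)_c+(\sigma_3^-)_b-\omega^-_a & -(\sigma_3^-)_a-\omega^-_b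 & (\sigma_2^-)_a-\omega^-_c\\ && -(\sigma_2^-)_c-(\sigma_3^-)_b+\omega^-_a & (\sigma_2^-)_b-(\sigma_3^-)_c\\ &&& (\sigma_2^-)_c+(\sigma_3^-)_b+\omega^-_a \end{pmatrix}.\] Let $I\subset\mathbb{R}$ be an open interval containing $0$, and let $P_t$, $t\in I$, be a smooth one-parameter family of hypo $\mathrm{SU}(2)$-structures on $M$, with defining forms $\alpha(t),\omega_i(t)$. Then $Q_{P_t}$ is the restriction to $P_t$ of a map $Q_{P_t}\colon F\to\mathfrak{gl}(5,\mathbb{R})$ with $Q_{P_t}(ug)=g^{-1}Q_{P_t}(u)g$ for all $u\in F$, $g\in\mathrm{GL}(5,\mathbb{R})$. Moreover, $P_t$ satisfies the hypo evolution equations \[\frac{\partial}{\partial t}\omega_1=-d\alpha,\qquad \frac{\partial}{\partial t}(\omega_2\wedge\alpha)=-d\omega_3,\qquad \frac{\partial}{\partial t}(\omega_3\wedge\alpha)=d\omega_2\] on $I$ if and only if there is a smooth one-parameter family of gauge transformations $s_t\colon F\to\mathrm{GL}(5,\mathbb{R})$, $t\in I$ (smooth maps with $s_t(ug)=g^{-1}s_t(u)g$),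 such that $s_0\equiv\mathrm{id}$ and, for all $t\in I$, \[P_t=\{u\,s_t(u)\mid u\in P_0\},\qquad s_t'\,s_t^{-1}=-Q_{P_t}.\] -/

import Mathlib

open Set Topology
open scoped Manifold ContDiff

noncomputable section

namespace Hypo

/-! ### Linear algebra on `ℝ⁵` (indices run over `0, …, 4` instead of `1, …, 5`) -/

/-- The form `e^{j₁ … jₖ} = e^{j₁} ∧ ⋯ ∧ e^{jₖ}` on `ℝ⁵`, normalised so that
`e^{j₁ … jₖ}(v₁, …, vₖ) = det (e^{j_b}(v_a))`. -/
def e {k : ℕ} (J : Fin k → Fin 5) : (Fin 5 → ℝ) [⋀^Fin k]→L[ℝ] ℝ :=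
  { (Matrix.detRowAlternating (R := ℝ) (n := Fin k)).compLinearMap
      (LinearMap.funLeft ℝ ℝ J) with
    cont := by
      change Continuous fun v : Fin k → Fin 5 → ℝ =>
        Matrix.det (Matrix.of fun a b => v a (J b))
      exact Continuous.matrix_det (by fun_prop) }

theorem e_apply {k : ℕ} (J : Fin k → Fin 5) (v : Fin k → Fin 5 → ℝ) :
    e J v = Matrix.det (Matrix.of fun a b => v a (J b)) := rfl

/-- `e⁵`. -/
def stdα : (Fin 5 → ℝ) [⋀^Fin 1]→L[ℝ] ℝ := e ![4]

/-- `e¹² + e³⁴`. -/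
def stdω₁ : (Fin 5 → ℝ) [⋀^Fin 2]→L[ℝ] ℝ := e ![0, 1] + e ![2, 3]

/-- `e¹³ + e⁴²`. -/
def stdω₂ : (Fin 5 → ℝ) [⋀^Fin 2]→L[ℝ] ℝ := e ![0, 2] + e ![3, 1]

/-- `e¹⁴ + e²³`. -/
def stdω₃ : (Fin 5 → ℝ) [⋀^Fin 2]→L[ℝ] ℝ := e ![0, 3] + e ![1, 2]

/-- `e¹³⁵ + e⁴²⁵`, that is `(e¹³ + e⁴²) ∧ e⁵`. -/
def stdψ₂ : (Fin 5 → ℝ) [⋀^Fin 3]→L[ℝ] ℝ := e ![0, 2, 4] + e ![3, 1, 4]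

/-- `e¹⁴⁵ + e²³⁵`, that is `(e¹⁴ + e²³) ∧ e⁵`. -/
def stdψ₃ : (Fin 5 → ℝ) [⋀^Fin 3]→L[ℝ] ℝ := e ![0, 3, 4] + e ![1, 2, 4]

/-- `stdψ₂` is the wedge product of `stdω₂` and `stdα`. -/
theorem stdψ₂_apply (x y z : Fin 5 → ℝ) :
    stdψ₂ ![x, y, z] = stdω₂ ![x, y] * stdα ![z] - stdω₂ ![x, z] * stdα ![y]
      + stdω₂ ![y, z] * stdα ![x] := by
  simp [stdψ₂, stdω₂, stdα, e_apply, Matrix.det_fin_three, Matrix.det_fin_two]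
  ring

/-- `stdψ₃` is the wedge product of `stdω₃` and `stdα`. -/
theorem stdψ₃_apply (x y z : Fin 5 → ℝ) :
    stdψ₃ ![x, y, z] = stdω₃ ![x, y] * stdα ![z] - stdω₃ ![x, z] * stdα ![y]
      + stdω₃ ![y, z] * stdα ![x] := by
  simp [stdψ₃, stdω₃, stdα, e_apply, Matrix.det_fin_three, Matrix.det_fin_two]
  ring

/-- An invertible matrix as an automorphism `v ↦ g v` of `ℝ⁵`. -/
def glEquiv (g : GL (Fin 5) ℝ) : (Fin 5 → ℝ) ≃L[ℝ] (Fin 5 → ℝ) :=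
  (Matrix.GeneralLinearGroup.toLin g).toLinearEquiv.toContinuousLinearEquiv

theorem glEquiv_apply (g : GL (Fin 5) ℝ) (v : Fin 5 → ℝ) :
    glEquiv g v = Matrix.mulVec (g : Matrix (Fin 5) (Fin 5) ℝ) v := rfl

/-- The pullback `g^* θ` of a form on `ℝ⁵` by an invertible matrix `g`. -/
def glPullback {k : ℕ} (g : GL (Fin 5) ℝ) (θ : (Fin 5 → ℝ) [⋀^Fin k]→L[ℝ] ℝ) :
    (Fin 5 → ℝ) [⋀^Fin k]→L[ℝ] ℝ :=
  θ.compContinuousLinearMap (glEquiv g : (Fin 5 → ℝ) →L[ℝ] (Fin 5 → ℝ))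

theorem glPullback_one {k : ℕ} (θ : (Fin 5 → ℝ) [⋀^Fin k]→L[ℝ] ℝ) :
    glPullback 1 θ = θ := by
  ext v
  simp only [glPullback, ContinuousAlternatingMap.compContinuousLinearMap_apply]
  congr 1
  funext i
  simp [glEquiv_apply]

theorem glPullback_mul {k : ℕ} (g h : GL (Fin 5) ℝ) (θ : (Fin 5 → ℝ) [⋀^Fin k]→L[ℝ] ℝ) :
    glPullback (g * h) θ = glPullback h (glPullback g θ) := by
  ext v
  simp only [glPullback, ContinuousAlternatingMap.compContinuousLinearMap_apply]
  congr 1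
  funext i
  simp [glEquiv_apply, Matrix.mulVec_mulVec]

/-- The stabilizer in `GL(5, ℝ)` of a form on `ℝ⁵`. -/
def stab {k : ℕ} (θ : (Fin 5 → ℝ) [⋀^Fin k]→L[ℝ] ℝ) : Subgroup (GL (Fin 5) ℝ) where
  carrier := {g | glPullback g θ = θ}
  one_mem' := glPullback_one θ
  mul_mem' := by
    intro g h hg hh
    simp only [mem_ofPred_eq] at hg hh ⊢
    rw [glPullback_mul, hg, hh]
  inv_mem' := by
    intro g hg
    simp only [mem_ofPred_eq] at hg ⊢
    conv_lhs => rw [← hg]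
    rw [← glPullback_mul, mul_inv_cancel, glPullback_one]

/-- `SU(2) ⊂ SO(4) ⊂ SO(5) ⊂ GL(5, ℝ)`, as the common stabilizer of `e⁵`, `e¹² + e³⁴`,
`e¹³ + e⁴²`, `e¹⁴ + e²³`. -/
def SU2 : Subgroup (GL (Fin 5) ℝ) := stab stdα ⊓ stab stdω₁ ⊓ stab stdω₂ ⊓ stab stdω₃

/-! ### Differential forms and frames on a `5`-manifold -/

variable (M : Type*) [TopologicalSpace M] [ChartedSpace (EuclideanSpace ℝ (Fin 5)) M]

/-- (Not necessarily smooth) differential `k`-forms on `M`. -/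
abbrev Form (k : ℕ) : Type _ := ∀ x : M, TangentSpace (𝓡 5) x [⋀^Fin k]→L[ℝ] ℝ

/-- The bundle `F` of linear frames of `M`: a point is a linear isomorphism `u : ℝ⁵ → T_x M`. -/
@[ext]
structure FrameBundle where
  /-- the base point -/
  pt : M
  /-- the frame -/
  frame : (Fin 5 → ℝ) ≃L[ℝ] TangentSpace (𝓡 5) pt

variable {M}

/-- The right action of `GL(5, ℝ)` on frames, `u g = u ∘ g`. -/
instance : HMul (FrameBundle M) (GL (Fin 5) ℝ) (FrameBundle M) where
  hMul u g := ⟨u.pt, (glEquiv g).trans u.frame⟩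

/-- The transition matrix `g` from a frame `v` to a frame `u` at the same point, `u = v g`. -/
def transition {x : M} (v u : (Fin 5 → ℝ) ≃L[ℝ] TangentSpace (𝓡 5) x) : GL (Fin 5) ℝ :=
  Matrix.GeneralLinearGroup.toLin.symm
    (LinearMap.GeneralLinearGroup.ofLinearEquiv (u.trans v.symm).toLinearEquiv)

theorem mul_transition {x : M} (v u : (Fin 5 → ℝ) ≃L[ℝ] TangentSpace (𝓡 5) x) :
    (⟨x, v⟩ : FrameBundle M) * transition v u = ⟨x, u⟩ := by
  have h : (glEquiv (transition v u)).trans v = u := by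
    ext w
    have h1 : glEquiv (transition v u) w = v.symm (u w) := by
      simp [glEquiv, transition]
    simp [h1]
  exact congrArg (FrameBundle.mk x) h

/-- The pullback of a form on `M` to `ℝ⁵` by a frame `u : ℝ⁵ → T_x M`. -/
def FrameBundle.pullback {k : ℕ} (u : FrameBundle M) (θ : Form M k) :
    (Fin 5 → ℝ) [⋀^Fin k]→L[ℝ] ℝ :=
  (θ u.pt).compContinuousLinearMap
    (u.frame : (Fin 5 → ℝ) →L[ℝ] TangentSpace (𝓡 5) u.pt)

/-- The form `θ` read in the chart `φ` of `M` at `x₀`, that is `(φ⁻¹)^* θ`. -/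
def chartForm {k : ℕ} (x₀ : M) (θ : Form M k) (y : EuclideanSpace ℝ (Fin 5)) :
    EuclideanSpace ℝ (Fin 5) [⋀^Fin k]→L[ℝ] ℝ :=
  (θ ((extChartAt (𝓡 5) x₀).symm y)).compContinuousLinearMap
    (mfderiv 𝓘(ℝ, EuclideanSpace ℝ (Fin 5)) (𝓡 5) (extChartAt (𝓡 5) x₀).symm y)

/-- The exterior derivative on `M`: at `x` it is `φ^* d ((φ⁻¹)^* θ)`, with `φ` the chart
at `x`. -/
def d {k : ℕ} (θ : Form M k) : Form M (k + 1) := fun x =>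
  (extDeriv (chartForm x θ) (extChartAt (𝓡 5) x x)).compContinuousLinearMap
    (mfderiv (𝓡 5) 𝓘(ℝ, EuclideanSpace ℝ (Fin 5)) (extChartAt (𝓡 5) x) x)

variable [IsManifold (𝓡 5) ∞ M]

/-- The frame `σ x` of `T_x M` depends smoothly on `x ∈ U`. -/
def IsSmoothFrameOn (U : Set M) (σ : ∀ x : M, (Fin 5 → ℝ) ≃L[ℝ] TangentSpace (𝓡 5) x) :
    Prop :=
  ∀ i : Fin 5, ContMDiffOn (𝓡 5) (𝓡 5).tangent ∞
    (fun x => (⟨x, σ x (Pi.single i 1)⟩ : TangentBundle (𝓡 5) M)) U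

/-- The frame `σ (t, x)` of `T_x M` depends smoothly on `(t, x) ∈ W`. -/
def IsSmoothFrameFamilyOn (W : Set (ℝ × M))
    (σ : ∀ p : ℝ × M, (Fin 5 → ℝ) ≃L[ℝ] TangentSpace (𝓡 5) p.2) : Prop :=
  ∀ i : Fin 5, ContMDiffOn (𝓘(ℝ, ℝ).prod (𝓡 5)) (𝓡 5).tangent ∞
    (fun p => (⟨p.2, σ p (Pi.single i 1)⟩ : TangentBundle (𝓡 5) M)) W

/-! ### `SU(2)`-structures -/

variable (M) in
/-- An `SU(2)`-structure on `M`: a smooth reduction `P ⊂ F` of the frame bundle to `SU(2)`. -/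
structure SU2Structure where
  /-- the set of adapted frames -/
  carrier : Set (FrameBundle M)
  nonempty : ∀ x : M, ∃ u ∈ carrier, u.pt = x
  mul_mem : ∀ u ∈ carrier, ∀ g ∈ SU2, u * g ∈ carrier
  exists_mul : ∀ u ∈ carrier, ∀ v ∈ carrier, u.pt = v.pt → ∃ g ∈ SU2, v = u * g
  smooth : ∀ x : M, ∃ U : Set M, IsOpen U ∧ x ∈ U ∧
    ∃ σ : ∀ y : M, (Fin 5 → ℝ) ≃L[ℝ] TangentSpace (𝓡 5) y,
      IsSmoothFrameOn U σ ∧ ∀ y ∈ U, (⟨y, σ y⟩ : FrameBundle M) ∈ carrier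

/-- `P t` depends smoothly on `t ∈ I`: there are local adapted frames of `P t` that depend
smoothly on `(t, x)`. -/
def IsSmoothFamily (I : Set ℝ) (P : ℝ → SU2Structure M) : Prop :=
  ∀ t₀ ∈ I, ∀ x₀ : M, ∃ W : Set (ℝ × M), IsOpen W ∧ (t₀, x₀) ∈ W ∧ W ⊆ I ×ˢ univ ∧
    ∃ σ : ∀ p : ℝ × M, (Fin 5 → ℝ) ≃L[ℝ] TangentSpace (𝓡 5) p.2,
      IsSmoothFrameFamilyOn W σ ∧
        ∀ p ∈ W, (⟨p.2, σ p⟩ : FrameBundle M) ∈ (P p.1).carrier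

namespace SU2Structure

/-- An adapted frame at `x`. -/
def someFrame (P : SU2Structure M) (x : M) : (Fin 5 → ℝ) ≃L[ℝ] TangentSpace (𝓡 5) x :=
  (P.nonempty x).choose_spec.2 ▸ (P.nonempty x).choose.frame

theorem someFrame_mem (P : SU2Structure M) (x : M) :
    (⟨x, P.someFrame x⟩ : FrameBundle M) ∈ P.carrier := by
  have key : ∀ (u : FrameBundle M) (h : u.pt = x), u ∈ P.carrier →
      (⟨x, h ▸ u.frame⟩ : FrameBundle M) ∈ P.carrier := by
    rintro u rfl hu
    exact hu
  exact key _ (P.nonempty x).choose_spec.2 (P.nonempty x).choose_spec.1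

/-- The form on `M` that every adapted frame of `P` pulls back to the `SU(2)`-invariant form
`θ` on `ℝ⁵`; see `pullback_formOf`. -/
def formOf {k : ℕ} (P : SU2Structure M) (θ : (Fin 5 → ℝ) [⋀^Fin k]→L[ℝ] ℝ) : Form M k :=
  fun x => θ.compContinuousLinearMap
    ((P.someFrame x).symm : TangentSpace (𝓡 5) x →L[ℝ] (Fin 5 → ℝ))

theorem pullback_formOf {k : ℕ} (P : SU2Structure M) (θ : (Fin 5 → ℝ) [⋀^Fin k]→L[ℝ] ℝ)
    (hθ : SU2 ≤ stab θ) (u : FrameBundle M) (hu : u ∈ P.carrier) :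
    u.pullback (P.formOf θ) = θ := by
  obtain ⟨x, v⟩ := u
  obtain ⟨g, hg, hv⟩ := P.exists_mul _ (P.someFrame_mem x) ⟨x, v⟩ hu rfl
  have hv' : v = (glEquiv g).trans (P.someFrame x) := by
    injection hv
  subst hv'
  have h : glPullback g θ = θ := hθ hg
  refine Eq.trans ?_ h
  ext v
  exact congrArg θ (funext fun i => (P.someFrame x).symm_apply_apply _)

/-- The defining `1`-form `α`. -/
def α (P : SU2Structure M) : Form M 1 := P.formOf stdα
/-- The defining `2`-form `ω₁`. -/
def ω₁ (P : SU2Structure M) : Form M 2 := P.formOf stdω₁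
/-- The defining `2`-form `ω₂`. -/
def ω₂ (P : SU2Structure M) : Form M 2 := P.formOf stdω₂
/-- The defining `2`-form `ω₃`. -/
def ω₃ (P : SU2Structure M) : Form M 2 := P.formOf stdω₃
/-- The `3`-form `ψ₂ = ω₂ ∧ α`. -/
def ψ₂ (P : SU2Structure M) : Form M 3 := P.formOf stdψ₂
/-- The `3`-form `ψ₃ = ω₃ ∧ α`. -/
def ψ₃ (P : SU2Structure M) : Form M 3 := P.formOf stdψ₃

/-- `P` is hypo: `ω₁`, `ψ₂ = ω₂ ∧ α` and `ψ₃ = ω₃ ∧ α` are closed. -/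
def IsHypo (P : SU2Structure M) : Prop := d P.ω₁ = 0 ∧ d P.ψ₂ = 0 ∧ d P.ψ₃ = 0

end SU2Structure

/-- The hypo evolution equations for `t ∈ I`:
`∂ω₁/∂t = -dα`, `∂(ω₂ ∧ α)/∂t = -dω₃`, `∂(ω₃ ∧ α)/∂t = dω₂`. -/
def HypoEvolution (I : Set ℝ) (P : ℝ → SU2Structure M) : Prop :=
  ∀ t ∈ I, ∀ x : M,
    (∀ v : Fin 2 → TangentSpace (𝓡 5) x,
      HasDerivAt (fun τ => (P τ).ω₁ x v) (-(d (P t).α x v)) t) ∧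
    (∀ v : Fin 3 → TangentSpace (𝓡 5) x,
      HasDerivAt (fun τ => (P τ).ψ₂ x v) (-(d (P t).ω₃ x v)) t) ∧
    (∀ v : Fin 3 → TangentSpace (𝓡 5) x,
      HasDerivAt (fun τ => (P τ).ψ₃ x v) (d (P t).ω₂ x v) t)

/-! ### The hypo intrinsic torsion and `Q_P` -/

/-- The components, at an adapted frame, of the hypo part of the intrinsic torsion: functions
`f`, `g`, a `1`-form `β = ∑ βᵢ eⁱ` (`i = 1, …, 4`), and forms `ω⁻`, `σ₂⁻`, `σ₃⁻` in `Λ²₋`, where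
a triple `(a, b, c)` stands for `2a(e¹² - e³⁴) + 2b(e¹³ - e⁴²) + 2c(e¹⁴ - e²³)`. -/
@[ext]
structure Torsion where
  f : ℝ
  g : ℝ
  β : Fin 4 → ℝ
  ωm : Fin 3 → ℝ
  σ₂ : Fin 3 → ℝ
  σ₃ : Fin 3 → ℝ

/-- The components `(a, b, c)` of the `Λ²₋` part of the `2`-form on `ℝ⁴` with coefficients
`C i j`, relative to `2(e¹² - e³⁴)`, `2(e¹³ - e⁴²)`, `2(e¹⁴ - e²³)`. -/
def antiSelfDual (C : Fin 5 → Fin 5 → ℝ) : Fin 3 → ℝ :=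
  ![(C 0 1 - C 2 3) / 4, (C 0 2 - C 3 1) / 4, (C 0 3 - C 1 2) / 4]

/-- The torsion components determined by forms `A`, `B₂`, `B₃` on `ℝ⁵`, which play the roles of
`dα`, `dω₂`, `dω₃`, through
`A = α ∧ β + f ω₁ + f₂ ω₂ + f₃ ω₃ + ω⁻`,
`B₂ = γ₂ ∧ ω₂ + α ∧ (λ ω₂ - g₃ ω₁ + g ω₃ + σ₂⁻)`,
`B₃ = γ₃ ∧ ω₃ + α ∧ (λ ω₃ - g ω₂ + g₂ ω₁ + σ₃⁻)`,
where `β`, `γ₂`, `γ₃` are combinations of `e¹, …, e⁴`. For a hypo structure these become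
`dα = α ∧ β + f ω₁ + ω⁻`, `dω₂ = β ∧ ω₂ + g α ∧ ω₃ + α ∧ σ₂⁻`,
`dω₃ = β ∧ ω₃ - g α ∧ ω₂ + α ∧ σ₃⁻`. -/
def torsionOf (A : (Fin 5 → ℝ) [⋀^Fin 2]→L[ℝ] ℝ) (B₂ B₃ : (Fin 5 → ℝ) [⋀^Fin 3]→L[ℝ] ℝ) :
    Torsion :=
  let ε : Fin 5 → Fin 5 → ℝ := fun i => Pi.single i 1
  let a : Fin 5 → Fin 5 → ℝ := fun i j => A ![ε i, ε j]
  let b₂ : Fin 5 → Fin 5 → ℝ := fun i j => B₂ ![ε 4, ε i, ε j]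
  let b₃ : Fin 5 → Fin 5 → ℝ := fun i j => B₃ ![ε 4, ε i, ε j]
  { f := (a 0 1 + a 2 3) / 2
    g := (b₂ 0 3 + b₂ 1 2) / 2
    β := fun j => a 4 j.castSucc
    ωm := antiSelfDual a
    σ₂ := antiSelfDual b₂
    σ₃ := antiSelfDual b₃ }

/-- The intrinsic torsion components of `P` at the frame `u` (meaningful for `u ∈ P`). -/
def SU2Structure.torsion (P : SU2Structure M) (u : FrameBundle M) : Torsion :=
  torsionOf (u.pullback (d P.α)) (u.pullback (d P.ω₂)) (u.pullback (d P.ω₃))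

/-- The almost complex structure `J₁` on `1`-forms of `ℝ⁴`, determined by
`γ ∧ ω₂ = J₁γ ∧ ω₃`; thus `J₁e¹ = e²`, `J₁e² = -e¹`, `J₁e³ = e⁴`, `J₁e⁴ = -e³`. -/
def J₁ (γ : Fin 4 → ℝ) : Fin 4 → ℝ := ![-γ 1, γ 0, -γ 3, γ 2]

/-- The symmetric `5 × 5` matrix built from the torsion components, with upper left `4 × 4` block
`-(f/2) id + Q̃`, last column `(J₁β, f + g)` and last row its transpose. -/
def Torsion.matrix (T : Torsion) : Matrix (Fin 5) (Fin 5) ℝ :=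
  let wa := T.ωm 0
  let wb := T.ωm 1
  let wc := T.ωm 2
  let ya := T.σ₂ 0
  let yb := T.σ₂ 1
  let yc := T.σ₂ 2
  let za := T.σ₃ 0
  let zb := T.σ₃ 1
  let zc := T.σ₃ 2
  let h := T.f / 2
  let j := J₁ T.β
  !![-h + (yc - zb - wa), yb + zc, -ya - wc, -za + wb, j 0;
     yb + zc, -h + (-yc + zb - wa), -za - wb, ya - wc, j 1;
     -ya - wc, -za - wb, -h + (-yc - zb + wa), yb - zc, j 2;
     -za + wb, ya - wc, yb - zc, -h + (yc + zb + wa), j 3;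
     j 0, j 1, j 2, j 3, T.f + T.g]

/-- `Q_P : F → gl(5, ℝ)`: the `GL(5, ℝ)`-equivariant extension to `F` of the `SU(2)`-equivariant
map `u ↦ (P.torsion u).matrix` on `P`. A frame `u` is written as `u = v g` with `v ∈ P`, and
`Q_P(u) = g⁻¹ Q_P(v) g`. -/
def Q (P : SU2Structure M) (u : FrameBundle M) : Matrix (Fin 5) (Fin 5) ℝ :=
  let v := P.someFrame u.pt
  let g := transition v u.frame
  ((g⁻¹ : GL (Fin 5) ℝ) : Matrix (Fin 5) (Fin 5) ℝ) * (P.torsion ⟨u.pt, v⟩).matrix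
    * (g : Matrix (Fin 5) (Fin 5) ℝ)

/-! ### Gauge transformations -/

variable (M) in
/-- A gauge transformation: a smooth `GL(5, ℝ)`-equivariant map `s : F → GL(5, ℝ)`, where
`GL(5, ℝ)` acts on itself by conjugation. By equivariance, `s` is smooth on `F` exactly when
`s ∘ σ` is smooth for every smooth local frame `σ`. -/
structure GaugeTransformation where
  toFun : FrameBundle M → GL (Fin 5) ℝ
  equivariant : ∀ u g, toFun (u * g) = g⁻¹ * toFun u * g
  smooth : ∀ U : Set M, IsOpen U → ∀ σ, IsSmoothFrameOn U σ → ∀ i j : Fin 5,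
    ContMDiffOn (𝓡 5) 𝓘(ℝ, ℝ) ∞
      (fun x => (toFun ⟨x, σ x⟩ : Matrix (Fin 5) (Fin 5) ℝ) i j) U

instance : CoeFun (GaugeTransformation M) (fun _ => FrameBundle M → GL (Fin 5) ℝ) where
  coe s := s.toFun

/-- `s t` depends smoothly on `t ∈ I`, jointly with the frame. -/
def IsSmoothGaugeFamily (I : Set ℝ) (s : ℝ → GaugeTransformation M) : Prop :=
  ∀ U : Set M, IsOpen U → ∀ σ, IsSmoothFrameOn U σ → ∀ i j : Fin 5,
    ContMDiffOn (𝓘(ℝ, ℝ).prod (𝓡 5)) 𝓘(ℝ, ℝ) ∞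
      (fun p : ℝ × M => (s p.1 ⟨p.2, σ p.2⟩ : Matrix (Fin 5) (Fin 5) ℝ) i j) (I ×ˢ U)

end Hypo

end

/-! The theorem rests on the infinitesimal action of `gl(5, ℝ)` on forms on `ℝ⁵`. A matrix that
annihilates `ω₁`, `ω₂ ∧ α` and `ω₃ ∧ α` lies in `su(2)` and is in particular antisymmetric
(`lieAct_eq_zero`), so a symmetric matrix is determined by its action on these three forms
(`eq_of_lieAct_eq`). In an adapted coframe the exterior derivatives of all defining forms are linear
in the first derivative of the coframe. Modulo the hypo conditions, linear algebra shows that the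
torsion matrix is the symmetric matrix acting on the three forms by `-dα`, `-dω₃`, `dω₂`
(`lieAct_torsion_matrix`). Thus `Q` is the infinitesimal deformation prescribed by the evolution
equations. As `SU(2)` is orthogonal, conjugation by it preserves symmetry, and uniqueness identifies
the equivariant extension `Q` with the torsion matrix on all of `P` (`Q_eq`).

Suppose that the evolution equations hold. For each frame `u` solve `S' = -Q(u) S`, `S(0) = 1`. The
family `P t` is given, so this is a linear equation with known coefficients: it is solvable on all
of `I`, its solutions are smooth in the frame (`contDiffOn_solution_nat`), and they are equivariant
by uniqueness. To see that `u S_t` is adapted to `P t` when `u` is adapted to `P 0`, take near any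
time a path `v` of adapted frames and write `(v⁻¹u)' = -X v⁻¹u`. The evolution equations say that `X
+ Q(v)` annihilates the three forms, hence lies in `su(2)`. The path `B = v⁻¹ u S` satisfies `B' =
-(X + Q(v)) B`, so the pullbacks of the defining forms by `u S_t` do not change with `t`
(`IsGaugeSolution.mul_mem`).

Conversely, if `P t` is swept out by `u s_t`, then `v = u s_t` is itself an adapted path, for which
`X = -Q(v)`. The derivatives of the defining forms are then given by the action of `Q`, which is the
right-hand side of the evolution equations (`evolution_of_gauge`). -/

noncomputable section

namespace Hypo

/-! ### The infinitesimal action of matrices on forms -/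

/-- The standard basis vector of `ℝ⁵`. -/
abbrev bv (i : Fin 5) : Fin 5 → ℝ := Pi.single i 1

/-- The infinitesimal action of a matrix `X` on a form `θ` on `ℝ⁵`,
`(v₁, …, vₖ) ↦ ∑ⱼ θ(v₁, …, X vⱼ, …, vₖ)`. -/
def lieAct {k : ℕ} (X : Matrix (Fin 5) (Fin 5) ℝ) (θ : (Fin 5 → ℝ) [⋀^Fin k]→L[ℝ] ℝ) :
    (Fin 5 → ℝ) [⋀^Fin k]→L[ℝ] ℝ :=
  θ.fderivCompContinuousLinearMap (.id ℝ _) (X.mulVecLin.toContinuousLinearMap)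

/-- The exterior derivative of `A^* θ` at a point, for a constant form `θ` and an `ℝ⁵`-valued
coframe `A` whose derivative is `N`. -/
def coframeD {k : ℕ} (N : (Fin 5 → ℝ) →L[ℝ] (Fin 5 → ℝ) →L[ℝ] (Fin 5 → ℝ))
    (θ : (Fin 5 → ℝ) [⋀^Fin k]→L[ℝ] ℝ) : (Fin 5 → ℝ) [⋀^Fin (k + 1)]→L[ℝ] ℝ :=
  .alternatizeUncurryFin (θ.fderivCompContinuousLinearMap (.id ℝ _) ∘L N)

theorem lieAct_apply {k : ℕ} (X : Matrix (Fin 5) (Fin 5) ℝ)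
    (θ : (Fin 5 → ℝ) [⋀^Fin k]→L[ℝ] ℝ) (v : Fin k → Fin 5 → ℝ) :
    lieAct X θ v = ∑ j, θ (Function.update v j (X.mulVec (v j))) := by
  simp only [lieAct, ContinuousAlternatingMap.fderivCompContinuousLinearMap_apply]
  refine Finset.sum_congr rfl fun j _ => congrArg θ (funext fun i => ?_)
  by_cases h : i = j
  · subst h; simp
  · simp [h]

section update
variable {α : Type*} (x y z a : α)

theorem update_one_zero : Function.update ![x] 0 a = ![a] := by
  ext i; fin_cases i; rfl

theorem update_two_zero : Function.update ![x, y] 0 a = ![a, y] := by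
  ext i; fin_cases i <;> rfl

theorem update_two_one : Function.update ![x, y] 1 a = ![x, a] := by
  ext i; fin_cases i <;> rfl

theorem update_three_zero : Function.update ![x, y, z] 0 a = ![a, y, z] := by
  ext i; fin_cases i <;> rfl

theorem update_three_one : Function.update ![x, y, z] 1 a = ![x, a, z] := by
  ext i; fin_cases i <;> rfl

theorem update_three_two : Function.update ![x, y, z] 2 a = ![x, y, a] := by
  ext i; fin_cases i <;> rfl

end update

theorem lieAct_apply_one (X : Matrix (Fin 5) (Fin 5) ℝ)
    (θ : (Fin 5 → ℝ) [⋀^Fin 1]→L[ℝ] ℝ) (x : Fin 5 → ℝ) :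
    lieAct X θ ![x] = θ ![X.mulVec x] := by
  rw [lieAct_apply]
  simp [update_one_zero]

theorem lieAct_apply_two (X : Matrix (Fin 5) (Fin 5) ℝ)
    (θ : (Fin 5 → ℝ) [⋀^Fin 2]→L[ℝ] ℝ) (x y : Fin 5 → ℝ) :
    lieAct X θ ![x, y] = θ ![X.mulVec x, y] + θ ![x, X.mulVec y] := by
  rw [lieAct_apply]
  simp [Fin.sum_univ_two, update_two_zero, update_two_one]

theorem lieAct_apply_three (X : Matrix (Fin 5) (Fin 5) ℝ)
    (θ : (Fin 5 → ℝ) [⋀^Fin 3]→L[ℝ] ℝ) (x y z : Fin 5 → ℝ) :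
    lieAct X θ ![x, y, z] =
      θ ![X.mulVec x, y, z] + θ ![x, X.mulVec y, z] + θ ![x, y, X.mulVec z] := by
  rw [lieAct_apply]
  simp [Fin.sum_univ_three, update_three_zero, update_three_one, update_three_two]

/-- By the product rule the derivative falls on one slot of `θ` at a time: `i` is the direction of
differentiation and `j` the slot that is differentiated. -/
theorem coframeD_apply {k : ℕ} (N : (Fin 5 → ℝ) →L[ℝ] (Fin 5 → ℝ) →L[ℝ] (Fin 5 → ℝ))
    (θ : (Fin 5 → ℝ) [⋀^Fin k]→L[ℝ] ℝ) (v : Fin (k + 1) → Fin 5 → ℝ) :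
    coframeD N θ v =
      ∑ i, (-1) ^ i.val • ∑ j, θ (Function.update (i.removeNth v) j
        (N (v i) (i.removeNth v j))) := by
  simp only [coframeD, ContinuousAlternatingMap.alternatizeUncurryFin_apply,
    ContinuousLinearMap.comp_apply, ContinuousAlternatingMap.fderivCompContinuousLinearMap_apply]
  refine Finset.sum_congr rfl fun i _ => ?_
  congr 1
  refine Finset.sum_congr rfl fun j _ => congrArg θ (funext fun l => ?_)
  by_cases h : l = j
  · subst h; simp
  · simp [h]

variable (N : (Fin 5 → ℝ) →L[ℝ] (Fin 5 → ℝ) →L[ℝ] (Fin 5 → ℝ))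

theorem coframeD_apply_one (θ : (Fin 5 → ℝ) [⋀^Fin 1]→L[ℝ] ℝ) (x y : Fin 5 → ℝ) :
    coframeD N θ ![x, y] = θ ![N x y] - θ ![N y x] := by
  have h0 : (0 : Fin 2).removeNth ![x, y] = ![y] := by ext i; fin_cases i; rfl
  have h1 : (1 : Fin 2).removeNth ![x, y] = ![x] := by ext i; fin_cases i; rfl
  rw [coframeD_apply]
  simp [Fin.sum_univ_two, h0, h1, update_one_zero, sub_eq_add_neg]

theorem coframeD_apply_two (θ : (Fin 5 → ℝ) [⋀^Fin 2]→L[ℝ] ℝ) (x y z : Fin 5 → ℝ) :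
    coframeD N θ ![x, y, z] =
      (θ ![N x y, z] + θ ![y, N x z]) - (θ ![N y x, z] + θ ![x, N y z])
        + (θ ![N z x, y] + θ ![x, N z y]) := by
  have h0 : (0 : Fin 3).removeNth ![x, y, z] = ![y, z] := by ext i; fin_cases i <;> rfl
  have h1 : (1 : Fin 3).removeNth ![x, y, z] = ![x, z] := by ext i; fin_cases i <;> rfl
  have h2 : (2 : Fin 3).removeNth ![x, y, z] = ![x, y] := by ext i; fin_cases i <;> rfl
  rw [coframeD_apply]
  simp [Fin.sum_univ_two, Fin.sum_univ_three, h0, h1, h2, update_two_zero, update_two_one]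
  ring

theorem coframeD_apply_three (θ : (Fin 5 → ℝ) [⋀^Fin 3]→L[ℝ] ℝ) (x y z w : Fin 5 → ℝ) :
    coframeD N θ ![x, y, z, w] =
      (θ ![N x y, z, w] + θ ![y, N x z, w] + θ ![y, z, N x w])
        - (θ ![N y x, z, w] + θ ![x, N y z, w] + θ ![x, z, N y w])
        + (θ ![N z x, y, w] + θ ![x, N z y, w] + θ ![x, y, N z w])
        - (θ ![N w x, y, z] + θ ![x, N w y, z] + θ ![x, y, N w z]) := by
  have h0 : (0 : Fin 4).removeNth ![x, y, z, w] = ![y, z, w] := by ext i; fin_cases i <;> rfl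
  have h1 : (1 : Fin 4).removeNth ![x, y, z, w] = ![x, z, w] := by ext i; fin_cases i <;> rfl
  have h2 : (2 : Fin 4).removeNth ![x, y, z, w] = ![x, y, w] := by ext i; fin_cases i <;> rfl
  have h3 : (3 : Fin 4).removeNth ![x, y, z, w] = ![x, y, z] := by ext i; fin_cases i <;> rfl
  rw [coframeD_apply]
  simp [Fin.sum_univ_four, Fin.sum_univ_three, h0, h1, h2, h3, pow_succ, update_three_zero,
    update_three_one, update_three_two]
  ring

theorem stdα_vec (x : Fin 5 → ℝ) : stdα ![x] = x 4 := by
  simp [stdα, e_apply]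

theorem stdω₁_vec (x y : Fin 5 → ℝ) :
    stdω₁ ![x, y] = x 0 * y 1 - x 1 * y 0 + (x 2 * y 3 - x 3 * y 2) := by
  simp [stdω₁, e_apply, Matrix.det_fin_two]

theorem stdω₂_vec (x y : Fin 5 → ℝ) :
    stdω₂ ![x, y] = x 0 * y 2 - x 2 * y 0 + (x 3 * y 1 - x 1 * y 3) := by
  simp [stdω₂, e_apply, Matrix.det_fin_two]

theorem stdω₃_vec (x y : Fin 5 → ℝ) :
    stdω₃ ![x, y] = x 0 * y 3 - x 3 * y 0 + (x 1 * y 2 - x 2 * y 1) := by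
  simp [stdω₃, e_apply, Matrix.det_fin_two]

/-- Two alternating `2`-forms on `ℝ⁵` agree if they agree on increasing pairs of basis vectors. -/
theorem ext_two {f g : (Fin 5 → ℝ) [⋀^Fin 2]→L[ℝ] ℝ}
    (h : ∀ i j : Fin 5, i < j → f ![bv i, bv j] = g ![bv i, bv j]) : f = g := by
  apply ContinuousAlternatingMap.toAlternatingMap_injective
  refine Module.Basis.ext_alternating (Pi.basisFun ℝ (Fin 5)) fun v hv => ?_
  have key : ∀ v : Fin 2 → Fin 5, Function.Injective v →
      ∃ σ : Equiv.Perm (Fin 2), v (σ 0) < v (σ 1) := by decide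
  obtain ⟨σ, hσ⟩ := key v hv
  have h' := h _ _ hσ
  have hvec : ![bv (v (σ 0)), bv (v (σ 1))] =
      (fun i => Pi.basisFun ℝ (Fin 5) (v i)) ∘ σ := by
    funext i; fin_cases i <;> simp [bv]
  rw [hvec] at h'
  -- Sorting the arguments multiplies both forms by the same sign, which can be cancelled.
  have hf := f.toAlternatingMap.map_perm (fun i => Pi.basisFun ℝ (Fin 5) (v i)) σ
  have hg := g.toAlternatingMap.map_perm (fun i => Pi.basisFun ℝ (Fin 5) (v i)) σ
  have := hf.symm.trans (Eq.trans h' hg)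
  exact (MulAction.injective (Equiv.Perm.sign σ)) this

/-- Two alternating `3`-forms on `ℝ⁵` agree if they agree on increasing triples of basis
vectors. -/
theorem ext_three {f g : (Fin 5 → ℝ) [⋀^Fin 3]→L[ℝ] ℝ}
    (h : ∀ i j l : Fin 5, i < j → j < l → f ![bv i, bv j, bv l] = g ![bv i, bv j, bv l]) :
    f = g := by
  apply ContinuousAlternatingMap.toAlternatingMap_injective
  refine Module.Basis.ext_alternating (Pi.basisFun ℝ (Fin 5)) fun v hv => ?_
  obtain ⟨σ, hσ, hσ'⟩ : ∃ σ : Equiv.Perm (Fin 3), v (σ 0) < v (σ 1) ∧ v (σ 1) < v (σ 2) := by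
    have hm := (Tuple.monotone_sort v).strictMono_of_injective
      (hv.comp (Tuple.sort v).injective)
    exact ⟨Tuple.sort v, hm (by decide), hm (by decide)⟩
  have h' := h _ _ _ hσ hσ'
  have hvec : ![bv (v (σ 0)), bv (v (σ 1)), bv (v (σ 2))] =
      (fun i => Pi.basisFun ℝ (Fin 5) (v i)) ∘ σ := by
    funext i; fin_cases i <;> simp [bv]
  rw [hvec] at h'
  have hf := f.toAlternatingMap.map_perm (fun i => Pi.basisFun ℝ (Fin 5) (v i)) σ
  have hg := g.toAlternatingMap.map_perm (fun i => Pi.basisFun ℝ (Fin 5) (v i)) σ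
  have := hf.symm.trans (Eq.trans h' hg)
  exact (MulAction.injective (Equiv.Perm.sign σ)) this

end Hypo

end

/-! ### Linear algebra of the three evolving forms -/

noncomputable section

namespace Hypo

variable (N : (Fin 5 → ℝ) →L[ℝ] (Fin 5 → ℝ) →L[ℝ] (Fin 5 → ℝ))

theorem forall_lt_fin_five {p : Fin 5 → Fin 5 → Prop} :
    (∀ i j, i < j → p i j) ↔ p 0 1 ∧ p 0 2 ∧ p 0 3 ∧ p 0 4 ∧ p 1 2 ∧ p 1 3 ∧ p 1 4 ∧ p 2 3 ∧
      p 2 4 ∧ p 3 4 := by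
  refine ⟨fun h => ⟨h _ _ ?_, h _ _ ?_, h _ _ ?_, h _ _ ?_, h _ _ ?_, h _ _ ?_, h _ _ ?_,
    h _ _ ?_, h _ _ ?_, h _ _ ?_⟩, ?_⟩
  on_goal 11 =>
    rintro ⟨h1, h2, h3, h4, h5, h6, h7, h8, h9, h10⟩ i j hij
    fin_cases i <;> fin_cases j <;> first | assumption | exact absurd hij (by decide)
  all_goals decide

theorem forall_lt_lt_fin_five {p : Fin 5 → Fin 5 → Fin 5 → Prop} :
    (∀ i j l, i < j → j < l → p i j l) ↔ p 0 1 2 ∧ p 0 1 3 ∧ p 0 1 4 ∧ p 0 2 3 ∧ p 0 2 4 ∧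
      p 0 3 4 ∧ p 1 2 3 ∧ p 1 2 4 ∧ p 1 3 4 ∧ p 2 3 4 := by
  refine ⟨fun h => ⟨h _ _ _ ?_ ?_, h _ _ _ ?_ ?_, h _ _ _ ?_ ?_, h _ _ _ ?_ ?_, h _ _ _ ?_ ?_,
    h _ _ _ ?_ ?_, h _ _ _ ?_ ?_, h _ _ _ ?_ ?_, h _ _ _ ?_ ?_, h _ _ _ ?_ ?_⟩, ?_⟩
  on_goal 21 =>
    rintro ⟨h1, h2, h3, h4, h5, h6, h7, h8, h9, h10⟩ i j l hij hjl
    fin_cases i <;> fin_cases j <;> try exact absurd hij (by decide)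
    all_goals fin_cases l <;> first | assumption | exact absurd hjl (by decide)
  all_goals decide

theorem mulVec_bv (X : Matrix (Fin 5) (Fin 5) ℝ) (i j : Fin 5) : X.mulVec (bv i) j = X j i := by
  simp

theorem stdψ₂_vec (x y z : Fin 5 → ℝ) : stdψ₂ ![x, y, z] =
    (x 0 * y 2 - x 2 * y 0 + (x 3 * y 1 - x 1 * y 3)) * z 4
    - (x 0 * z 2 - x 2 * z 0 + (x 3 * z 1 - x 1 * z 3)) * y 4
    + (y 0 * z 2 - y 2 * z 0 + (y 3 * z 1 - y 1 * z 3)) * x 4 := by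
  rw [stdψ₂_apply]; simp only [stdω₂_vec, stdα_vec]

theorem stdψ₃_vec (x y z : Fin 5 → ℝ) : stdψ₃ ![x, y, z] =
    (x 0 * y 3 - x 3 * y 0 + (x 1 * y 2 - x 2 * y 1)) * z 4
    - (x 0 * z 3 - x 3 * z 0 + (x 1 * z 2 - x 2 * z 1)) * y 4
    + (y 0 * z 3 - y 3 * z 0 + (y 1 * z 2 - y 2 * z 1)) * x 4 := by
  rw [stdψ₃_apply]; simp only [stdω₃_vec, stdα_vec]

/-- A matrix annihilating `ω₁`, `ω₂ ∧ α` and `ω₃ ∧ α` is antisymmetric and annihilates `α`, `ω₂`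
and `ω₃`, that is, it lies in `su(2)`. -/
theorem lieAct_eq_zero {X : Matrix (Fin 5) (Fin 5) ℝ} (h₁ : lieAct X stdω₁ = 0)
    (h₂ : lieAct X stdψ₂ = 0) (h₃ : lieAct X stdψ₃ = 0) :
    X.transpose = -X ∧ lieAct X stdα = 0 ∧ lieAct X stdω₂ = 0 ∧ lieAct X stdω₃ = 0 := by
  have e₁ := forall_lt_fin_five.1 fun i j _ => congrArg (fun θ => θ ![bv i, bv j]) h₁
  have e₂ := forall_lt_lt_fin_five.1 fun i j l _ _ =>
    congrArg (fun θ => θ ![bv i, bv j, bv l]) h₂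
  have e₃ := forall_lt_lt_fin_five.1 fun i j l _ _ =>
    congrArg (fun θ => θ ![bv i, bv j, bv l]) h₃
  -- The components form a homogeneous linear system in the entries of `X`; every claim below is a
  -- linear consequence of it.
  simp [lieAct_apply_two, lieAct_apply_three, stdω₁_vec, stdψ₂_vec, stdψ₃_vec] at e₁ e₂ e₃
  obtain ⟨a1, a2, a3, a4, a5, a6, a7, a8, a9, a10⟩ := e₁
  obtain ⟨b1, b2, b3, b4, b5, b6, b7, b8, b9⟩ := e₂
  obtain ⟨c1, c2, c3, c4, c5, c6, c7, c8, c9⟩ := e₃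
  refine ⟨?_, ?_, ?_, ?_⟩
  · ext i j
    simp only [Matrix.transpose_apply, Matrix.neg_apply]
    fin_cases i <;> fin_cases j <;> simp <;> linarith
  · ext v
    have hv : v = ![v 0] := by ext i; fin_cases i; rfl
    have h4 : ∀ j, X 4 j = 0 := by
      intro j
      fin_cases j <;> simp <;> linarith
    rw [hv, lieAct_apply_one, stdα_vec]
    simp [Matrix.mulVec, dotProduct, h4]
  · refine ext_two (forall_lt_fin_five.2 ?_)
    simp [lieAct_apply_two, stdω₂_vec]
    refine ⟨?_, ?_, ?_, ?_, ?_, ?_, ?_, ?_, ?_, ?_⟩ <;> linarith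
  · refine ext_two (forall_lt_fin_five.2 ?_)
    simp [lieAct_apply_two, stdω₃_vec]
    refine ⟨?_, ?_, ?_, ?_, ?_, ?_, ?_, ?_, ?_, ?_⟩ <;> linarith

set_option maxHeartbeats 1000000 in
/-- The matrix of the torsion of a coframe of a hypo structure acts on `ω₁`, `ω₂ ∧ α`, `ω₃ ∧ α`
as prescribed by the hypo evolution equations. -/
theorem lieAct_torsion_matrix (h₁ : coframeD N stdω₁ = 0) (h₂ : coframeD N stdψ₂ = 0)
    (h₃ : coframeD N stdψ₃ = 0) {X : Matrix (Fin 5) (Fin 5) ℝ}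
    (hX : X = (torsionOf (coframeD N stdα) (coframeD N stdω₂) (coframeD N stdω₃)).matrix) :
    X.transpose = X ∧ lieAct X stdω₁ = -coframeD N stdα ∧ lieAct X stdψ₂ = -coframeD N stdω₃ ∧
      lieAct X stdψ₃ = coframeD N stdω₂ := by
  have e₁ := forall_lt_lt_fin_five.1 fun i j l _ _ =>
    congrArg (fun θ => θ ![bv i, bv j, bv l]) h₁
  have e₂ : ∀ i j l m : Fin 5, coframeD N stdψ₂ ![bv i, bv j, bv l, bv m] = 0 := by simp [h₂]
  have e₃ : ∀ i j l m : Fin 5, coframeD N stdψ₃ ![bv i, bv j, bv l, bv m] = 0 := by simp [h₃]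
  -- A `4`-form on `ℝ⁵` has five independent components, one for each omitted index.
  have b1 := e₂ 0 1 2 3
  have b2 := e₂ 0 1 2 4
  have b3 := e₂ 0 1 3 4
  have b4 := e₂ 0 2 3 4
  have b5 := e₂ 1 2 3 4
  have c1 := e₃ 0 1 2 3
  have c2 := e₃ 0 1 2 4
  have c3 := e₃ 0 1 3 4
  have c4 := e₃ 0 2 3 4
  have c5 := e₃ 1 2 3 4
  simp [coframeD_apply_two, coframeD_apply_three, stdω₁_vec, stdψ₂_vec, stdψ₃_vec]
    at e₁ b1 b2 b3 b4 b5 c1 c2 c3 c4 c5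
  obtain ⟨a1, a2, a3, a4, a5, a6, a7, a8, a9, a10⟩ := e₁
  simp [torsionOf, Torsion.matrix, antiSelfDual, coframeD_apply_one, coframeD_apply_two,
    stdα_vec, stdω₂_vec, stdω₃_vec, J₁] at hX
  clear e₂ e₃ h₁ h₂ h₃
  -- Only the values of `N` on basis vectors matter. Treated as independent unknowns, they make
  -- hypotheses and goals linear, and each goal is a linear combination of the hypo equations.
  obtain ⟨n, hn⟩ : ∃ n : Fin 5 → Fin 5 → Fin 5 → ℝ, ∀ a b i,
    N (Pi.single a 1) (Pi.single b 1) i = n a b i := ⟨_, fun _ _ _ => rfl⟩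
  simp only [hn] at a1 a2 a3 a4 a5 a6 a7 a8 a9 a10 b1 b2 b3 b4 b5 c1 c2 c3 c4 c5 hX
  refine ⟨?_, ?_, ?_, ?_⟩
  · subst hX
    ext i j
    fin_cases i <;> fin_cases j <;> rfl
  · refine ext_two (forall_lt_fin_five.2 ?_)
    subst hX
    simp [lieAct_apply_two, stdω₁_vec, coframeD_apply_one, stdα_vec, hn]
    and_intros <;> linarith
  · refine ext_three (forall_lt_lt_fin_five.2 ?_)
    subst hX
    simp [lieAct_apply_three, stdψ₂_vec, coframeD_apply_two, stdω₃_vec, hn]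
    and_intros <;> linarith
  · refine ext_three (forall_lt_lt_fin_five.2 ?_)
    subst hX
    simp [lieAct_apply_three, stdψ₃_vec, coframeD_apply_two, stdω₂_vec, hn]
    and_intros <;> linarith

end Hypo

end

/-! ### Equivariance of the action, and orthogonality of `SU(2)` -/

noncomputable section

namespace Hypo

theorem lieAct_add {k : ℕ} (X Y : Matrix (Fin 5) (Fin 5) ℝ)
    (θ : (Fin 5 → ℝ) [⋀^Fin k]→L[ℝ] ℝ) : lieAct (X + Y) θ = lieAct X θ + lieAct Y θ := by
  have h : (X + Y).mulVecLin.toContinuousLinearMap =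
      X.mulVecLin.toContinuousLinearMap + Y.mulVecLin.toContinuousLinearMap := by
    ext v i; simp
  rw [lieAct, h, map_add]; rfl

theorem lieAct_neg {k : ℕ} (X : Matrix (Fin 5) (Fin 5) ℝ)
    (θ : (Fin 5 → ℝ) [⋀^Fin k]→L[ℝ] ℝ) : lieAct (-X) θ = -lieAct X θ := by
  have h : (-X).mulVecLin.toContinuousLinearMap = -X.mulVecLin.toContinuousLinearMap := by
    ext v i; simp
  rw [lieAct, h, map_neg]; rfl

theorem lieAct_sub {k : ℕ} (X Y : Matrix (Fin 5) (Fin 5) ℝ)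
    (θ : (Fin 5 → ℝ) [⋀^Fin k]→L[ℝ] ℝ) : lieAct (X - Y) θ = lieAct X θ - lieAct Y θ := by
  rw [sub_eq_add_neg, lieAct_add, lieAct_neg, sub_eq_add_neg]

theorem glPullback_apply {k : ℕ} (g : GL (Fin 5) ℝ) (θ : (Fin 5 → ℝ) [⋀^Fin k]→L[ℝ] ℝ)
    (v : Fin k → Fin 5 → ℝ) :
    glPullback g θ v = θ fun i => (g : Matrix (Fin 5) (Fin 5) ℝ).mulVec (v i) := rfl

theorem glPullback_neg {k : ℕ} (g : GL (Fin 5) ℝ) (θ : (Fin 5 → ℝ) [⋀^Fin k]→L[ℝ] ℝ) :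
    glPullback g (-θ) = -glPullback g θ := rfl

/-- Inserting `g g⁻¹` in front of `X` in the differentiated slot moves `g` past `X`. When `g`
stabilizes `θ`, this turns conjugation of matrices into pullback of the resulting forms. -/
theorem glPullback_lieAct {k : ℕ} (g : GL (Fin 5) ℝ) (X : Matrix (Fin 5) (Fin 5) ℝ)
    (θ : (Fin 5 → ℝ) [⋀^Fin k]→L[ℝ] ℝ) :
    glPullback g (lieAct X θ) =
      lieAct ((g⁻¹ : GL (Fin 5) ℝ).val * X * g.val) (glPullback g θ) := by
  ext v
  rw [glPullback_apply, lieAct_apply, lieAct_apply]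
  refine Finset.sum_congr rfl fun j _ => ?_
  rw [glPullback_apply]
  refine congrArg θ (funext fun i => ?_)
  by_cases h : i = j
  · subst h
    simp only [Function.update_self, Matrix.mulVec_mulVec]
    rw [← mul_assoc, ← mul_assoc, ← Units.val_mul, mul_inv_cancel, Units.val_one, one_mul]
  · simp [h]

/-- The matrix of a `2`-form on `ℝ⁵`. -/
def formMatrix (θ : (Fin 5 → ℝ) [⋀^Fin 2]→L[ℝ] ℝ) : Matrix (Fin 5) (Fin 5) ℝ :=
  Matrix.of fun i j => θ ![bv i, bv j]

theorem formMatrix_stdω₁ : formMatrix stdω₁ =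
    !![0, 1, 0, 0, 0; -1, 0, 0, 0, 0; 0, 0, 0, 1, 0; 0, 0, -1, 0, 0; 0, 0, 0, 0, 0] := by
  ext i j
  fin_cases i <;> fin_cases j <;> simp [formMatrix, stdω₁_vec]

theorem formMatrix_stdω₂ : formMatrix stdω₂ =
    !![0, 0, 1, 0, 0; 0, 0, 0, -1, 0; -1, 0, 0, 0, 0; 0, 1, 0, 0, 0; 0, 0, 0, 0, 0] := by
  ext i j
  fin_cases i <;> fin_cases j <;> simp [formMatrix, stdω₂_vec]

theorem formMatrix_stdω₃ : formMatrix stdω₃ =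
    !![0, 0, 0, 1, 0; 0, 0, 1, 0, 0; 0, -1, 0, 0, 0; -1, 0, 0, 0, 0; 0, 0, 0, 0, 0] := by
  ext i j
  fin_cases i <;> fin_cases j <;> simp [formMatrix, stdω₃_vec]

theorem apply_eq_dotProduct_formMatrix (θ : (Fin 5 → ℝ) [⋀^Fin 2]→L[ℝ] ℝ) (x y : Fin 5 → ℝ) :
    θ ![x, y] = x ⬝ᵥ (formMatrix θ).mulVec y := by
  have hx : ![x, y] = ![∑ i, x i • bv i, ∑ j, y j • bv j] := by
    congr 1
    · ext i; simp [Pi.single_apply]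
    · congr 1; ext i; simp [Pi.single_apply]
  have h1 : ∀ z : Fin 5 → ℝ, θ ![∑ i, x i • bv i, z] = ∑ i, x i * θ ![bv i, z] := by
    intro z
    have hL : ∀ w, θ.toContinuousMultilinearMap.toMultilinearMap.toLinearMap ![0, z] 0 w
        = θ ![w, z] := fun w => congrArg θ (update_two_zero _ _ _)
    rw [← hL, map_sum]
    simp only [map_smul, smul_eq_mul]
    simp only [hL]
  have h2 : ∀ z : Fin 5 → ℝ, θ ![z, ∑ i, y i • bv i] = ∑ i, y i * θ ![z, bv i] := by
    intro z
    have hL : ∀ w, θ.toContinuousMultilinearMap.toMultilinearMap.toLinearMap ![z, 0] 1 w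
        = θ ![z, w] := fun w => congrArg θ (update_two_one _ _ _)
    rw [← hL, map_sum]
    simp only [map_smul, smul_eq_mul]
    simp only [hL]
  rw [hx, h1]
  simp only [h2, dotProduct, Matrix.mulVec, formMatrix, Matrix.of_apply]
  refine Finset.sum_congr rfl fun i _ => ?_
  congr 1
  exact Finset.sum_congr rfl fun j _ => mul_comm _ _

theorem formMatrix_glPullback (g : GL (Fin 5) ℝ) (θ : (Fin 5 → ℝ) [⋀^Fin 2]→L[ℝ] ℝ) :
    formMatrix (glPullback g θ) = g.val.transpose * formMatrix θ * g.val := by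
  ext i j
  have h : (fun l => g.val.mulVec (![bv i, bv j] l)) =
      ![g.val.mulVec (bv i), g.val.mulVec (bv j)] := by
    ext l; fin_cases l <;> rfl
  have hc : ∀ i, g.val.mulVec (bv i) = g.val.transpose i := fun i => funext fun j => mulVec_bv _ _ _
  rw [formMatrix, Matrix.of_apply, glPullback_apply, h, apply_eq_dotProduct_formMatrix,
    Matrix.mul_mul_apply, hc, hc]

theorem stdα_row {g : GL (Fin 5) ℝ} (hg : g ∈ stab stdα) : g.val 4 = Pi.single 4 1 := by
  ext j
  have h : glPullback g stdα ![bv j] = stdα ![bv j] := congrArg (fun θ => θ ![bv j]) hg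
  have h' : (fun l => g.val.mulVec (![bv j] l)) = ![g.val.mulVec (bv j)] := by
    ext l; fin_cases l; rfl
  rw [glPullback_apply, h', stdα_vec, stdα_vec, mulVec_bv] at h
  rw [h]; simp [Pi.single_apply, eq_comm]

/-- `SU(2)` consists of orthogonal matrices. -/
theorem SU2_transpose_mul_self {g : GL (Fin 5) ℝ} (hg : g ∈ SU2) :
    g.val.transpose * g.val = 1 := by
  obtain ⟨⟨⟨h0, h1⟩, h2⟩, h3⟩ := hg
  -- The matrices of the `ωᵢ` are degenerate along `e₅`. Adding `E`, the matrix of `α ⊗ α`, makes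
  -- them invertible, and `g` preserves `E` because its last row is that of the identity.
  set E : Matrix (Fin 5) (Fin 5) ℝ := Matrix.single 4 4 1 with hE
  have e0 : g.val.transpose * E * g.val = E := by
    ext i j
    rw [Matrix.mul_mul_apply, hE, Matrix.single_mulVec,
      show ∀ c : ℝ, Function.update (0 : Fin 5 → ℝ) 4 c = Pi.single 4 c from fun _ => rfl,
      dotProduct_single]
    simp only [Matrix.transpose_apply, stdα_row h0, Pi.single_apply, Matrix.single_apply]
    rcases eq_or_ne i 4 with rfl | hi <;> rcases eq_or_ne j 4 with rfl | hj <;> simp [*, Ne.symm]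
  have e1 : g.val.transpose * (formMatrix stdω₁ + E) * g.val = formMatrix stdω₁ + E := by
    rw [mul_add, add_mul, e0, ← formMatrix_glPullback]; rw [show glPullback g stdω₁ = _ from h1]
  have e2 : g.val.transpose * (formMatrix stdω₂ + E) * g.val = formMatrix stdω₂ + E := by
    rw [mul_add, add_mul, e0, ← formMatrix_glPullback]; rw [show glPullback g stdω₂ = _ from h2]
  have e3 : g.val.transpose * (formMatrix stdω₃ + E) * g.val = formMatrix stdω₃ + E := by
    rw [mul_add, add_mul, e0, ← formMatrix_glPullback]; rw [show glPullback g stdω₃ = _ from h3]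
  set W₁ := formMatrix stdω₁ + E
  set W₂ := formMatrix stdω₂ + E
  set W₃ := formMatrix stdω₃ + E
  -- The quaternionic relations: on `ℝ⁴` the matrix of `ω₂` has inverse its negative, and `ω₂⁻¹ ω₃`
  -- is the matrix of `ω₁`, read as an endomorphism.
  have i2 : (-formMatrix stdω₂ + E) * W₂ = 1 := by
    simp only [W₂, hE, formMatrix_stdω₂]
    ext i j
    fin_cases i <;> fin_cases j <;> simp [Matrix.mul_apply, Fin.sum_univ_five, Matrix.single_apply]
  have i1 : W₁ * (-formMatrix stdω₁ + E) = 1 := by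
    simp only [W₁, hE, formMatrix_stdω₁]
    ext i j
    fin_cases i <;> fin_cases j <;> simp [Matrix.mul_apply, Fin.sum_univ_five, Matrix.single_apply]
  have i3 : (-formMatrix stdω₂ + E) * W₃ = W₁ := by
    simp only [W₁, W₃, hE, formMatrix_stdω₁, formMatrix_stdω₂, formMatrix_stdω₃]
    ext i j
    fin_cases i <;> fin_cases j <;> simp [Matrix.mul_apply, Fin.sum_univ_five, Matrix.single_apply]
  generalize -formMatrix stdω₂ + E = V₂ at i2 i3
  -- Inverting `gᵀ W₂ g = W₂` shows that `g` preserves the dual bivector.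
  have hV : g.val * V₂ * g.val.transpose = V₂ := by
    have h4 : (V₂ * g.val.transpose * W₂) * g.val = 1 := by
      simp only [mul_assoc] at e2 ⊢
      rw [e2, i2]
    have h5 := mul_eq_one_comm.1 h4
    calc g.val * V₂ * g.val.transpose
        = g.val * (V₂ * g.val.transpose * W₂) * V₂ := by
          simp only [mul_assoc, mul_eq_one_comm.1 i2, mul_one]
      _ = V₂ := by rw [h5, one_mul]
  -- `W₁ = V₂ W₃` composes a bivector with a bilinear form, both invariant, so as an endomorphism it
  -- commutes with `g`.
  have hc : g.val * W₁ = W₁ * g.val := by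
    calc g.val * W₁ = g.val * V₂ * g.val.transpose * W₃ * g.val := by
          rw [← i3]; conv_lhs => rw [← e3]
          simp only [mul_assoc]
      _ = W₁ * g.val := by rw [hV, i3]
  -- `W₁` is invariant as a bilinear form and commutes with `g` as an endomorphism; dividing one by
  -- the other leaves the Euclidean metric.
  calc g.val.transpose * g.val = g.val.transpose * (g.val * W₁) * (-formMatrix stdω₁ + E) := by
        rw [mul_assoc, mul_assoc, i1, mul_one]
    _ = 1 := by rw [hc, ← mul_assoc, e1, i1]

end Hypo

end

/-! ### Linear differential equations: existence and uniqueness -/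

noncomputable section

namespace LinearODE

open MeasureTheory Filter

variable {F : Type*} [NormedAddCommGroup F] [NormedSpace ℝ F]

/-- The terms of the Dyson series of the linear differential equation `y' = A y`, `y(0) = c`. -/
def dysonTerm (A : ℝ → F →L[ℝ] F) (c : F) : ℕ → ℝ → F
  | 0, _ => c
  | n + 1, t => ∫ s in (0 : ℝ)..t, A s (dysonTerm A c n s)

variable {I : Set ℝ} {A : ℝ → F →L[ℝ] F} {c : F}

/-- Compactness estimates need a closed interval in `I` with both the initial time and the time of
interest in its interior. -/
theorem exists_Ioo_subset (hIo : IsOpen I) (hIc : I.OrdConnected) (h0 : (0 : ℝ) ∈ I) {t : ℝ}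
    (ht : t ∈ I) : ∃ a b : ℝ, a < 0 ∧ 0 < b ∧ a < t ∧ t < b ∧ Icc a b ⊆ I := by
  have key : ∀ x ∈ I, ∃ a b, a < x ∧ x < b ∧ a ∈ I ∧ b ∈ I := by
    intro x hx
    obtain ⟨ε, hε, h⟩ := Metric.isOpen_iff.1 hIo x hx
    refine ⟨x - ε / 2, x + ε / 2, by linarith, by linarith, h ?_, h ?_⟩ <;>
    · simp only [Metric.mem_ball, Real.dist_eq, abs_lt]
      constructor <;> linarith
  obtain ⟨a₁, b₁, h1, h2, h3, h4⟩ := key 0 h0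
  obtain ⟨a₂, b₂, h5, h6, h7, h8⟩ := key t ht
  refine ⟨min a₁ a₂, max b₁ b₂, ?_, ?_, ?_, ?_, hIc.out ?_ ?_⟩
  · simp [h1]
  · simp [h2]
  · simp [h5]
  · simp [h6]
  · rcases min_choice a₁ a₂ with h | h <;> rwa [h]
  · rcases max_choice b₁ b₂ with h | h <;> rwa [h]

/-- This is the fundamental theorem of calculus; the induction supplies the continuity of the
preceding term, and hence of the integrand. -/
theorem hasDerivAt_dysonTerm_succ [CompleteSpace F] (hIo : IsOpen I) (hIc : I.OrdConnected)
    (h0 : (0 : ℝ) ∈ I) (hA : ContinuousOn A I) (n : ℕ) {t : ℝ} (ht : t ∈ I) :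
    HasDerivAt (dysonTerm A c (n + 1)) (A t (dysonTerm A c n t)) t := by
  induction n generalizing t with
  | zero =>
    have hc : ContinuousOn (fun s => A s c) I := hA.clm_apply continuousOn_const
    exact intervalIntegral.integral_hasDerivAt_right
      (hc.mono (hIc.uIcc_subset h0 ht)).intervalIntegrable
      (hc.stronglyMeasurableAtFilter hIo t ht) (hc.continuousAt (hIo.mem_nhds ht))
  | succ n ih =>
    have hc : ContinuousOn (fun s => A s (dysonTerm A c (n + 1) s)) I :=
      hA.clm_apply fun s hs => (ih hs).continuousAt.continuousWithinAt
    exact intervalIntegral.integral_hasDerivAt_right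
      (hc.mono (hIc.uIcc_subset h0 ht)).intervalIntegrable
      (hc.stronglyMeasurableAtFilter hIo t ht) (hc.continuousAt (hIo.mem_nhds ht))

/-- Each integration raises the power of `|t|` by one and divides by the new exponent, which
accumulates the factorial that makes the series converge. -/
theorem norm_dysonTerm_le {a b M : ℝ} (ha : a ≤ 0) (hb : 0 ≤ b)
    (hM : ∀ t ∈ Icc a b, ‖A t‖ ≤ M) (n : ℕ) {t : ℝ} (ht : t ∈ Icc a b) :
    ‖dysonTerm A c n t‖ ≤ ‖c‖ * (M * |t|) ^ n / n.factorial := by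
  have hM0 : 0 ≤ M := (norm_nonneg _).trans (hM 0 ⟨ha, hb⟩)
  induction n generalizing t with
  | zero => simp [dysonTerm]
  | succ n ih =>
    have hsub : uIoc 0 t ⊆ Icc a b :=
      uIoc_subset_uIcc.trans (ordConnected_Icc.uIcc_subset ⟨ha, hb⟩ ht)
    have h1 : ‖dysonTerm A c (n + 1) t‖ ≤
        |∫ s in (0 : ℝ)..t, ‖c‖ * M ^ (n + 1) / n.factorial * |s - 0| ^ n| := by
      refine intervalIntegral.norm_integral_le_abs_of_norm_le ?_ ?_
      · refine (ae_restrict_mem measurableSet_uIoc).mono fun s hs => ?_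
        calc ‖A s (dysonTerm A c n s)‖ ≤ ‖A s‖ * ‖dysonTerm A c n s‖ := (A s).le_opNorm _
          _ ≤ M * (‖c‖ * (M * |s|) ^ n / n.factorial) := by
              gcongr
              · exact hM s (hsub hs)
              · exact ih (hsub hs)
          _ = ‖c‖ * M ^ (n + 1) / n.factorial * |s - 0| ^ n := by
              rw [sub_zero]; ring
      · exact Continuous.intervalIntegrable (by fun_prop) _ _
    refine h1.trans (le_of_eq ?_)
    rw [intervalIntegral.integral_const_mul, abs_mul, intervalIntegral.abs_intervalIntegral_eq,
      integral_pow_abs_sub_uIoc, abs_of_nonneg (by positivity : 0 ≤ ‖c‖ * M ^ (n + 1) /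
        (n.factorial : ℝ)), abs_of_nonneg (by positivity), sub_zero, Nat.factorial_succ]
    push_cast
    field_simp
    ring

/-- Global existence for linear differential equations. -/
theorem exists_solution [CompleteSpace F] (hIo : IsOpen I) (hIc : I.OrdConnected)
    (h0 : (0 : ℝ) ∈ I) (hA : ContinuousOn A I) (c : F) :
    ∃ y : ℝ → F, y 0 = c ∧ ∀ t ∈ I, HasDerivAt y (A t (y t)) t := by
  have hz : ∀ n, dysonTerm A c (n + 1) 0 = 0 := fun n => by simp [dysonTerm]
  have hs0 : HasSum (fun n => dysonTerm A c n 0) c := by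
    have := hasSum_single (f := fun n => dysonTerm A c n 0) 0 fun n hn => by
      obtain ⟨m, rfl⟩ := Nat.exists_eq_succ_of_ne_zero hn
      exact hz m
    exact this
  refine ⟨fun t => ∑' n, dysonTerm A c n t, hs0.tsum_eq, fun t ht => ?_⟩
  obtain ⟨a, b, ha, hb, hat, htb, hab⟩ := exists_Ioo_subset hIo hIc h0 ht
  obtain ⟨M, hM⟩ := isCompact_Icc.exists_bound_of_continuousOn (hA.mono hab)
  have hM0 : 0 ≤ M := (norm_nonneg _).trans (hM 0 ⟨ha.le, hb.le⟩)
  have hbd : ∀ n, ∀ s ∈ Ioo a b,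
      ‖dysonTerm A c n s‖ ≤ ‖c‖ * ((M * (|a| + |b|)) ^ n / n.factorial) := by
    intro n s hs
    have hs' : |s| ≤ |a| + |b| := by
      rw [abs_of_neg ha, abs_of_pos hb, abs_le]
      constructor <;> linarith [hs.1, hs.2]
    refine (norm_dysonTerm_le ha.le hb.le hM n ⟨hs.1.le, hs.2.le⟩).trans ?_
    rw [mul_div_assoc]
    gcongr
  have hsum : ∀ s ∈ Ioo a b, Summable fun n => dysonTerm A c n s := fun s hs =>
    .of_norm_bounded ((Real.summable_pow_div_factorial _).mul_left _) fun n => hbd n s hs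
  -- The termwise derivatives: the constant zeroth term contributes `0`, and the index shifts by
  -- one. Up to that shift, `u` is a multiple of the exponential series and dominates them on `Ioo a
  -- b`.
  set g' : ℕ → ℝ → F := fun n s => Nat.casesOn n 0 fun m => A s (dysonTerm A c m s) with hg'
  set u : ℕ → ℝ := fun n => Nat.casesOn n 0 fun m =>
    M * (‖c‖ * ((M * (|a| + |b|)) ^ m / m.factorial)) with hu
  have hD := hasDerivAt_tsum_of_isPreconnected (g := dysonTerm A c) (g' := g') (u := u)
    (t := Ioo a b) (y₀ := 0) (y := t) ?_ isOpen_Ioo isPreconnected_Ioo ?_ ?_ ⟨ha, hb⟩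
    hs0.summable ⟨hat, htb⟩
  · convert hD using 1
    have hst := hsum t ⟨hat, htb⟩
    rw [(A t).map_tsum hst]
    have hsg : Summable fun n => g' n t := by
      rw [← summable_nat_add_iff 1]
      exact (A t).summable hst
    rw [hsg.tsum_eq_zero_add]
    simp [hg']
  · rw [← summable_nat_add_iff 1]
    exact ((Real.summable_pow_div_factorial _).mul_left _).mul_left _
  · rintro (_ | n) s hs
    · exact hasDerivAt_const _ _
    · exact hasDerivAt_dysonTerm_succ hIo hIc h0 hA n (hab ⟨hs.1.le, hs.2.le⟩)
  · rintro (_ | n) s hs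
    · simp [hg', hu]
    · refine ((A s).le_opNorm _).trans ?_
      simp only [hu]
      gcongr
      · exact hM s ⟨hs.1.le, hs.2.le⟩
      · exact hbd n s hs

/-- A two-sided Grönwall inequality, for functions vanishing at `0`. -/
theorem norm_le_of_deriv_le {a b K : ℝ} (ha : a ≤ 0) (hb : 0 ≤ b) (hK : 0 ≤ K) :
    ∃ C, 0 ≤ C ∧ ∀ (z z' : ℝ → F) (ε : ℝ), 0 ≤ ε → z 0 = 0 →
      (∀ t ∈ Icc a b, HasDerivAt z (z' t) t) → (∀ t ∈ Icc a b, ‖z' t‖ ≤ K * ‖z t‖ + ε) →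
      ∀ t ∈ Icc a b, ‖z t‖ ≤ C * ε := by
  -- With initial value `0` the Grönwall bound is linear in `ε`, so one constant serves all `z` and
  -- `ε`.
  have hlin : ∀ ε x : ℝ, gronwallBound 0 K ε x = gronwallBound 0 K 1 x * ε := by
    intro ε x
    rcases eq_or_ne K 0 with rfl | h
    · simp [gronwallBound_K0, mul_comm]
    · simp only [gronwallBound_of_K_ne_0 h]; ring
  have hmono := gronwallBound_mono (le_refl (0 : ℝ)) zero_le_one hK
  have hC0 : ∀ x : ℝ, 0 ≤ x → 0 ≤ gronwallBound 0 K 1 x := fun x hx => by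
    simpa [gronwallBound_x0] using hmono hx
  have key : ∀ (d : ℝ) (z z' : ℝ → F) (ε : ℝ), z 0 = 0 →
      (∀ t ∈ Icc 0 d, HasDerivAt z (z' t) t) → (∀ t ∈ Icc 0 d, ‖z' t‖ ≤ K * ‖z t‖ + ε) →
      ∀ t ∈ Icc 0 d, ‖z t‖ ≤ gronwallBound 0 K ε t := by
    intro d z z' ε hz hd hle t ht
    simpa using norm_le_gronwallBound_of_norm_deriv_right_le (δ := 0)
      (fun s hs => (hd s hs).continuousAt.continuousWithinAt)
      (fun s hs => (hd s ⟨hs.1, hs.2.le⟩).hasDerivWithinAt) (by simp [hz])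
      (fun s hs => hle s ⟨hs.1, hs.2.le⟩) t ht
  -- The bound increases with time, so its value at the longer of the two half-intervals suffices on
  -- both sides of `0`.
  refine ⟨gronwallBound 0 K 1 (max (-a) b), hC0 _ (by simp [hb]), ?_⟩
  intro z z' ε hε hz hd hle t ht
  rcases le_total 0 t with h | h
  · refine (key b z z' ε hz (fun s hs => hd s ⟨ha.trans hs.1, hs.2⟩)
      (fun s hs => hle s ⟨ha.trans hs.1, hs.2⟩) t ⟨h, ht.2⟩).trans ?_
    rw [hlin]
    gcongr
    exact hmono (ht.2.trans (le_max_right _ _))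
  -- Negative times are reduced to positive ones by reversing time.
  · have := key (-a) (fun s => z (-s)) (fun s => -z' (-s)) ε (by simp [hz]) ?_ ?_ (-t)
      ⟨by linarith, by linarith [ht.1]⟩
    · simp only [neg_neg] at this
      refine this.trans ?_
      rw [hlin]
      gcongr
      exact hmono ((neg_le_neg ht.1).trans (le_max_left _ _))
    · intro s hs
      have hs' : -s ∈ Icc a b := ⟨by linarith [hs.2], by linarith [hs.1]⟩
      simpa [Function.comp_def] using (hd (-s) hs').scomp s (hasDerivAt_neg s)
    · intro s hs
      have hs' : -s ∈ Icc a b := ⟨by linarith [hs.2], by linarith [hs.1]⟩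
      simpa using hle (-s) hs'

/-- Uniqueness for linear differential equations. -/
theorem solution_unique (hIo : IsOpen I) (hIc : I.OrdConnected) (h0 : (0 : ℝ) ∈ I)
    (hA : ContinuousOn A I) {y z : ℝ → F} (hyz : y 0 = z 0)
    (hy : ∀ t ∈ I, HasDerivAt y (A t (y t)) t) (hz : ∀ t ∈ I, HasDerivAt z (A t (z t)) t) :
    ∀ t ∈ I, y t = z t := by
  intro t ht
  obtain ⟨a, b, ha, hb, hat, htb, hab⟩ := exists_Ioo_subset hIo hIc h0 ht
  obtain ⟨M, hM⟩ := isCompact_Icc.exists_bound_of_continuousOn (hA.mono hab)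
  have hM0 : 0 ≤ M := (norm_nonneg _).trans (hM 0 ⟨ha.le, hb.le⟩)
  obtain ⟨C, -, hC⟩ := norm_le_of_deriv_le (F := F) ha.le hb.le hM0
  have := hC (fun s => y s - z s) (fun s => A s (y s - z s)) 0 le_rfl (by simp [hyz])
    (fun s hs => by rw [map_sub]; exact (hy s (hab hs)).sub (hz s (hab hs)))
    (fun s hs => by
      rw [add_zero]
      exact ((A s).le_opNorm _).trans (mul_le_mul_of_nonneg_right (hM s hs) (norm_nonneg _)))
    t ⟨hat.le, htb.le⟩
  rw [mul_zero, norm_le_zero_iff, sub_eq_zero] at this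
  exact this

end LinearODE

end

/-! ### Linear differential equations: dependence on parameters -/

noncomputable section

namespace LinearODE

open MeasureTheory Filter

universe u

section parameters

/-- Compactness of `Icc a b` makes the continuity in the parameter uniform in time. -/
theorem eventually_norm_sub_le {E G : Type*} [NormedAddCommGroup E] [NormedAddCommGroup G]
    {I : Set ℝ} {W : Set E} (hIo : IsOpen I) (hW : IsOpen W) {g : ℝ × E → G} (hg : ContinuousOn g (I ×ˢ W)) {a b : ℝ}
    (hab : Icc a b ⊆ I) {x₀ : E} (hx₀ : x₀ ∈ W) {ε : ℝ} (hε : 0 < ε) :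
    ∀ᶠ x in 𝓝 x₀, ∀ t ∈ Icc a b, ‖g (t, x) - g (t, x₀)‖ ≤ ε := by
  refine isCompact_Icc.eventually_forall_of_forall_eventually fun t ht => ?_
  have hc : ContinuousAt g (t, x₀) := hg.continuousAt ((hIo.prod hW).mem_nhds ⟨hab ht, hx₀⟩)
  have h1 : Tendsto (fun z : E × ℝ => g (z.2, z.1) - g (z.2, x₀)) (𝓝 (x₀, t)) (𝓝 0) := by
    rw [← sub_self (g (t, x₀))]
    refine Tendsto.sub ?_ ?_
    · exact hc.tendsto.comp (Continuous.tendsto' (by fun_prop) (x₀, t) (t, x₀) rfl)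
    · exact hc.tendsto.comp (Continuous.tendsto' (by fun_prop) (x₀, t) (t, x₀) rfl)
  filter_upwards [(tendsto_zero_iff_norm_tendsto_zero.1 h1).eventually_lt_const hε] with z hz
  exact hz.le

variable {E F : Type*} [NormedAddCommGroup E] [NormedAddCommGroup F]
  [NormedSpace ℝ F] {I : Set ℝ} {W : Set E}

variable {A : ℝ × E → F →L[ℝ] F} {y : ℝ × E → F} {c : F}

/-- Solutions of a linear differential equation depend on the parameter as well as the
coefficients do. -/
theorem exists_norm_sub_le (hIo : IsOpen I) (hW : IsOpen W) (hA : ContinuousOn A (I ×ˢ W))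
    (hy0 : ∀ x ∈ W, y (0, x) = c)
    (hy : ∀ t ∈ I, ∀ x ∈ W, HasDerivAt (fun s => y (s, x)) (A (t, x) (y (t, x))) t)
    {a b : ℝ} (ha : a < 0) (hb : 0 < b) (hab : Icc a b ⊆ I) {x₀ : E} (hx₀ : x₀ ∈ W) :
    ∃ C, 0 ≤ C ∧ ∀ᶠ x in 𝓝 x₀, ∀ δ : ℝ, (∀ t ∈ Icc a b, ‖A (t, x) - A (t, x₀)‖ ≤ δ) →
      ∀ t ∈ Icc a b, ‖y (t, x) - y (t, x₀)‖ ≤ C * δ := by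
  have h00 : (0 : ℝ) ∈ Icc a b := ⟨ha.le, hb.le⟩
  have hAc : ContinuousOn (fun t => A (t, x₀)) (Icc a b) :=
    hA.comp (by fun_prop) fun t ht => ⟨hab ht, hx₀⟩
  have hyc : ContinuousOn (fun t => y (t, x₀)) (Icc a b) := fun t ht =>
    (hy t (hab ht) x₀ hx₀).continuousAt.continuousWithinAt
  obtain ⟨M, hM⟩ := isCompact_Icc.exists_bound_of_continuousOn hAc
  obtain ⟨Y, hY⟩ := isCompact_Icc.exists_bound_of_continuousOn hyc
  have hM0 : 0 ≤ M := (norm_nonneg _).trans (hM 0 h00)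
  have hY0 : 0 ≤ Y := (norm_nonneg _).trans (hY 0 h00)
  -- The coefficients at `x₀` are bounded by `M`; those at nearby `x` differ by at most `1`.
  obtain ⟨C, hC0, hC⟩ := norm_le_of_deriv_le (F := F) ha.le hb.le (K := M + 1) (by positivity)
  refine ⟨C * Y, by positivity, ?_⟩
  filter_upwards [eventually_norm_sub_le hIo hW hA hab hx₀ one_pos, hW.mem_nhds hx₀]
    with x hx hxW δ hδ t ht
  have hδ0 : 0 ≤ δ := (norm_nonneg _).trans (hδ 0 h00)
  refine (hC (fun t => y (t, x) - y (t, x₀))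
    (fun t => A (t, x) (y (t, x)) - A (t, x₀) (y (t, x₀))) (Y * δ) (by positivity)
    (by simp [hy0 x hxW, hy0 x₀ hx₀])
    (fun s hs => (hy s (hab hs) x hxW).sub (hy s (hab hs) x₀ hx₀)) (fun s hs => ?_) t ht).trans
    (le_of_eq (by ring))
  have e : A (s, x) (y (s, x)) - A (s, x₀) (y (s, x₀)) =
      A (s, x) (y (s, x) - y (s, x₀)) + (A (s, x) - A (s, x₀)) (y (s, x₀)) := by
    simp
  have hAx : ‖A (s, x)‖ ≤ M + 1 := by
    calc ‖A (s, x)‖ = ‖A (s, x₀) + (A (s, x) - A (s, x₀))‖ := by rw [add_sub_cancel]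
      _ ≤ M + 1 := (norm_add_le _ _).trans (add_le_add (hM s hs) (hx s hs))
  rw [e]
  refine (norm_add_le _ _).trans (add_le_add ?_ ?_)
  · exact ((A (s, x)).le_opNorm _).trans (by gcongr)
  · refine (ContinuousLinearMap.le_opNorm _ _).trans ?_
    rw [mul_comm Y]
    gcongr
    · exact hδ s hs
    · exact hY s hs

/-- Continuous dependence on parameters of the solutions of linear differential equations. -/
theorem continuousOn_solution (hIo : IsOpen I) (hIc : I.OrdConnected) (h0 : (0 : ℝ) ∈ I)
    (hW : IsOpen W) (hA : ContinuousOn A (I ×ˢ W)) (hy0 : ∀ x ∈ W, y (0, x) = c)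
    (hy : ∀ t ∈ I, ∀ x ∈ W, HasDerivAt (fun s => y (s, x)) (A (t, x) (y (t, x))) t) :
    ContinuousOn y (I ×ˢ W) := by
  rintro ⟨t₀, x₀⟩ ⟨ht₀, hx₀⟩
  refine ContinuousAt.continuousWithinAt ?_
  obtain ⟨a, b, ha, hb, hat, htb, hab⟩ := exists_Ioo_subset hIo hIc h0 ht₀
  obtain ⟨C, hC0, hC⟩ := exists_norm_sub_le hIo hW hA hy0 hy ha hb hab hx₀
  rw [Metric.continuousAt_iff']
  intro ε hε
  -- Chosen so that `C` times this tolerance is less than `ε / 2`; the `+ 1` covers `C = 0`.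
  have h1 := eventually_norm_sub_le hIo hW hA hab hx₀ (ε := ε / (2 * (C + 1))) (by positivity)
  have h2 : ∀ᶠ x in 𝓝 x₀, ∀ t ∈ Icc a b, ‖y (t, x) - y (t, x₀)‖ < ε / 2 := by
    filter_upwards [h1, hC] with x hx hx' t ht
    refine (hx' _ hx t ht).trans_lt ?_
    calc C * (ε / (2 * (C + 1))) = (ε / 2) * (C / (C + 1)) := by field_simp
      _ < (ε / 2) * 1 := by
        gcongr
        rw [div_lt_one (by positivity)]
        linarith
      _ = ε / 2 := mul_one _
  have h3 : ∀ᶠ t in 𝓝 t₀, dist (y (t, x₀)) (y (t₀, x₀)) < ε / 2 :=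
    Metric.continuousAt_iff'.1 (hy t₀ ht₀ x₀ hx₀).continuousAt _ (half_pos hε)
  rw [nhds_prod_eq]
  filter_upwards [(h3.and (Icc_mem_nhds hat htb)).prod_mk h2] with p hp
  calc dist (y p) (y (t₀, x₀)) ≤ dist (y p) (y (p.1, x₀)) + dist (y (p.1, x₀)) (y (t₀, x₀)) :=
        dist_triangle _ _ _
    _ < ε / 2 + ε / 2 := add_lt_add (by rw [dist_eq_norm]; exact hp.2 _ hp.1.2) hp.1.1
    _ = ε := add_halves ε

variable [NormedSpace ℝ E]

/-- The mean value inequality on a ball where the derivative is uniformly close to its value at `x₀`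
gives a Taylor estimate uniform in time. -/
theorem eventually_norm_sub_sub_le {G : Type*} [NormedAddCommGroup G] [NormedSpace ℝ G]
    (hIo : IsOpen I) (hW : IsOpen W) {g : ℝ × E → G} {g' : ℝ × E → E →L[ℝ] G}
    (hg : ∀ t ∈ I, ∀ x ∈ W, HasFDerivAt (fun x => g (t, x)) (g' (t, x)) x)
    (hg' : ContinuousOn g' (I ×ˢ W)) {a b : ℝ}
    (hab : Icc a b ⊆ I) {x₀ : E} (hx₀ : x₀ ∈ W) {ε : ℝ} (hε : 0 < ε) :
    ∀ᶠ x in 𝓝 x₀, ∀ t ∈ Icc a b,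
      ‖g (t, x) - g (t, x₀) - g' (t, x₀) (x - x₀)‖ ≤ ε * ‖x - x₀‖ := by
  obtain ⟨r, hr, h⟩ := Metric.eventually_nhds_iff_ball.1
    ((eventually_norm_sub_le hIo hW hg' hab hx₀ hε).and (hW.mem_nhds hx₀))
  filter_upwards [Metric.ball_mem_nhds x₀ hr] with x hx t ht
  exact (convex_ball x₀ r).norm_image_sub_le_of_norm_hasFDerivWithin_le'
    (fun z hz => (hg t (hab ht) z (h z hz).2).hasFDerivWithinAt)
    (fun z hz => (h z hz).1 t ht) (Metric.mem_ball_self hr) hx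

/-- The variational equation: differentiability in the parameter of the solutions of linear
differential equations. -/
theorem hasFDerivAt_solution (hIo : IsOpen I) (hIc : I.OrdConnected) (h0 : (0 : ℝ) ∈ I)
    (hW : IsOpen W) {A' : ℝ × E → E →L[ℝ] F →L[ℝ] F} (hA : ContinuousOn A (I ×ˢ W))
    (hA' : ContinuousOn A' (I ×ˢ W))
    (hAA' : ∀ t ∈ I, ∀ x ∈ W, HasFDerivAt (fun x => A (t, x)) (A' (t, x)) x)
    (hy0 : ∀ x ∈ W, y (0, x) = c)
    (hy : ∀ t ∈ I, ∀ x ∈ W, HasDerivAt (fun s => y (s, x)) (A (t, x) (y (t, x))) t)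
    {x₀ : E} (hx₀ : x₀ ∈ W) {V : ℝ → E →L[ℝ] F} (hV0 : V 0 = 0)
    (hV : ∀ t ∈ I, HasDerivAt V (A (t, x₀) ∘L V t + (A' (t, x₀)).flip (y (t, x₀))) t)
    {t₀ : ℝ} (ht₀ : t₀ ∈ I) : HasFDerivAt (fun x => y (t₀, x)) (V t₀) x₀ := by
  obtain ⟨a, b, ha, hb, hat, htb, hab⟩ := exists_Ioo_subset hIo hIc h0 ht₀
  obtain ⟨C₁, hC₁, h₁⟩ := exists_norm_sub_le hIo hW hA hy0 hy ha hb hab hx₀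
  have h00 : (0 : ℝ) ∈ Icc a b := ⟨ha.le, hb.le⟩
  have hAc : ContinuousOn (fun t => A (t, x₀)) (Icc a b) :=
    hA.comp (by fun_prop) fun t ht => ⟨hab ht, hx₀⟩
  have hAc' : ContinuousOn (fun t => A' (t, x₀)) (Icc a b) :=
    hA'.comp (by fun_prop) fun t ht => ⟨hab ht, hx₀⟩
  have hyc : ContinuousOn (fun t => y (t, x₀)) (Icc a b) := fun t ht =>
    (hy t (hab ht) x₀ hx₀).continuousAt.continuousWithinAt
  obtain ⟨M, hM⟩ := isCompact_Icc.exists_bound_of_continuousOn hAc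
  obtain ⟨L, hL⟩ := isCompact_Icc.exists_bound_of_continuousOn (E := E →L[ℝ] F →L[ℝ] F) hAc'
  obtain ⟨Y, hY⟩ := isCompact_Icc.exists_bound_of_continuousOn hyc
  have hM0 : 0 ≤ M := (norm_nonneg _).trans (hM 0 h00)
  have hL0 : 0 ≤ L := (norm_nonneg _).trans (hL 0 h00)
  have hY0 : 0 ≤ Y := (norm_nonneg _).trans (hY 0 h00)
  obtain ⟨C₂, hC₂, h₂⟩ := norm_le_of_deriv_le (F := F) ha.le hb.le hM0
  -- The two second-order errors below: the first summand bounds the change of `A` applied to the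
  -- change of `y`, the second the Taylor remainder of `A` applied to `y (t, x₀)`.
  set D := (L + 1) * (C₁ * (L + 1)) + Y with hD
  have hD0 : 0 ≤ D := by positivity
  refine .of_isLittleO (Asymptotics.isLittleO_iff.2 fun κ hκ => ?_)
  set ε := κ / (C₂ * D + 1) with hε
  have hε0 : 0 < ε := by positivity
  have hεκ : C₂ * (D * ε) ≤ κ := by
    rw [hε]
    calc C₂ * (D * (κ / (C₂ * D + 1))) = κ * (C₂ * D / (C₂ * D + 1)) := by ring
      _ ≤ κ * 1 := by
        gcongr
        rw [div_le_one (by positivity)]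
        linarith
      _ = κ := mul_one _
  filter_upwards [h₁, hW.mem_nhds hx₀, Metric.ball_mem_nhds x₀ hε0,
    eventually_norm_sub_sub_le hIo hW hAA' hA' hab hx₀ hε0,
    eventually_norm_sub_sub_le hIo hW hAA' hA' hab hx₀ one_pos] with x hx hxW hxε hxA hxA1
  have hxε' : ‖x - x₀‖ ≤ ε := by
    rw [← dist_eq_norm]; exact (Metric.mem_ball.1 hxε).le
  have hLip : ∀ t ∈ Icc a b, ‖A (t, x) - A (t, x₀)‖ ≤ (L + 1) * ‖x - x₀‖ := by
    intro t ht
    calc ‖A (t, x) - A (t, x₀)‖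
        = ‖A' (t, x₀) (x - x₀) + (A (t, x) - A (t, x₀) - A' (t, x₀) (x - x₀))‖ := by
          rw [add_sub_cancel]
      _ ≤ L * ‖x - x₀‖ + 1 * ‖x - x₀‖ := (norm_add_le _ _).trans
          (add_le_add (((A' (t, x₀)).le_opNorm _).trans (by gcongr; exact hL t ht)) (hxA1 t ht))
      _ = (L + 1) * ‖x - x₀‖ := by ring
  have hyL := hx _ hLip
  have := h₂ (fun t => y (t, x) - y (t, x₀) - V t (x - x₀))
    (fun t => A (t, x) (y (t, x)) - A (t, x₀) (y (t, x₀)) -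
      (A (t, x₀) ∘L V t + (A' (t, x₀)).flip (y (t, x₀))) (x - x₀)) (D * ε * ‖x - x₀‖)
    (by positivity) (by simp [hy0 x hxW, hy0 x₀ hx₀, hV0])
    (fun s hs => ((hy s (hab hs) x hxW).sub (hy s (hab hs) x₀ hx₀)).sub
      ((hV s (hab hs)).clm_apply (hasDerivAt_const s (x - x₀)) |>.congr_deriv (by simp)))
    (fun s hs => ?_) t₀ ⟨hat.le, htb.le⟩
  · refine this.trans ?_
    rw [← mul_assoc]
    gcongr
  -- The Taylor remainder of `y` satisfies the equation at `x₀` up to these two errors, so Grönwall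
  -- bounds it by their size.
  · have e : A (s, x) (y (s, x)) - A (s, x₀) (y (s, x₀)) -
        (A (s, x₀) ∘L V s + (A' (s, x₀)).flip (y (s, x₀))) (x - x₀) =
        A (s, x₀) (y (s, x) - y (s, x₀) - V s (x - x₀)) +
        ((A (s, x) - A (s, x₀)) (y (s, x) - y (s, x₀)) +
        (A (s, x) - A (s, x₀) - A' (s, x₀) (x - x₀)) (y (s, x₀))) := by
      simp only [add_apply, sub_apply,
        ContinuousLinearMap.comp_apply, ContinuousLinearMap.flip_apply, map_sub]
      abel
    rw [e]
    refine (norm_add_le _ _).trans (add_le_add ?_ ((norm_add_le _ _).trans ?_))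
    · exact ((A (s, x₀)).le_opNorm _).trans (by gcongr; exact hM s hs)
    · have i1 := (ContinuousLinearMap.le_opNorm (A (s, x) - A (s, x₀))
        (y (s, x) - y (s, x₀))).trans (mul_le_mul (hLip s hs) (hyL s hs) (norm_nonneg _)
          (by positivity))
      have i2 := (ContinuousLinearMap.le_opNorm (A (s, x) - A (s, x₀) - A' (s, x₀) (x - x₀))
        (y (s, x₀))).trans (mul_le_mul (hxA s hs) (hY s hs) (norm_nonneg _) (by positivity))
      refine (add_le_add i1 i2).trans ?_
      have i3 : (L + 1) * ‖x - x₀‖ * (C₁ * ((L + 1) * ‖x - x₀‖)) ≤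
          (L + 1) * ‖x - x₀‖ * (C₁ * ((L + 1) * ε)) := by gcongr
      rw [hD]
      linarith

/-- The linear system satisfied by a solution together with its derivative in the parameter. -/
def augment (a : F →L[ℝ] F) (d : E →L[ℝ] F →L[ℝ] F) :
    (F × (E →L[ℝ] F)) →L[ℝ] (F × (E →L[ℝ] F)) :=
  .inl ℝ F (E →L[ℝ] F) ∘L a ∘L .fst ℝ F (E →L[ℝ] F) +
    .inr ℝ F (E →L[ℝ] F) ∘L (ContinuousLinearMap.compL ℝ E F F a ∘L .snd ℝ F (E →L[ℝ] F) +
      ContinuousLinearMap.flipₗᵢ ℝ E F F d ∘L .fst ℝ F (E →L[ℝ] F))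

theorem augment_apply (a : F →L[ℝ] F) (d : E →L[ℝ] F →L[ℝ] F) (p : F × (E →L[ℝ] F)) :
    augment a d p = (a p.1, a ∘L p.2 + d.flip p.1) := by
  ext <;> simp [augment]

theorem contDiffOn_augment {X : Type*} [NormedAddCommGroup X] [NormedSpace ℝ X] {s : Set X}
    {n : WithTop ℕ∞} {a : X → F →L[ℝ] F} {d : X → E →L[ℝ] F →L[ℝ] F} (ha : ContDiffOn ℝ n a s)
    (hd : ContDiffOn ℝ n d s) : ContDiffOn ℝ n (fun x => augment (a x) (d x)) s := by
  have h1 : ContDiffOn ℝ n (fun x => .inl ℝ F (E →L[ℝ] F) ∘L a x ∘L .fst ℝ F (E →L[ℝ] F)) s :=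
    contDiffOn_const.clm_comp (ha.clm_comp contDiffOn_const)
  have hc : ContDiff ℝ n fun a : F →L[ℝ] F => ContinuousLinearMap.compL ℝ E F F a :=
    ContinuousLinearMap.contDiff _
  have hf : ContDiff ℝ n fun d : E →L[ℝ] F →L[ℝ] F =>
      (ContinuousLinearMap.flipₗᵢ ℝ E F F d : F →L[ℝ] E →L[ℝ] F) :=
    LinearIsometryEquiv.contDiff _
  have ha' : ContDiffOn ℝ n (fun x => ContinuousLinearMap.compL ℝ E F F (a x)) s :=
    hc.comp_contDiffOn ha
  have hd' : ContDiffOn ℝ n (fun x => (ContinuousLinearMap.flipₗᵢ ℝ E F F (d x) :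
      F →L[ℝ] E →L[ℝ] F)) s := hf.comp_contDiffOn hd
  have h2 : ContDiffOn ℝ n
      (fun x => ContinuousLinearMap.compL ℝ E F F (a x) ∘L .snd ℝ F (E →L[ℝ] F)) s :=
    ha'.clm_comp contDiffOn_const
  have h3 : ContDiffOn ℝ n
      (fun x => (ContinuousLinearMap.flipₗᵢ ℝ E F F (d x) : F →L[ℝ] E →L[ℝ] F) ∘L
        .fst ℝ F (E →L[ℝ] F)) s :=
    hd'.clm_comp contDiffOn_const
  exact h1.add (contDiffOn_const.clm_comp (h2.add h3))

end parameters

/-- Smooth dependence on parameters of the solutions of linear differential equations. -/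
theorem contDiffOn_solution_nat {E : Type u} [NormedAddCommGroup E] [NormedSpace ℝ E] {I : Set ℝ}
    {W : Set E} (hIo : IsOpen I) (hIc : I.OrdConnected) (h0 : (0 : ℝ) ∈ I) (hW : IsOpen W) (n : ℕ)
    {F : Type u} [NormedAddCommGroup F] [NormedSpace ℝ F] [CompleteSpace F]
    {A : ℝ × E → F →L[ℝ] F} {y : ℝ × E → F} {c : F} (hA : ContDiffOn ℝ n A (I ×ˢ W))
    (hy0 : ∀ x ∈ W, y (0, x) = c)
    (hy : ∀ t ∈ I, ∀ x ∈ W, HasDerivAt (fun s => y (s, x)) (A (t, x) (y (t, x))) t) :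
    ContDiffOn ℝ n y (I ×ˢ W) := by
  have hIW := hIo.prod hW
  -- The space changes in the induction: the hypothesis is applied to `F × (E →L[ℝ] F)`, which is
  -- why `F` is generalized and shares the universe of `E`.
  induction n generalizing F with
  | zero =>
    exact contDiffOn_zero.2 (continuousOn_solution hIo hIc h0 hW (contDiffOn_zero.1 hA) hy0 hy)
  | succ n ih =>
    push_cast at hA ⊢
    have hfd := (contDiffOn_succ_iff_fderiv_of_isOpen hIW).1 hA
    set A' : ℝ × E → E →L[ℝ] F →L[ℝ] F := fun p => fderiv ℝ A p ∘L .inr ℝ ℝ E with hA'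
    have hA'n : ContDiffOn ℝ n A' (I ×ˢ W) := hfd.2.2.clm_comp contDiffOn_const
    have hAn : ContDiffOn ℝ n A (I ×ˢ W) := hA.of_le (by exact_mod_cast Nat.le_succ n)
    have hAA' : ∀ t ∈ I, ∀ x ∈ W, HasFDerivAt (fun x => A (t, x)) (A' (t, x)) x := by
      intro t ht x hx
      exact ((hfd.1 (t, x) ⟨ht, hx⟩).differentiableAt
        (hIW.mem_nhds ⟨ht, hx⟩)).hasFDerivAt.comp x (hasFDerivAt_prodMk_right t x)
    have haug := contDiffOn_augment hAn hA'n
    have hex : ∀ x ∈ W, ∃ w : ℝ → F × (E →L[ℝ] F), w 0 = (c, 0) ∧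
        ∀ t ∈ I, HasDerivAt w (augment (A (t, x)) (A' (t, x)) (w t)) t := fun x hx =>
      exists_solution hIo hIc h0
        (haug.continuousOn.comp (f := fun t : ℝ => (t, x)) (by fun_prop) fun t ht => ⟨ht, hx⟩) _
    choose! w hw0 hw using hex
    -- The augmented system is linear too, and its coefficients have lost only one derivative.
    have hwn : ContDiffOn ℝ n (fun p : ℝ × E => w p.2 p.1) (I ×ˢ W) :=
      ih haug hw0 (fun t ht x hx => hw x hx t ht)
    have hw1 : ∀ x ∈ W, ∀ t ∈ I, HasDerivAt (fun t => (w x t).1) (A (t, x) (w x t).1) t := by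
      intro x hx t ht
      have := hasFDerivAt_fst.comp_hasDerivAt t (hw x hx t ht)
      rw [augment_apply] at this
      exact this
    have hyw : ∀ x ∈ W, ∀ t ∈ I, y (t, x) = (w x t).1 := by
      intro x hx
      refine solution_unique hIo hIc h0 (A := fun t => A (t, x)) ?_ ?_
        (fun t ht => hy t ht x hx) (fun t ht => hw1 x hx t ht)
      · exact hA.continuousOn.comp (by fun_prop) fun t ht => ⟨ht, hx⟩
      · rw [hy0 x hx, hw0 x hx]
    have hyn : ContDiffOn ℝ n y (I ×ˢ W) :=
      hwn.fst.congr fun p hp => hyw p.2 hp.2 p.1 hp.1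
    -- The second component of the augmented solution solves the variational equation, hence is the
    -- derivative in the parameter.
    have hVx : ∀ t ∈ I, ∀ x ∈ W, HasFDerivAt (fun x => y (t, x)) (w x t).2 x := by
      intro t ht x hx
      refine hasFDerivAt_solution hIo hIc h0 hW hAn.continuousOn hA'n.continuousOn hAA' hy0 hy hx
        (V := fun t => (w x t).2) (by simp [hw0 x hx]) (fun s hs => ?_) ht
      rw [hyw x hx s hs]
      have := hasFDerivAt_snd.comp_hasDerivAt s (hw x hx s hs)
      rw [augment_apply] at this
      exact this
    set f₁ : ℝ → E → ℝ →L[ℝ] F := fun t x => .toSpanSingleton ℝ (A (t, x) (y (t, x)))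
    set f₂ : ℝ → E → E →L[ℝ] F := fun t x => (w x t).2
    have hf₁ : ContDiffOn ℝ n (fun p : ℝ × E => f₁ p.1 p.2) (I ×ˢ W) :=
      (ContinuousLinearMap.toSpanSingletonCLE (𝕜 := ℝ) (E := F)).contDiff.comp_contDiffOn
        (hAn.clm_apply hyn)
    have hf₂ : ContDiffOn ℝ n (fun p : ℝ × E => f₂ p.1 p.2) (I ×ˢ W) := hwn.snd
    -- Both partial derivatives exist and are continuous, so `y` is jointly differentiable.
    have hder : ∀ p ∈ I ×ˢ W, HasFDerivAt y ((f₁ p.1 p.2).coprod (f₂ p.1 p.2)) p := by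
      intro p hp
      have hn := hIW.mem_nhds hp
      exact (hasStrictFDerivAt_uncurry_coprod (f := fun t x => y (t, x)) (f₁ := f₁) (f₂ := f₂)
        (Filter.mem_of_superset hn fun q hq => (hy q.1 hq.1 q.2 hq.2).hasFDerivAt)
        (Filter.mem_of_superset hn fun q hq => hVx q.1 hq.1 q.2 hq.2)
        (hf₁.continuousOn.continuousAt hn) (hf₂.continuousOn.continuousAt hn)).hasFDerivAt
    refine (contDiffOn_succ_iff_fderiv_of_isOpen hIW).2
      ⟨fun p hp => (hder p hp).differentiableAt.differentiableWithinAt, by simp, ?_⟩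
    have h1 : ContDiffOn ℝ n (fun p : ℝ × E => f₁ p.1 p.2 ∘L .fst ℝ ℝ E) (I ×ˢ W) :=
      hf₁.clm_comp contDiffOn_const
    have h2 : ContDiffOn ℝ n (fun p : ℝ × E => f₂ p.1 p.2 ∘L .snd ℝ ℝ E) (I ×ˢ W) :=
      hf₂.clm_comp contDiffOn_const
    refine (h1.add h2).congr fun p hp => ?_
    rw [(hder p hp).fderiv]
    rfl

end LinearODE

end

noncomputable section

namespace Hypo

variable {M : Type*} [TopologicalSpace M] [ChartedSpace (EuclideanSpace ℝ (Fin 5)) M]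

/-! ### Forms and frames in charts -/

/-- The model space `ℝ⁵` of the manifold. -/
abbrev E5 : Type := EuclideanSpace ℝ (Fin 5)

/-- The derivative at `x` of the chart at `x₀`, as a map between model spaces. -/
def dchart (x₀ x : M) : E5 →L[ℝ] E5 :=
  mfderiv (𝓡 5) 𝓘(ℝ, E5) (extChartAt (𝓡 5) x₀) x

/-- The derivative at `y` of the inverse of the chart at `x₀`, as a map between model spaces. -/
def dchartSymm (x₀ : M) (y : E5) : E5 →L[ℝ] E5 :=
  mfderiv 𝓘(ℝ, E5) (𝓡 5) (extChartAt (𝓡 5) x₀).symm y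

/-- A frame, as a map to the model space. -/
def frameMap {x : M} (u : (Fin 5 → ℝ) ≃L[ℝ] TangentSpace (𝓡 5) x) : (Fin 5 → ℝ) ≃L[ℝ] E5 := u

/-- A form at a point, as a form on the model space. -/
def formMap {k : ℕ} (θ : Form M k) (x : M) : E5 [⋀^Fin k]→L[ℝ] ℝ := θ x

theorem chartForm_eq {k : ℕ} (x₀ : M) (θ : Form M k) (y : E5) :
    chartForm x₀ θ y = (formMap θ ((extChartAt (𝓡 5) x₀).symm y)).compContinuousLinearMap
      (dchartSymm x₀ y) := rfl

theorem formMap_d {k : ℕ} (θ : Form M k) (x : M) :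
    formMap (d θ) x = (extDeriv (chartForm x θ) (extChartAt (𝓡 5) x x)).compContinuousLinearMap
      (dchart x x) := rfl

theorem pullback_eq {k : ℕ} (u : FrameBundle M) (θ : Form M k) :
    u.pullback θ = (formMap θ u.pt).compContinuousLinearMap (frameMap u.frame : _ →L[ℝ] E5) := rfl

theorem isOpen_target (x₀ : M) : IsOpen (extChartAt (𝓡 5) x₀).target :=
  isOpen_extChartAt_target x₀

variable [IsManifold (𝓡 5) ∞ M]

instance : IsManifold (𝓡 5) 1 M := .of_le (n := ∞) (by simp)

theorem dchart_comp_dchartSymm {x₀ x : M} (hx : x ∈ (extChartAt (𝓡 5) x₀).source) :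
    dchart x₀ x ∘L dchartSymm x₀ (extChartAt (𝓡 5) x₀ x) = .id ℝ E5 := by
  have h := mfderiv_extChartAt_comp_mfderivWithin_extChartAt_symm' (I := 𝓡 5) hx
  rw [show range (𝓡 5) = univ from range_id, mfderivWithin_univ] at h
  exact h

theorem dchartSymm_comp_dchart {x₀ x : M} (hx : x ∈ (extChartAt (𝓡 5) x₀).source) :
    dchartSymm x₀ (extChartAt (𝓡 5) x₀ x) ∘L dchart x₀ x = .id ℝ E5 := by
  have h := mfderivWithin_extChartAt_symm_comp_mfderiv_extChartAt' (I := 𝓡 5) hx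
  rw [show range (𝓡 5) = univ from range_id, mfderivWithin_univ] at h
  exact h

theorem mdifferentiableAt_chart_symm {x₀ : M} {y : E5} (hy : y ∈ (extChartAt (𝓡 5) x₀).target) :
    MDifferentiableAt 𝓘(ℝ, E5) (𝓡 5) (extChartAt (𝓡 5) x₀).symm y := by
  have h := mdifferentiableWithinAt_extChartAt_symm (I := 𝓡 5) hy
  rwa [show range (𝓡 5) = univ from range_id, mdifferentiableWithinAt_univ] at h

theorem fderiv_chart_change {x x₀ : M} {y : E5} (hy : y ∈ (extChartAt (𝓡 5) x).target)
    (hy' : (extChartAt (𝓡 5) x).symm y ∈ (extChartAt (𝓡 5) x₀).source) :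
    fderiv ℝ (extChartAt (𝓡 5) x₀ ∘ (extChartAt (𝓡 5) x).symm) y =
      dchart x₀ ((extChartAt (𝓡 5) x).symm y) ∘L dchartSymm x y := by
  rw [← mfderiv_eq_fderiv]
  exact mfderiv_comp y (mdifferentiableAt_extChartAt (by rwa [extChartAt_source] at hy'))
    (mdifferentiableAt_chart_symm hy)

theorem chartForm_change {k : ℕ} (θ : Form M k) {x x₀ : M} {y : E5}
    (hy : y ∈ (extChartAt (𝓡 5) x).target)
    (hy' : (extChartAt (𝓡 5) x).symm y ∈ (extChartAt (𝓡 5) x₀).source) :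
    chartForm x θ y = (chartForm x₀ θ ((extChartAt (𝓡 5) x₀ ∘ (extChartAt (𝓡 5) x).symm) y)
      ).compContinuousLinearMap
        (fderiv ℝ (extChartAt (𝓡 5) x₀ ∘ (extChartAt (𝓡 5) x).symm) y) := by
  rw [fderiv_chart_change hy hy', chartForm_eq, chartForm_eq, Function.comp_apply,
    (extChartAt (𝓡 5) x₀).left_inv hy']
  ext v
  simp only [ContinuousAlternatingMap.compContinuousLinearMap_apply]
  refine congrArg _ (funext fun i => ?_)
  exact (DFunLike.congr_fun (dchartSymm_comp_dchart hy') (dchartSymm x y (v i))).symm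

theorem contDiffAt_chart_change {x x₀ : M} {y : E5} (hy : y ∈ (extChartAt (𝓡 5) x).target)
    (hy' : (extChartAt (𝓡 5) x).symm y ∈ (extChartAt (𝓡 5) x₀).source) :
    ContDiffAt ℝ ∞ (extChartAt (𝓡 5) x₀ ∘ (extChartAt (𝓡 5) x).symm) y := by
  rw [← contMDiffAt_iff_contDiffAt]
  refine ContMDiffAt.comp (I' := 𝓡 5) y ?_ ?_
  · rw [extChartAt_source] at hy'
    exact (contMDiffOn_extChartAt (n := ∞)).contMDiffAt
      ((chartAt E5 x₀).open_source.mem_nhds hy')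
  · exact (contMDiffOn_extChartAt_symm (n := ∞) x).contMDiffAt ((isOpen_target x).mem_nhds hy)

/-- The exterior derivative may be computed in any chart. -/
theorem formMap_d_eq {k : ℕ} (θ : Form M k) {x x₀ : M} (hx : x ∈ (extChartAt (𝓡 5) x₀).source)
    (hθ : DifferentiableAt ℝ (chartForm x₀ θ) (extChartAt (𝓡 5) x₀ x)) :
    formMap (d θ) x = (extDeriv (chartForm x₀ θ) (extChartAt (𝓡 5) x₀ x)).compContinuousLinearMap
      (dchart x₀ x) := by
  have hxt := mem_extChartAt_target (I := 𝓡 5) x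
  have hxx := extChartAt_to_inv (I := 𝓡 5) x
  have hxx' : (extChartAt (𝓡 5) x).symm (extChartAt (𝓡 5) x x) ∈ (extChartAt (𝓡 5) x₀).source := by
    rwa [hxx]
  have hev : chartForm x θ =ᶠ[𝓝 (extChartAt (𝓡 5) x x)] fun y =>
      (chartForm x₀ θ ((extChartAt (𝓡 5) x₀ ∘ (extChartAt (𝓡 5) x).symm) y)
      ).compContinuousLinearMap
        (fderiv ℝ (extChartAt (𝓡 5) x₀ ∘ (extChartAt (𝓡 5) x).symm) y) := by
    have hc : ContinuousAt (extChartAt (𝓡 5) x).symm (extChartAt (𝓡 5) x x) :=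
      continuousAt_extChartAt_symm x
    filter_upwards [(isOpen_target x).mem_nhds hxt,
      hc.preimage_mem_nhds ((isOpen_extChartAt_source x₀).mem_nhds hxx')] with y hy hy'
    exact chartForm_change θ hy hy'
  -- Naturality of `d` under the transition map; the two derivatives of the chart at `x` then cancel
  -- at its centre.
  rw [formMap_d, hev.extDeriv_eq, extDeriv_pullback (r := ∞) (by simpa [hxx] using hθ)
    (contDiffAt_chart_change hxt hxx')
      (by rw [minSmoothness_of_isRCLikeNormedField]; exact WithTop.coe_le_coe.2 (le_top : (2 : ℕ∞) ≤ ⊤)), fderiv_chart_change hxt hxx']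
  rw [Function.comp_apply, hxx]
  ext v
  simp only [ContinuousAlternatingMap.compContinuousLinearMap_apply]
  refine congrArg _ (funext fun i => ?_)
  exact congrArg _ (DFunLike.congr_fun
    (dchartSymm_comp_dchart (mem_extChartAt_source (I := 𝓡 5) x)) (v i))

end Hypo

end

/-! ### Smooth frames and coframes in a chart -/

noncomputable section

namespace Hypo

variable {M : Type*} [TopologicalSpace M] [ChartedSpace (EuclideanSpace ℝ (Fin 5)) M]

/-- A family of frames, read in the chart at `x₀`. -/
def chartFrame (x₀ : M) (σ : ∀ p : ℝ × M, (Fin 5 → ℝ) ≃L[ℝ] TangentSpace (𝓡 5) p.2)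
    (q : ℝ × E5) : (Fin 5 → ℝ) →L[ℝ] E5 :=
  dchart x₀ ((extChartAt (𝓡 5) x₀).symm q.2) ∘L
    (frameMap (σ (q.1, (extChartAt (𝓡 5) x₀).symm q.2)) : (Fin 5 → ℝ) →L[ℝ] E5)

/-- The dual coframes of a family of frames, read in the chart at `x₀`. -/
def chartCoframe (x₀ : M) (σ : ∀ p : ℝ × M, (Fin 5 → ℝ) ≃L[ℝ] TangentSpace (𝓡 5) p.2)
    (q : ℝ × E5) : E5 →L[ℝ] (Fin 5 → ℝ) :=
  ((frameMap (σ (q.1, (extChartAt (𝓡 5) x₀).symm q.2))).symm : E5 →L[ℝ] (Fin 5 → ℝ)) ∘L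
    dchartSymm x₀ q.2

/-- The points of `ℝ × ℝ⁵` that correspond to `W ⊆ ℝ × M` in the chart at `x₀`. -/
def chartSet (x₀ : M) (W : Set (ℝ × M)) : Set (ℝ × E5) :=
  {q | q.2 ∈ (extChartAt (𝓡 5) x₀).target ∧ (q.1, (extChartAt (𝓡 5) x₀).symm q.2) ∈ W}

theorem isOpen_chartSet (x₀ : M) {W : Set (ℝ × M)} (hW : IsOpen W) : IsOpen (chartSet x₀ W) := by
  have hc : ContinuousOn (fun q : ℝ × E5 => (q.1, (extChartAt (𝓡 5) x₀).symm q.2))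
      (Prod.snd ⁻¹' (extChartAt (𝓡 5) x₀).target) :=
    continuousOn_fst.prodMk ((continuousOn_extChartAt_symm x₀).comp continuousOn_snd
      fun q hq => hq)
  exact hc.isOpen_inter_preimage ((isOpen_target x₀).preimage continuous_snd) hW

variable [IsManifold (𝓡 5) ∞ M]

theorem chartFrame_comp_chartCoframe (x₀ : M)
    (σ : ∀ p : ℝ × M, (Fin 5 → ℝ) ≃L[ℝ] TangentSpace (𝓡 5) p.2) {q : ℝ × E5}
    (hq : q.2 ∈ (extChartAt (𝓡 5) x₀).target) :
    chartFrame x₀ σ q ∘L chartCoframe x₀ σ q = .id ℝ _ := by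
  have h := dchart_comp_dchartSymm ((extChartAt (𝓡 5) x₀).map_target hq)
  rw [(extChartAt (𝓡 5) x₀).right_inv hq] at h
  ext1 v
  simpa [chartFrame, chartCoframe] using DFunLike.congr_fun h v

theorem chartCoframe_comp_chartFrame (x₀ : M)
    (σ : ∀ p : ℝ × M, (Fin 5 → ℝ) ≃L[ℝ] TangentSpace (𝓡 5) p.2) {q : ℝ × E5}
    (hq : q.2 ∈ (extChartAt (𝓡 5) x₀).target) :
    chartCoframe x₀ σ q ∘L chartFrame x₀ σ q = .id ℝ _ := by
  have h := dchartSymm_comp_dchart ((extChartAt (𝓡 5) x₀).map_target hq)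
  rw [(extChartAt (𝓡 5) x₀).right_inv hq] at h
  ext1 v
  have h' := DFunLike.congr_fun h (frameMap (σ (q.1, (extChartAt (𝓡 5) x₀).symm q.2)) v)
  exact (congrArg _ h').trans (ContinuousLinearEquiv.symm_apply_apply _ v)

/-- Over the chart domain the trivialization of the tangent bundle at `x₀` is the derivative of the
chart, so smoothness in the bundle becomes smoothness of the components. -/
theorem contMDiffOn_dchart_frame {W : Set (ℝ × M)}
    {σ : ∀ p : ℝ × M, (Fin 5 → ℝ) ≃L[ℝ] TangentSpace (𝓡 5) p.2}
    (hσ : IsSmoothFrameFamilyOn W σ) (x₀ : M) (i : Fin 5) :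
    ContMDiffOn (𝓘(ℝ, ℝ).prod (𝓡 5)) 𝓘(ℝ, E5) ∞
      (fun p => dchart x₀ p.2 (frameMap (σ p) (bv i)))
      (W ∩ {p | p.2 ∈ (extChartAt (𝓡 5) x₀).source}) := by
  set e := trivializationAt E5 (TangentSpace (𝓡 5) : M → Type) x₀
  have h1 : ContMDiffOn (𝓘(ℝ, ℝ).prod (𝓡 5)) 𝓘(ℝ, E5) ∞
      (fun p => (e (⟨p.2, σ p (bv i)⟩ : TangentBundle (𝓡 5) M)).2)
      (W ∩ {p | p.2 ∈ (extChartAt (𝓡 5) x₀).source}) := by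
    refine (contMDiff_snd (I := 𝓡 5) (J := 𝓘(ℝ, E5)) (n := ∞)).comp_contMDiffOn ?_
    refine (Bundle.Trivialization.contMDiffOn (n := ∞) (IB := 𝓡 5) e).comp
      ((hσ i).mono inter_subset_left) fun p hp => ?_
    have := hp.2
    simp only [mem_preimage]
    rw [e.mem_source]
    simpa [e] using this
  refine h1.congr fun p hp => ?_
  have hp' : p.2 ∈ (chartAt E5 x₀).source := by simpa using hp.2
  have := TangentBundle.continuousLinearMapAt_trivializationAt (I := 𝓡 5) hp'
  have h2 := DFunLike.congr_fun this (σ p (bv i))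
  refine h2.symm.trans ?_
  rw [Bundle.Trivialization.continuousLinearMapAt_apply,
    Bundle.Trivialization.coe_linearMapAt_of_mem]
  simpa [e] using hp'

theorem contDiffOn_chartFrame {W : Set (ℝ × M)}
    {σ : ∀ p : ℝ × M, (Fin 5 → ℝ) ≃L[ℝ] TangentSpace (𝓡 5) p.2}
    (hσ : IsSmoothFrameFamilyOn W σ) (x₀ : M) :
    ContDiffOn ℝ ∞ (chartFrame x₀ σ) (chartSet x₀ W) := by
  have key : ∀ i, ContDiffOn ℝ ∞ (fun q => chartFrame x₀ σ q (bv i)) (chartSet x₀ W) := by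
    intro i
    rw [← contMDiffOn_iff_contDiffOn, modelWithCornersSelf_prod, ← chartedSpaceSelf_prod]
    have h1 : ContMDiffOn (𝓘(ℝ, ℝ).prod 𝓘(ℝ, E5)) (𝓘(ℝ, ℝ).prod (𝓡 5)) ∞
        (fun q : ℝ × E5 => (q.1, (extChartAt (𝓡 5) x₀).symm q.2)) (chartSet x₀ W) :=
      contMDiff_fst.contMDiffOn.prodMk ((contMDiffOn_extChartAt_symm (n := ∞) x₀).comp
        contMDiff_snd.contMDiffOn fun q hq => hq.1)
    exact (contMDiffOn_dchart_frame hσ x₀ i).comp h1 fun q hq =>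
      ⟨hq.2, (extChartAt (𝓡 5) x₀).map_target hq.1⟩
  rw [contDiffOn_clm_apply]
  intro v
  have hv : v = ∑ i, v i • bv i := by ext i; simp [Pi.single_apply]
  rw [hv]
  simp only [map_sum, map_smul]
  exact ContDiffOn.sum fun i _ => (key i).const_smul (v i)

/-- The coframe is the inverse of the frame, and inversion is smooth on invertible operators. -/
theorem contDiffOn_chartCoframe {W : Set (ℝ × M)}
    {σ : ∀ p : ℝ × M, (Fin 5 → ℝ) ≃L[ℝ] TangentSpace (𝓡 5) p.2}
    (hσ : IsSmoothFrameFamilyOn W σ) (x₀ : M) :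
    ContDiffOn ℝ ∞ (chartCoframe x₀ σ) (chartSet x₀ W) := by
  have hinv : ∀ q ∈ chartSet x₀ W,
      chartCoframe x₀ σ q = ContinuousLinearMap.inverse (chartFrame x₀ σ q) := fun q hq =>
    (ContinuousLinearMap.inverse_eq (chartFrame_comp_chartCoframe x₀ σ hq.1)
      (chartCoframe_comp_chartFrame x₀ σ hq.1)).symm
  refine ContDiffOn.congr (fun q hq => ?_) hinv
  set e : (Fin 5 → ℝ) ≃L[ℝ] E5 := .equivOfInverse (chartFrame x₀ σ q) (chartCoframe x₀ σ q)
    (DFunLike.congr_fun (chartCoframe_comp_chartFrame x₀ σ hq.1))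
    (DFunLike.congr_fun (chartFrame_comp_chartCoframe x₀ σ hq.1))
  have he : ContDiffAt ℝ ∞ (ContinuousLinearMap.inverse (R := ℝ) (M := Fin 5 → ℝ) (M₂ := E5))
      (chartFrame x₀ σ q) := contDiffAt_map_inverse e
  exact he.comp_contDiffWithinAt q (contDiffOn_chartFrame hσ x₀ q hq)

/-! ### The exterior derivative of the defining forms -/

/-- The derivative of a coframe `a` at `y`, read in a frame `b`. -/
def coframeN (a' : E5 →L[ℝ] E5 →L[ℝ] (Fin 5 → ℝ)) (b : (Fin 5 → ℝ) →L[ℝ] E5) :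
    (Fin 5 → ℝ) →L[ℝ] (Fin 5 → ℝ) →L[ℝ] (Fin 5 → ℝ) :=
  (ContinuousLinearMap.compL ℝ (Fin 5 → ℝ) E5 (Fin 5 → ℝ)).flip b ∘L a' ∘L b

theorem coframeN_apply (a' : E5 →L[ℝ] E5 →L[ℝ] (Fin 5 → ℝ)) (b : (Fin 5 → ℝ) →L[ℝ] E5)
    (v w : Fin 5 → ℝ) : coframeN a' b v w = a' (b v) (b w) := rfl

/-- The forms were defined by a chosen frame at each point; this allows any adapted frame, in
particular a smooth one. -/
theorem formMap_formOf {k : ℕ} (P : SU2Structure M) (θ : (Fin 5 → ℝ) [⋀^Fin k]→L[ℝ] ℝ)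
    (hθ : SU2 ≤ stab θ) {x : M} {u : (Fin 5 → ℝ) ≃L[ℝ] TangentSpace (𝓡 5) x}
    (hu : (⟨x, u⟩ : FrameBundle M) ∈ P.carrier) :
    formMap (P.formOf θ) x =
      θ.compContinuousLinearMap ((frameMap u).symm : E5 →L[ℝ] (Fin 5 → ℝ)) := by
  conv_rhs => rw [← P.pullback_formOf θ hθ _ hu, pullback_eq]
  ext v
  simp [Function.comp_def]

/-- The exterior derivative of a defining form in terms of the derivative of a coframe. -/
theorem pullback_d_formOf {k : ℕ} (P : SU2Structure M) (θ : (Fin 5 → ℝ) [⋀^Fin k]→L[ℝ] ℝ)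
    {x₀ x : M} (hx : x ∈ (extChartAt (𝓡 5) x₀).source) {a : E5 → E5 →L[ℝ] (Fin 5 → ℝ)}
    (hθa : ∀ᶠ y in 𝓝 (extChartAt (𝓡 5) x₀ x),
      chartForm x₀ (P.formOf θ) y = θ.compContinuousLinearMap (a y))
    (ha : DifferentiableAt ℝ a (extChartAt (𝓡 5) x₀ x))
    (u : (Fin 5 → ℝ) ≃L[ℝ] TangentSpace (𝓡 5) x)
    (hu : a (extChartAt (𝓡 5) x₀ x) ∘L dchart x₀ x ∘L (frameMap u : (Fin 5 → ℝ) →L[ℝ] E5) =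
      .id ℝ _) :
    (⟨x, u⟩ : FrameBundle M).pullback (d (P.formOf θ)) =
      coframeD (coframeN (fderiv ℝ a (extChartAt (𝓡 5) x₀ x))
        (dchart x₀ x ∘L (frameMap u : (Fin 5 → ℝ) →L[ℝ] E5))) θ := by
  have hder := HasFDerivAt.continuousAlternatingMapCompContinuousLinearMap
    (hasFDerivAt_const θ (extChartAt (𝓡 5) x₀ x)) ha.hasFDerivAt
  have hder' := hder.congr_of_eventuallyEq hθa
  rw [pullback_eq, formMap_d_eq (P.formOf θ) hx hder'.differentiableAt, extDeriv, hder'.fderiv]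
  ext v
  simp only [coframeD, ContinuousAlternatingMap.compContinuousLinearMap_apply,
    ContinuousAlternatingMap.alternatizeUncurryFin_apply]
  refine Finset.sum_congr rfl fun i _ => ?_
  congr 1
  simp [ContinuousAlternatingMap.fderivCompContinuousLinearMap_apply, Fin.removeNth]
  -- In the undifferentiated slots the coframe meets its own dual frame and gives the identity.
  refine Finset.sum_congr rfl fun j _ => congrArg θ (funext fun l => ?_)
  by_cases h : l = j
  · subst h; simp [coframeN_apply]
  · simp only [ne_eq, h, not_false_eq_true, Function.update_of_ne]
    exact DFunLike.congr_fun hu _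

end Hypo

end

/-! ### The equivariant map `Q` on adapted frames -/

noncomputable section

namespace Hypo

theorem SU2_le_stdα : SU2 ≤ stab stdα := fun _ h => h.1.1.1
theorem SU2_le_stdω₁ : SU2 ≤ stab stdω₁ := fun _ h => h.1.1.2
theorem SU2_le_stdω₂ : SU2 ≤ stab stdω₂ := fun _ h => h.1.2
theorem SU2_le_stdω₃ : SU2 ≤ stab stdω₃ := fun _ h => h.2

theorem glPullback_two (g : GL (Fin 5) ℝ) (θ : (Fin 5 → ℝ) [⋀^Fin 2]→L[ℝ] ℝ) (x y : Fin 5 → ℝ) :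
    glPullback g θ ![x, y] = θ ![g.val.mulVec x, g.val.mulVec y] := by
  rw [glPullback_apply]
  congr 1; ext i; fin_cases i <;> rfl

theorem glPullback_one_form (g : GL (Fin 5) ℝ) (θ : (Fin 5 → ℝ) [⋀^Fin 1]→L[ℝ] ℝ)
    (x : Fin 5 → ℝ) : glPullback g θ ![x] = θ ![g.val.mulVec x] := by
  rw [glPullback_apply]
  congr 1; ext i; fin_cases i; rfl

theorem glPullback_three (g : GL (Fin 5) ℝ) (θ : (Fin 5 → ℝ) [⋀^Fin 3]→L[ℝ] ℝ)
    (x y z : Fin 5 → ℝ) :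
    glPullback g θ ![x, y, z] = θ ![g.val.mulVec x, g.val.mulVec y, g.val.mulVec z] := by
  rw [glPullback_apply]
  congr 1; ext i; fin_cases i <;> rfl

theorem SU2_le_stdψ₂ : SU2 ≤ stab stdψ₂ := by
  intro g hg
  have h1 : glPullback g stdω₂ = stdω₂ := SU2_le_stdω₂ hg
  have h2 : glPullback g stdα = stdα := SU2_le_stdα hg
  refine ext_three fun i j l _ _ => ?_
  rw [glPullback_three, stdψ₂_apply, stdψ₂_apply]
  simp only [← glPullback_two, ← glPullback_one_form, h1, h2]

theorem SU2_le_stdψ₃ : SU2 ≤ stab stdψ₃ := by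
  intro g hg
  have h1 : glPullback g stdω₃ = stdω₃ := SU2_le_stdω₃ hg
  have h2 : glPullback g stdα = stdα := SU2_le_stdα hg
  refine ext_three fun i j l _ _ => ?_
  rw [glPullback_three, stdψ₃_apply, stdψ₃_apply]
  simp only [← glPullback_two, ← glPullback_one_form, h1, h2]

variable {M : Type*} [TopologicalSpace M] [ChartedSpace (EuclideanSpace ℝ (Fin 5)) M]

theorem mul_def (u : FrameBundle M) (g : GL (Fin 5) ℝ) :
    u * g = ⟨u.pt, (glEquiv g).trans u.frame⟩ := rfl

theorem frame_mul_mul (u : FrameBundle M) (g h : GL (Fin 5) ℝ) : u * g * h = u * (g * h) := by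
  simp only [mul_def]
  congr 1
  ext v
  simp [glEquiv_apply, Matrix.mulVec_mulVec]

theorem frame_mul_one (u : FrameBundle M) : u * (1 : GL (Fin 5) ℝ) = u := by
  obtain ⟨x, u⟩ := u
  rw [mul_def]
  congr 1
  ext v
  simp [glEquiv_apply]

theorem pullback_mul {k : ℕ} (u : FrameBundle M) (g : GL (Fin 5) ℝ) (θ : Form M k) :
    (u * g).pullback θ = glPullback g (u.pullback θ) := rfl

theorem glEquiv_transition {x : M} (v u : (Fin 5 → ℝ) ≃L[ℝ] TangentSpace (𝓡 5) x)
    (w : Fin 5 → ℝ) : glEquiv (transition v u) w = v.symm (u w) := by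
  simp [glEquiv, transition]

theorem gl_ext {g h : GL (Fin 5) ℝ} (H : ∀ w, glEquiv g w = glEquiv h w) : g = h := by
  apply Units.ext
  apply Matrix.mulVec_injective
  funext w
  exact H w

theorem transition_mul {x : M} (v u : (Fin 5 → ℝ) ≃L[ℝ] TangentSpace (𝓡 5) x)
    (g : GL (Fin 5) ℝ) : transition v ((glEquiv g).trans u) = transition v u * g := by
  refine gl_ext fun w => ?_
  have h : glEquiv (transition v u * g) w = glEquiv (transition v u) (glEquiv g w) := by
    simp [glEquiv_apply, Matrix.mulVec_mulVec]
  rw [h, glEquiv_transition, glEquiv_transition]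
  rfl

theorem chartFrame_extChartAt (x₀ : M)
    (σ : ∀ p : ℝ × M, (Fin 5 → ℝ) ≃L[ℝ] TangentSpace (𝓡 5) p.2) (t : ℝ) {x : M}
    (hx : x ∈ (extChartAt (𝓡 5) x₀).source) :
    chartFrame x₀ σ (t, extChartAt (𝓡 5) x₀ x) =
      dchart x₀ x ∘L (frameMap (σ (t, x)) : (Fin 5 → ℝ) →L[ℝ] E5) := by
  simp only [chartFrame]
  rw [(extChartAt (𝓡 5) x₀).left_inv hx]

theorem mem_chartSet {x₀ x : M} {t : ℝ} {W : Set (ℝ × M)}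
    (hx : x ∈ (extChartAt (𝓡 5) x₀).source) (hW : (t, x) ∈ W) :
    (t, extChartAt (𝓡 5) x₀ x) ∈ chartSet x₀ W :=
  ⟨(extChartAt (𝓡 5) x₀).map_source hx, by
    simpa only [(extChartAt (𝓡 5) x₀).left_inv hx] using hW⟩

variable [IsManifold (𝓡 5) ∞ M]

/-- The reference frame depends only on the base point, so replacing `u` by `u * g` multiplies the
transition matrix by `g` on the right. -/
theorem Q_mul (P : SU2Structure M) (u : FrameBundle M) (g : GL (Fin 5) ℝ) :
    Q P (u * g) = (g⁻¹ : GL (Fin 5) ℝ).val * Q P u * g.val := by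
  have h : Q P (u * g) =
      ((transition (P.someFrame u.pt) ((glEquiv g).trans u.frame))⁻¹ : GL (Fin 5) ℝ).val *
        (P.torsion ⟨u.pt, P.someFrame u.pt⟩).matrix *
        (transition (P.someFrame u.pt) ((glEquiv g).trans u.frame)).val := rfl
  rw [h, transition_mul, mul_inv_rev, Units.val_mul, Units.val_mul]
  simp only [Q, mul_assoc]

theorem chartForm_formOf {k : ℕ} (P : SU2Structure M) (θ : (Fin 5 → ℝ) [⋀^Fin k]→L[ℝ] ℝ)
    (hθ : SU2 ≤ stab θ) (x₀ : M)
    {σ : ∀ p : ℝ × M, (Fin 5 → ℝ) ≃L[ℝ] TangentSpace (𝓡 5) p.2} {q : ℝ × E5}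
    (hq : (⟨(extChartAt (𝓡 5) x₀).symm q.2, σ (q.1, (extChartAt (𝓡 5) x₀).symm q.2)⟩ :
      FrameBundle M) ∈ P.carrier) :
    chartForm x₀ (P.formOf θ) q.2 = θ.compContinuousLinearMap (chartCoframe x₀ σ q) := by
  rw [chartForm_eq, formMap_formOf P θ hθ hq]
  rfl

/-- The derivative of the coframe of a family of frames in the chart at `x₀`. -/
def familyN (x₀ : M) (σ : ∀ p : ℝ × M, (Fin 5 → ℝ) ≃L[ℝ] TangentSpace (𝓡 5) p.2)
    (q : ℝ × E5) : (Fin 5 → ℝ) →L[ℝ] (Fin 5 → ℝ) →L[ℝ] (Fin 5 → ℝ) :=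
  coframeN (fderiv ℝ (chartCoframe x₀ σ) q ∘L .inr ℝ ℝ E5) (chartFrame x₀ σ q)

/-- The exterior derivatives of the defining forms in terms of a smooth family of adapted
frames. -/
theorem pullback_d_formOf_family {k : ℕ} (P : ℝ → SU2Structure M)
    (θ : (Fin 5 → ℝ) [⋀^Fin k]→L[ℝ] ℝ) (hθ : SU2 ≤ stab θ) {W : Set (ℝ × M)} (hW : IsOpen W)
    {σ : ∀ p : ℝ × M, (Fin 5 → ℝ) ≃L[ℝ] TangentSpace (𝓡 5) p.2}
    (hσ : IsSmoothFrameFamilyOn W σ)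
    (hσP : ∀ p ∈ W, (⟨p.2, σ p⟩ : FrameBundle M) ∈ (P p.1).carrier) {x₀ x : M} {t : ℝ}
    (hx : x ∈ (extChartAt (𝓡 5) x₀).source) (hp : (t, x) ∈ W) :
    (⟨x, σ (t, x)⟩ : FrameBundle M).pullback (d ((P t).formOf θ)) =
      coframeD (familyN x₀ σ (t, extChartAt (𝓡 5) x₀ x)) θ := by
  have hmem := mem_chartSet hx hp
  have hopen := isOpen_chartSet x₀ hW
  have hder : HasFDerivAt (fun y => chartCoframe x₀ σ (t, y))
      (fderiv ℝ (chartCoframe x₀ σ) (t, extChartAt (𝓡 5) x₀ x) ∘L .inr ℝ ℝ E5)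
      (extChartAt (𝓡 5) x₀ x) :=
    ((((contDiffOn_chartCoframe hσ x₀).differentiableOn (by simp) _ hmem).differentiableAt
      (hopen.mem_nhds hmem)).hasFDerivAt).comp _ (hasFDerivAt_prodMk_right t _)
  have hev : ∀ᶠ y in 𝓝 (extChartAt (𝓡 5) x₀ x),
      chartForm x₀ ((P t).formOf θ) y = θ.compContinuousLinearMap (chartCoframe x₀ σ (t, y)) := by
    have hc : Continuous fun y : E5 => (t, y) := by fun_prop
    filter_upwards [hc.continuousAt.preimage_mem_nhds (hopen.mem_nhds hmem)] with y hy
    exact chartForm_formOf (P t) θ hθ x₀ (q := (t, y)) (hσP _ hy.2)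
  have hf := chartFrame_extChartAt x₀ σ t hx
  rw [pullback_d_formOf (P t) θ hx hev hder.differentiableAt (σ (t, x))
    (by rw [← hf]; exact chartCoframe_comp_chartFrame x₀ σ hmem.1), hder.fderiv, familyN, hf]

theorem isSmoothFrameFamilyOn_const {U : Set M}
    {σ : ∀ x : M, (Fin 5 → ℝ) ≃L[ℝ] TangentSpace (𝓡 5) x} (hσ : IsSmoothFrameOn U σ) :
    IsSmoothFrameFamilyOn (univ ×ˢ U) fun p => σ p.2 := fun i =>
  (hσ i).comp contMDiff_snd.contMDiffOn fun _ hp => hp.2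

/-- The exterior derivatives of the defining forms are all given by the derivative of one
coframe. -/
theorem exists_pullback_d_formOf (P : SU2Structure M) {u : FrameBundle M} (hu : u ∈ P.carrier) :
    ∃ N, ∀ {k : ℕ} (θ : (Fin 5 → ℝ) [⋀^Fin k]→L[ℝ] ℝ), SU2 ≤ stab θ →
      u.pullback (d (P.formOf θ)) = coframeD N θ := by
  obtain ⟨x, u⟩ := u
  obtain ⟨U, hU, hxU, σ, hσ, hσP⟩ := P.smooth x
  obtain ⟨g, hg, hgu⟩ := P.exists_mul _ (hσP x hxU) _ hu rfl
  have hmem := mem_chartSet (W := univ ×ˢ U) (t := 0) (mem_extChartAt_source (I := 𝓡 5) x)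
    ⟨mem_univ _, hxU⟩
  have hopen := isOpen_chartSet x ((isOpen_univ (X := ℝ)).prod hU)
  have hsm := contDiffOn_chartCoframe (isSmoothFrameFamilyOn_const hσ) x
  -- The smooth local frame need not pass through `u`. Multiplying it by the constant `g ∈ SU(2)`
  -- corrects this and keeps it adapted.
  set a : E5 → E5 →L[ℝ] (Fin 5 → ℝ) := fun y =>
    ((glEquiv g).symm : (Fin 5 → ℝ) →L[ℝ] (Fin 5 → ℝ)) ∘L
      chartCoframe x (fun p : ℝ × M => σ p.2) (0, y) with ha
  refine ⟨coframeN (fderiv ℝ a (extChartAt (𝓡 5) x x))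
        (dchart x x ∘L (frameMap u : (Fin 5 → ℝ) →L[ℝ] E5)), fun θ hθ => ?_⟩
  refine pullback_d_formOf P θ (mem_extChartAt_source x) (a := a) ?_ ?_ u ?_
  · have hc : Continuous fun y : E5 => ((0 : ℝ), y) := by fun_prop
    filter_upwards [hc.continuousAt.preimage_mem_nhds (hopen.mem_nhds hmem)] with y hy
    exact chartForm_formOf P θ hθ x (q := (0, y)) (σ := fun p => (glEquiv g).trans (σ p.2))
      (P.mul_mem _ (hσP _ hy.2.2) g hg)
  · have hd := ((hsm.differentiableOn (by simp) _ hmem).differentiableAt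
      (hopen.mem_nhds hmem)).hasFDerivAt.comp (extChartAt (𝓡 5) x x)
        (hasFDerivAt_prodMk_right (0 : ℝ) _)
    exact (differentiableAt_const _).clm_comp hd.differentiableAt
  · have hu' : u = (glEquiv g).trans (σ x) := by injection hgu
    have hf := chartFrame_extChartAt x (fun p : ℝ × M => σ p.2) 0
      (mem_extChartAt_source (I := 𝓡 5) x)
    have h1 := chartCoframe_comp_chartFrame x (fun p : ℝ × M => σ p.2) hmem.1
    rw [hf] at h1
    ext1 v
    have h2 := DFunLike.congr_fun h1 (glEquiv g v)
    rw [hu']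
    exact (congrArg (glEquiv g).symm h2).trans ((glEquiv g).symm_apply_apply v)

/-- The torsion matrix of a hypo structure is symmetric and acts on the defining forms as
prescribed by the hypo evolution equations. -/
theorem lieAct_torsion {P : SU2Structure M} (hP : P.IsHypo) {u : FrameBundle M}
    (hu : u ∈ P.carrier) :
    (P.torsion u).matrix.transpose = (P.torsion u).matrix ∧
      lieAct (P.torsion u).matrix stdω₁ = -u.pullback (d P.α) ∧
      lieAct (P.torsion u).matrix stdψ₂ = -u.pullback (d P.ω₃) ∧
      lieAct (P.torsion u).matrix stdψ₃ = u.pullback (d P.ω₂) := by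
  obtain ⟨N, hN⟩ := exists_pullback_d_formOf P hu
  have hα : u.pullback (d P.α) = _ := hN stdα SU2_le_stdα
  have h₂ : u.pullback (d P.ω₂) = _ := hN stdω₂ SU2_le_stdω₂
  have h₃ : u.pullback (d P.ω₃) = _ := hN stdω₃ SU2_le_stdω₃
  have hz : ∀ {k : ℕ} (θ : Form M k), θ = 0 → u.pullback θ = 0 := by
    rintro k θ rfl; rfl
  rw [SU2Structure.torsion, hα, h₂, h₃]
  exact lieAct_torsion_matrix N ((hN stdω₁ SU2_le_stdω₁).symm.trans (hz _ hP.1))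
    ((hN stdψ₂ SU2_le_stdψ₂).symm.trans (hz _ hP.2.1))
    ((hN stdψ₃ SU2_le_stdψ₃).symm.trans (hz _ hP.2.2)) rfl

/-- A symmetric matrix is determined by its action on `ω₁`, `ω₂ ∧ α` and `ω₃ ∧ α`. -/
theorem eq_of_lieAct_eq {X Y : Matrix (Fin 5) (Fin 5) ℝ} (hX : X.transpose = X)
    (hY : Y.transpose = Y) (h₁ : lieAct X stdω₁ = lieAct Y stdω₁)
    (h₂ : lieAct X stdψ₂ = lieAct Y stdψ₂) (h₃ : lieAct X stdψ₃ = lieAct Y stdψ₃) : X = Y := by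
  have h := (lieAct_eq_zero (X := X - Y) (by rw [lieAct_sub, h₁, sub_self])
    (by rw [lieAct_sub, h₂, sub_self]) (by rw [lieAct_sub, h₃, sub_self])).1
  rw [Matrix.transpose_sub, hX, hY] at h
  ext i j
  have hij := congrFun (congrFun h i) j
  simp only [Matrix.sub_apply, Matrix.neg_apply] at hij
  linarith

/-- Both sides are symmetric and act equally on the three evolving forms, so they coincide. This
avoids computing how the individual torsion components transform under `SU(2)`. -/
theorem Q_eq {P : SU2Structure M} (hP : P.IsHypo) {u : FrameBundle M} (hu : u ∈ P.carrier) :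
    Q P u = (P.torsion u).matrix := by
  obtain ⟨x, u⟩ := u
  have hv := P.someFrame_mem x
  set v : FrameBundle M := ⟨x, P.someFrame x⟩
  set g := transition (P.someFrame x) u with hg
  have hvu : v * g = ⟨x, u⟩ := mul_transition _ _
  have hgS : g ∈ SU2 := by
    obtain ⟨h, hh, hh'⟩ := P.exists_mul v hv _ hu rfl
    have : u = (glEquiv h).trans (P.someFrame x) := by injection hh'
    have : g = h := by
      refine gl_ext fun w => ?_
      rw [hg, glEquiv_transition, this]
      simp
    rwa [this]
  have hQ : Q P ⟨x, u⟩ = (g⁻¹ : GL (Fin 5) ℝ).val * (P.torsion v).matrix * g.val := rfl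
  obtain ⟨s, e₁, e₂, e₃⟩ := lieAct_torsion hP hv
  obtain ⟨s', e₁', e₂', e₃'⟩ := lieAct_torsion hP hu
  -- Orthogonality of `g` is what makes the conjugated matrix symmetric.
  have hgT : (g⁻¹ : GL (Fin 5) ℝ).val = g.val.transpose := by
    have h := SU2_transpose_mul_self hgS
    calc (g⁻¹ : GL (Fin 5) ℝ).val = g.val.transpose * g.val * (g⁻¹ : GL (Fin 5) ℝ).val := by
          rw [h, one_mul]
      _ = g.val.transpose := by rw [mul_assoc, ← Units.val_mul, mul_inv_cancel]; simp
  have key : ∀ {k : ℕ} (θ : (Fin 5 → ℝ) [⋀^Fin k]→L[ℝ] ℝ), SU2 ≤ stab θ →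
      lieAct (Q P ⟨x, u⟩) θ = glPullback g (lieAct (P.torsion v).matrix θ) := by
    intro k θ hθ
    rw [glPullback_lieAct, show glPullback g θ = θ from hθ hgS, hQ]
  refine eq_of_lieAct_eq ?_ s' ?_ ?_ ?_
  · rw [hQ, hgT]
    simp only [Matrix.transpose_mul, Matrix.transpose_transpose, s, mul_assoc]
  · rw [key stdω₁ SU2_le_stdω₁, e₁, e₁', glPullback_neg, ← pullback_mul, hvu]
  · rw [key stdψ₂ SU2_le_stdψ₂, e₂, e₂', glPullback_neg, ← pullback_mul, hvu]
  · rw [key stdψ₃ SU2_le_stdψ₃, e₃, e₃', ← pullback_mul, hvu]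

end Hypo

end

noncomputable section

namespace Hypo

/-! ### Smoothness of `Q` -/

theorem contDiff_coframeD {k : ℕ} (θ : (Fin 5 → ℝ) [⋀^Fin k]→L[ℝ] ℝ)
    (v : Fin (k + 1) → Fin 5 → ℝ) : ContDiff ℝ ∞ fun N => coframeD N θ v := by
  simp only [coframeD, ContinuousAlternatingMap.alternatizeUncurryFin_apply]
  refine ContDiff.sum fun i _ => ContDiff.const_smul _ ?_
  simp only [ContinuousLinearMap.comp_apply,
    ContinuousAlternatingMap.fderivCompContinuousLinearMap_apply]
  refine ContDiff.sum fun j _ => ?_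
  have hθ : ContDiff ℝ ∞ (fun m : Fin k → Fin 5 → ℝ => θ m) :=
    θ.toContinuousMultilinearMap.contDiff
  refine hθ.comp (contDiff_pi.2 fun l => ?_)
  by_cases h : l = j
  · subst h; simp; fun_prop
  · simp [h]; fun_prop

/-- Smoothness of `Q` is thereby reduced to that of the first derivative of a coframe. -/
theorem contDiff_torsion_matrix (i j : Fin 5) : ContDiff ℝ ∞ fun N =>
    (torsionOf (coframeD N stdα) (coframeD N stdω₂) (coframeD N stdω₃)).matrix i j := by
  have h := @contDiff_coframeD
  fin_cases i <;> fin_cases j <;>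
    simp [Torsion.matrix, torsionOf, antiSelfDual, J₁] <;> fun_prop

variable {M : Type*} [TopologicalSpace M] [ChartedSpace (EuclideanSpace ℝ (Fin 5)) M]

theorem transition_apply {x : M} (v u : (Fin 5 → ℝ) ≃L[ℝ] TangentSpace (𝓡 5) x) (i j : Fin 5) :
    (transition v u).val i j = v.symm (u (bv j)) i := by
  rw [← glEquiv_transition, glEquiv_apply, mulVec_bv]

theorem transition_inv {x : M} (v u : (Fin 5 → ℝ) ≃L[ℝ] TangentSpace (𝓡 5) x) :
    (transition v u)⁻¹ = transition u v := by
  refine inv_eq_of_mul_eq_one_right (gl_ext fun w => ?_)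
  have h : glEquiv (transition v u * transition u v) w =
      glEquiv (transition v u) (glEquiv (transition u v) w) := by
    simp [glEquiv_apply, Matrix.mulVec_mulVec]
  rw [h, glEquiv_transition, glEquiv_transition]
  simp [glEquiv_apply]

variable [IsManifold (𝓡 5) ∞ M]

theorem chartCoframe_chartFrame_apply (x₀ : M)
    (σ τ : ∀ p : ℝ × M, (Fin 5 → ℝ) ≃L[ℝ] TangentSpace (𝓡 5) p.2) {q : ℝ × E5}
    (hq : q.2 ∈ (extChartAt (𝓡 5) x₀).target) (v : Fin 5 → ℝ) :
    chartCoframe x₀ σ q (chartFrame x₀ τ q v) =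
      (σ (q.1, (extChartAt (𝓡 5) x₀).symm q.2)).symm
        (τ (q.1, (extChartAt (𝓡 5) x₀).symm q.2) v) := by
  have h := dchartSymm_comp_dchart ((extChartAt (𝓡 5) x₀).map_target hq)
  rw [(extChartAt (𝓡 5) x₀).right_inv hq] at h
  exact congrArg _ (DFunLike.congr_fun h
    (frameMap (τ (q.1, (extChartAt (𝓡 5) x₀).symm q.2)) v))

/-- `Q` at an arbitrary frame in terms of an adapted frame. -/
theorem Q_eq_conj {P : SU2Structure M} (hP : P.IsHypo) {x : M}
    {v : (Fin 5 → ℝ) ≃L[ℝ] TangentSpace (𝓡 5) x} (hv : (⟨x, v⟩ : FrameBundle M) ∈ P.carrier)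
    (u : (Fin 5 → ℝ) ≃L[ℝ] TangentSpace (𝓡 5) x) :
    Q P ⟨x, u⟩ =
      (transition u v).val * (P.torsion ⟨x, v⟩).matrix * (transition v u).val := by
  rw [← mul_transition v u, Q_mul, Q_eq hP hv, transition_inv]

/-- For a smooth family of hypo structures, `Q` is smooth along smooth frames. -/
theorem contDiffOn_Q {I : Set ℝ} {P : ℝ → SU2Structure M} (hP : IsSmoothFamily I P)
    (hyp : ∀ t ∈ I, (P t).IsHypo) {U : Set M} (hU : IsOpen U)
    {s : ∀ x : M, (Fin 5 → ℝ) ≃L[ℝ] TangentSpace (𝓡 5) x} (hs : IsSmoothFrameOn U s) (x₀ : M)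
    (i j : Fin 5) :
    ContDiffOn ℝ ∞ (fun q : ℝ × E5 => Q (P q.1)
      ⟨(extChartAt (𝓡 5) x₀).symm q.2, s ((extChartAt (𝓡 5) x₀).symm q.2)⟩ i j)
      (chartSet x₀ (I ×ˢ U)) := by
  intro q hq
  -- The frames chosen in the definition of `Q` need not be smooth; near `q` they are replaced by a
  -- smooth adapted family, which gives the same `Q` by `Q_eq_conj`.
  obtain ⟨W, hW, hqW, hWI, σ, hσ, hσP⟩ := hP q.1 hq.2.1 ((extChartAt (𝓡 5) x₀).symm q.2)
  have hs' := isSmoothFrameFamilyOn_const hs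
  have ho₁ := isOpen_chartSet x₀ hW
  have ho₂ := isOpen_chartSet x₀ ((isOpen_univ (X := ℝ)).prod hU)
  have hn₁ : chartSet x₀ W ∈ 𝓝 q := ho₁.mem_nhds ⟨hq.1, hqW⟩
  have hn₂ : chartSet x₀ (univ ×ˢ U) ∈ 𝓝 q := ho₂.mem_nhds ⟨hq.1, mem_univ _, hq.2.2⟩
  have ha := (contDiffOn_chartCoframe hσ x₀).contDiffAt hn₁
  have hb := (contDiffOn_chartFrame hσ x₀).contDiffAt hn₁
  have ha' := (contDiffOn_chartCoframe hs' x₀).contDiffAt hn₂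
  have hb' := (contDiffOn_chartFrame hs' x₀).contDiffAt hn₂
  have hN : ContDiffAt ℝ ∞ (familyN x₀ σ) q := by
    have hda : ContDiffAt ℝ ∞ (fderiv ℝ (chartCoframe x₀ σ)) q :=
      ha.fderiv_right (m := ∞) (by simp)
    have h1 : ContDiffAt ℝ ∞ (fun q => (ContinuousLinearMap.compL ℝ (Fin 5 → ℝ) E5
        (Fin 5 → ℝ)).flip (chartFrame x₀ σ q)) q :=
      (ContinuousLinearMap.contDiff _).contDiffAt.comp q hb
    exact h1.clm_comp ((hda.clm_comp contDiffAt_const).clm_comp hb)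
  have hT : ∀ k l, ContDiffAt ℝ ∞ (fun q => (torsionOf (coframeD (familyN x₀ σ q) stdα)
      (coframeD (familyN x₀ σ q) stdω₂) (coframeD (familyN x₀ σ q) stdω₃)).matrix k l) q :=
    fun k l => (contDiff_torsion_matrix k l).contDiffAt.comp q hN
  have hg : ∀ k l, ContDiffAt ℝ ∞ (fun q => chartCoframe x₀ σ q
      (chartFrame x₀ (fun p : ℝ × M => s p.2) q (bv l)) k) q := fun k l =>
    contDiffAt_pi.1 (ha.clm_apply (hb'.clm_apply contDiffAt_const)) k
  have hg' : ∀ k l, ContDiffAt ℝ ∞ (fun q => chartCoframe x₀ (fun p : ℝ × M => s p.2) q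
      (chartFrame x₀ σ q (bv l)) k) q := fun k l =>
    contDiffAt_pi.1 (ha'.clm_apply (hb.clm_apply contDiffAt_const)) k
  refine ContDiffAt.contDiffWithinAt ?_
  have hsum : ContDiffAt ℝ ∞ (fun q => ∑ k, (∑ l, chartCoframe x₀ (fun p : ℝ × M => s p.2) q
      (chartFrame x₀ σ q (bv l)) i * (torsionOf (coframeD (familyN x₀ σ q) stdα)
      (coframeD (familyN x₀ σ q) stdω₂) (coframeD (familyN x₀ σ q) stdω₃)).matrix l k) *
        chartCoframe x₀ σ q (chartFrame x₀ (fun p : ℝ × M => s p.2) q (bv j)) k) q :=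
    ContDiffAt.sum fun k _ => (ContDiffAt.sum fun l _ => (hg' i l).mul (hT l k)).mul (hg k j)
  refine hsum.congr_of_eventuallyEq ?_
  filter_upwards [hn₁] with q hq
  have hpx : (q.1, extChartAt (𝓡 5) x₀ ((extChartAt (𝓡 5) x₀).symm q.2)) = q := by
    rw [(extChartAt (𝓡 5) x₀).right_inv hq.1]
  have hd : ∀ {k : ℕ} (θ : (Fin 5 → ℝ) [⋀^Fin k]→L[ℝ] ℝ), SU2 ≤ stab θ →
      (⟨(extChartAt (𝓡 5) x₀).symm q.2, σ (q.1, (extChartAt (𝓡 5) x₀).symm q.2)⟩ :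
        FrameBundle M).pullback (d ((P q.1).formOf θ)) = coframeD (familyN x₀ σ q) θ := by
    intro k θ hθ
    have h := pullback_d_formOf_family P θ hθ hW hσ hσP
      ((extChartAt (𝓡 5) x₀).map_target hq.1) hq.2
    rwa [hpx] at h
  have hTq : (P q.1).torsion
      ⟨(extChartAt (𝓡 5) x₀).symm q.2, σ (q.1, (extChartAt (𝓡 5) x₀).symm q.2)⟩ =
      torsionOf (coframeD (familyN x₀ σ q) stdα)
      (coframeD (familyN x₀ σ q) stdω₂) (coframeD (familyN x₀ σ q) stdω₃) := by
    rw [← hd stdα SU2_le_stdα, ← hd stdω₂ SU2_le_stdω₂, ← hd stdω₃ SU2_le_stdω₃]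
    rfl
  rw [Q_eq_conj (hyp q.1 (hWI hq.2).1) (hσP _ hq.2), hTq]
  simp only [Matrix.mul_apply, transition_apply]
  refine Finset.sum_congr rfl fun k _ => ?_
  rw [chartCoframe_chartFrame_apply x₀ σ _ hq.1]
  congr 1
  refine Finset.sum_congr rfl fun l _ => ?_
  rw [chartCoframe_chartFrame_apply x₀ _ σ hq.1]

end Hypo

end

noncomputable section

namespace Hypo

/-! ### Linear differential equations for matrices -/

theorem hasDerivAt_matrix {f : ℝ → Matrix (Fin 5) (Fin 5) ℝ} {f' : Matrix (Fin 5) (Fin 5) ℝ}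
    {t : ℝ} : HasDerivAt f f' t ↔ ∀ i j, HasDerivAt (fun τ => f τ i j) (f' i j) t := by
  have h : HasDerivAt (F := Fin 5 → Fin 5 → ℝ) f f' t ↔ ∀ i, HasDerivAt (fun τ => f τ i) (f' i) t :=
    hasDerivAt_pi
  exact h.trans (forall_congr' fun i => hasDerivAt_pi)

theorem hasDerivAt_matrix_mul {f g : ℝ → Matrix (Fin 5) (Fin 5) ℝ}
    {f' g' : Matrix (Fin 5) (Fin 5) ℝ} {t : ℝ} (hf : HasDerivAt f f' t)
    (hg : HasDerivAt g g' t) :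
    HasDerivAt (fun τ => f τ * g τ) (f' * g t + f t * g') t := by
  rw [hasDerivAt_matrix] at *
  intro i j
  simp only [Matrix.mul_apply, Matrix.add_apply, ← Finset.sum_add_distrib]
  exact HasDerivAt.fun_sum fun k _ => (hf i k).mul (hg k j)

theorem hasDerivAt_matrix_const (C : Matrix (Fin 5) (Fin 5) ℝ) {t : ℝ} :
    HasDerivAt (fun _ : ℝ => C) 0 t :=
  hasDerivAt_matrix.2 fun i j => hasDerivAt_const t (C i j)

/-- Multiplication of matrices on the left, as a continuous bilinear map. -/
def leftMul : (Fin 5 → Fin 5 → ℝ) →L[ℝ] (Fin 5 → Fin 5 → ℝ) →L[ℝ] (Fin 5 → Fin 5 → ℝ) :=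
  LinearMap.toContinuousLinearMap
    ((LinearMap.toContinuousLinearMap (𝕜 := ℝ) (E := Fin 5 → Fin 5 → ℝ)
      (F' := Fin 5 → Fin 5 → ℝ)).toLinearMap ∘ₗ
        LinearMap.mul ℝ (Matrix (Fin 5) (Fin 5) ℝ))

variable {I : Set ℝ} {A : ℝ → Matrix (Fin 5) (Fin 5) ℝ}

theorem continuousOn_leftMul (hA : ∀ i j, ContinuousOn (fun t => A t i j) I) :
    ContinuousOn (fun t => leftMul (A t)) I :=
  leftMul.continuous.comp_continuousOn
    (continuousOn_pi.2 fun i => continuousOn_pi.2 fun j => hA i j)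

theorem exists_matrix_solution (hIo : IsOpen I) (hIc : I.OrdConnected) (h0 : (0 : ℝ) ∈ I)
    (hA : ∀ i j, ContinuousOn (fun t => A t i j) I) :
    ∃ S : ℝ → Matrix (Fin 5) (Fin 5) ℝ, S 0 = 1 ∧ ∀ t ∈ I, HasDerivAt S (A t * S t) t :=
  LinearODE.exists_solution hIo hIc h0 (continuousOn_leftMul hA)
    (1 : Matrix (Fin 5) (Fin 5) ℝ)

theorem matrix_solution_unique (hIo : IsOpen I) (hIc : I.OrdConnected) (h0 : (0 : ℝ) ∈ I)
    (hA : ∀ i j, ContinuousOn (fun t => A t i j) I) {S T : ℝ → Matrix (Fin 5) (Fin 5) ℝ}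
    (h : S 0 = T 0) (hS : ∀ t ∈ I, HasDerivAt S (A t * S t) t)
    (hT : ∀ t ∈ I, HasDerivAt T (A t * T t) t) {t : ℝ} (ht : t ∈ I) : S t = T t :=
  LinearODE.solution_unique (F := Fin 5 → Fin 5 → ℝ) hIo hIc h0 (continuousOn_leftMul hA)
    h hS hT t ht

/-- Constancy is uniqueness for the equation `y' = 0`. -/
theorem eq_of_hasDerivAt_zero (hIo : IsOpen I) (hIc : I.OrdConnected) (h0 : (0 : ℝ) ∈ I)
    {f : ℝ → ℝ} (hf : ∀ t ∈ I, HasDerivAt f 0 t) {t : ℝ} (ht : t ∈ I) : f t = f 0 :=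
  LinearODE.solution_unique (y := f) (z := fun _ => f 0) (A := 0) hIo hIc h0 continuousOn_const
    rfl (by simpa using hf) (fun t _ => by simpa using hasDerivAt_const t (f 0)) t ht

/-- The inverse of a solution of a linear matrix equation solves the adjoint equation. -/
theorem exists_inverse_solution (hIo : IsOpen I) (hIc : I.OrdConnected) (h0 : (0 : ℝ) ∈ I)
    (hA : ∀ i j, ContinuousOn (fun t => A t i j) I) {S : ℝ → Matrix (Fin 5) (Fin 5) ℝ}
    (hS0 : S 0 = 1) (hS : ∀ t ∈ I, HasDerivAt S (A t * S t) t) :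
    ∃ R : ℝ → Matrix (Fin 5) (Fin 5) ℝ, R 0 = 1 ∧ ∀ t ∈ I, R t * S t = 1 ∧
      HasDerivAt R (-(R t * A t)) t := by
  -- The equation `R' = -R A` has its coefficient on the right; transposition brings it to the left,
  -- where existence applies.
  obtain ⟨R, hR0, hR⟩ := exists_matrix_solution (A := fun t => -(A t).transpose) hIo hIc h0
    fun i j => (hA j i).neg
  have hR' : ∀ t ∈ I, HasDerivAt (fun t => (R t).transpose) (-((R t).transpose * A t)) t := by
    intro t ht
    rw [hasDerivAt_matrix]
    intro i j
    have h := hasDerivAt_matrix.1 (hR t ht) j i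
    have e : (-(A t).transpose * R t) j i = (-((R t).transpose * A t)) i j := by
      simp [Matrix.mul_apply, mul_comm]
    rwa [e] at h
  refine ⟨fun t => (R t).transpose, by simp [hR0], fun t ht => ⟨?_, hR' t ht⟩⟩
  ext i j
  -- The terms `-R A S` and `R A S` cancel, so the product keeps its initial value `1`.
  have hd : ∀ τ ∈ I, HasDerivAt (fun τ => ((R τ).transpose * S τ) i j) 0 τ := by
    intro τ hτ
    have h := hasDerivAt_matrix.1 (hasDerivAt_matrix_mul (hR' τ hτ) (hS τ hτ)) i j
    rwa [neg_mul, mul_assoc, neg_add_cancel] at h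
  have h := eq_of_hasDerivAt_zero hIo hIc h0 hd ht
  simpa [hR0, hS0] using h

theorem exists_GL_solution (hIo : IsOpen I) (hIc : I.OrdConnected) (h0 : (0 : ℝ) ∈ I)
    (hA : ∀ i j, ContinuousOn (fun t => A t i j) I) :
    ∃ S : ℝ → GL (Fin 5) ℝ, S 0 = 1 ∧ (∀ t ∉ I, S t = 1) ∧
      ∀ t ∈ I, HasDerivAt (fun τ => (S τ).val) (A t * (S t).val) t := by
  classical
  obtain ⟨S, hS0, hS⟩ := exists_matrix_solution hIo hIc h0 hA
  obtain ⟨R, hR0, hR⟩ := exists_inverse_solution hIo hIc h0 hA hS0 hS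
  -- The default value `1` off `I` makes `T` total, and keeps the later gauge transformations
  -- equivariant and smooth at all times.
  set T : ℝ → GL (Fin 5) ℝ := fun t => if h : t ∈ I then
    ⟨S t, R t, mul_eq_one_comm.1 (hR t h).1, (hR t h).1⟩ else 1 with hT
  have hTS : ∀ t ∈ I, (T t).val = S t := fun t ht => by simp [hT, ht]
  refine ⟨T, Units.ext ?_, fun t ht => by simp [hT, ht], fun t ht => ?_⟩
  · rw [hTS 0 h0, hS0]; rfl
  · rw [hTS t ht]
    refine HasDerivAt.congr_of_eventuallyEq (F := Fin 5 → Fin 5 → ℝ) (hS t ht) ?_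
    filter_upwards [hIo.mem_nhds ht] with τ hτ using hTS τ hτ

/-- The derivative of `a^* θ` along a path of matrices `a` with `a' = -X a`. -/
theorem hasDerivAt_form_mulVec {k : ℕ} (θ : (Fin 5 → ℝ) [⋀^Fin k]→L[ℝ] ℝ)
    {a : ℝ → Matrix (Fin 5) (Fin 5) ℝ} {X : Matrix (Fin 5) (Fin 5) ℝ} {t : ℝ}
    (ha : HasDerivAt a (-(X * a t)) t) (w : Fin k → Fin 5 → ℝ) :
    HasDerivAt (fun τ => θ fun i => (a τ).mulVec (w i))
      (-(lieAct X θ fun i => (a t).mulVec (w i))) t := by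
  have hv : HasDerivAt (fun τ => fun i => (a τ).mulVec (w i))
      (fun i => -(X.mulVec ((a t).mulVec (w i)))) t := by
    rw [hasDerivAt_pi]
    intro i
    rw [hasDerivAt_pi]
    intro j
    rw [Matrix.mulVec_mulVec, ← Matrix.neg_mulVec]
    simp only [Matrix.mulVec, dotProduct]
    exact HasDerivAt.fun_sum fun l _ => (hasDerivAt_matrix.1 ha j l).mul_const _
  have hθ := (θ.toContinuousMultilinearMap.hasFDerivAt
    (fun i => (a t).mulVec (w i))).comp_hasDerivAt t hv
  refine HasDerivAt.congr_deriv hθ ?_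
  rw [lieAct_apply, ContinuousMultilinearMap.linearDeriv_apply, ← Finset.sum_neg_distrib]
  refine Finset.sum_congr rfl fun j _ => ?_
  exact θ.toAlternatingMap.map_update_neg _ j _

end Hypo

end

/-! ### Paths of adapted frames, and the gauge equation `S' = -Q S` -/

noncomputable section

namespace Hypo

variable {M : Type*} [TopologicalSpace M] [ChartedSpace (EuclideanSpace ℝ (Fin 5)) M]

theorem transition_mulVec {x : M} (v u : (Fin 5 → ℝ) ≃L[ℝ] TangentSpace (𝓡 5) x)
    (w : Fin 5 → ℝ) : (transition v u).val.mulVec w = v.symm (u w) := by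
  rw [← glEquiv_apply, glEquiv_transition]

theorem pullback_apply {k : ℕ} (u : FrameBundle M) (θ : Form M k) (v : Fin k → Fin 5 → ℝ) :
    u.pullback θ v = θ u.pt fun i => u.frame (v i) := rfl

variable [IsManifold (𝓡 5) ∞ M]

theorem chartCoframe_dchart (x₀ : M)
    (σ : ∀ p : ℝ × M, (Fin 5 → ℝ) ≃L[ℝ] TangentSpace (𝓡 5) p.2) (t : ℝ) {x : M}
    (hx : x ∈ (extChartAt (𝓡 5) x₀).source) (w : E5) :
    chartCoframe x₀ σ (t, extChartAt (𝓡 5) x₀ x) (dchart x₀ x w) =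
      (frameMap (σ (t, x))).symm w := by
  simp only [chartCoframe]
  rw [(extChartAt (𝓡 5) x₀).left_inv hx]
  exact congrArg _ (DFunLike.congr_fun (dchartSymm_comp_dchart hx) w)

/-- A frame is adapted as soon as it pulls back the defining forms to the standard ones. -/
theorem mem_of_pullback {P : SU2Structure M} {u : FrameBundle M}
    (hα : u.pullback P.α = stdα) (h₁ : u.pullback P.ω₁ = stdω₁)
    (h₂ : u.pullback P.ω₂ = stdω₂) (h₃ : u.pullback P.ω₃ = stdω₃) : u ∈ P.carrier := by
  have hv := P.someFrame_mem u.pt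
  set v : FrameBundle M := ⟨u.pt, P.someFrame u.pt⟩
  set g := transition (P.someFrame u.pt) u.frame
  have hvu : v * g = u := mul_transition _ _
  have key : ∀ {k : ℕ} (θ : (Fin 5 → ℝ) [⋀^Fin k]→L[ℝ] ℝ), SU2 ≤ stab θ →
      u.pullback (P.formOf θ) = θ → g ∈ stab θ := by
    intro k θ hθ hu
    rw [← hvu, pullback_mul, P.pullback_formOf θ hθ v hv] at hu
    exact hu
  rw [← hvu]
  exact P.mul_mem v hv g ⟨⟨⟨key _ SU2_le_stdα hα, key _ SU2_le_stdω₁ h₁⟩,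
    key _ SU2_le_stdω₂ h₂⟩, key _ SU2_le_stdω₃ h₃⟩

theorem formOf_apply {k : ℕ} (P : SU2Structure M) (θ : (Fin 5 → ℝ) [⋀^Fin k]→L[ℝ] ℝ)
    (hθ : SU2 ≤ stab θ) {x : M} {u : (Fin 5 → ℝ) ≃L[ℝ] TangentSpace (𝓡 5) x}
    (hu : (⟨x, u⟩ : FrameBundle M) ∈ P.carrier) (v : Fin k → TangentSpace (𝓡 5) x) :
    P.formOf θ x v = θ fun i => u.symm (v i) :=
  DFunLike.congr_fun (formMap_formOf P θ hθ hu) v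

/-- At a fixed point, the defining forms of a smooth family are pulled back from `ℝ⁵` by a
differentiable path of matrices. -/
theorem exists_transition_hasDerivAt {I : Set ℝ} {P : ℝ → SU2Structure M}
    (hP : IsSmoothFamily I P) {t : ℝ} (ht : t ∈ I) {x : M}
    (u : (Fin 5 → ℝ) ≃L[ℝ] TangentSpace (𝓡 5) x) :
    ∃ v : ℝ → (Fin 5 → ℝ) ≃L[ℝ] TangentSpace (𝓡 5) x,
      (∀ᶠ τ in 𝓝 t, (⟨x, v τ⟩ : FrameBundle M) ∈ (P τ).carrier) ∧
      ∃ X, HasDerivAt (fun τ => (transition (v τ) u).val)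
        (-(X * (transition (v t) u).val)) t := by
  obtain ⟨W, hW, htW, -, σ, hσ, hσP⟩ := hP t ht x
  refine ⟨fun τ => σ (τ, x), ?_, ?_⟩
  · have hc : Continuous fun τ : ℝ => (τ, x) := by fun_prop
    filter_upwards [hc.continuousAt.preimage_mem_nhds (hW.mem_nhds htW)] with τ hτ
    exact hσP _ hτ
  · have hmem := mem_chartSet (mem_extChartAt_source (I := 𝓡 5) x) htW
    have hd : DifferentiableAt ℝ (fun τ => chartCoframe x σ (τ, extChartAt (𝓡 5) x x)) t :=
      DifferentiableAt.comp (g := chartCoframe x σ) t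
        (((contDiffOn_chartCoframe hσ x).differentiableOn (by simp) _ hmem).differentiableAt
        ((isOpen_chartSet x hW).mem_nhds hmem))
        (by fun_prop : DifferentiableAt ℝ (fun τ : ℝ => (τ, extChartAt (𝓡 5) x x)) t)
    have hent : ∀ i j, DifferentiableAt ℝ (fun τ => (transition (σ (τ, x)) u).val i j) t := by
      intro i j
      have h := differentiableAt_pi.1 (hd.clm_apply
        (differentiableAt_const (dchart x x (frameMap u (bv j))))) i
      refine h.congr_of_eventuallyEq (Filter.Eventually.of_forall fun τ => ?_)
      beta_reduce
      rw [chartCoframe_dchart x σ τ (mem_extChartAt_source x), transition_apply]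
      rfl
    obtain ⟨a', ha'⟩ : ∃ a', HasDerivAt (fun τ => (transition (σ (τ, x)) u).val) a' t :=
      ⟨fun i j => _, hasDerivAt_matrix.2 fun i j => (hent i j).hasDerivAt⟩
    -- Solving `a' = -X a` for `X`, which is possible since `a` is invertible.
    refine ⟨-(a' * (transition (σ (t, x)) u)⁻¹.val), ?_⟩
    rwa [neg_mul, neg_neg, mul_assoc, ← Units.val_mul, inv_mul_cancel, Units.val_one, mul_one]

/-- If `a` is the path of matrices of an adapted path of frames, the derivatives of the defining
forms are given by `a' a⁻¹`. -/
theorem hasDerivAt_formOf {k : ℕ} {P : ℝ → SU2Structure M}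
    (θ : (Fin 5 → ℝ) [⋀^Fin k]→L[ℝ] ℝ) (hθ : SU2 ≤ stab θ) {t : ℝ} {x : M}
    {u : (Fin 5 → ℝ) ≃L[ℝ] TangentSpace (𝓡 5) x}
    {v : ℝ → (Fin 5 → ℝ) ≃L[ℝ] TangentSpace (𝓡 5) x}
    (hv : ∀ᶠ τ in 𝓝 t, (⟨x, v τ⟩ : FrameBundle M) ∈ (P τ).carrier)
    {X : Matrix (Fin 5) (Fin 5) ℝ}
    (hX : HasDerivAt (fun τ => (transition (v τ) u).val)
      (-(X * (transition (v t) u).val)) t) (w : Fin k → TangentSpace (𝓡 5) x) :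
    HasDerivAt (fun τ => (P τ).formOf θ x w) (-(lieAct X θ fun i => (v t).symm (w i))) t := by
  have h := hasDerivAt_form_mulVec θ hX fun i => u.symm (w i)
  simp only [transition_mulVec, ContinuousLinearEquiv.apply_symm_apply] at h
  refine h.congr_of_eventuallyEq ?_
  filter_upwards [hv] with τ hτ
  exact formOf_apply (P τ) θ hθ hτ w

/-- `Q` is continuous in time. -/
theorem continuousOn_Q {I : Set ℝ} {P : ℝ → SU2Structure M} (hP : IsSmoothFamily I P)
    (hyp : ∀ t ∈ I, (P t).IsHypo) (u : FrameBundle M) (i j : Fin 5) :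
    ContinuousOn (fun t => Q (P t) u i j) I := by
  obtain ⟨x, u⟩ := u
  -- `P 0` serves only to provide a smooth frame independent of `t` near `x`.
  obtain ⟨U, hU, hxU, s, hs, -⟩ := (P 0).smooth x
  have hc : ∀ k l, ContinuousOn (fun t => Q (P t) ⟨x, s x⟩ k l) I := by
    intro k l
    have h := (contDiffOn_Q hP hyp hU hs x k l).continuousOn.comp
      (f := fun t : ℝ => (t, extChartAt (𝓡 5) x x)) (s := I) (by fun_prop)
      fun t ht => mem_chartSet (mem_extChartAt_source x) ⟨ht, hxU⟩
    refine h.congr fun t _ => ?_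
    simp only [Function.comp_apply]
    rw [(extChartAt (𝓡 5) x).left_inv (mem_extChartAt_source x)]
  have he : ∀ t, Q (P t) ⟨x, u⟩ i j = ∑ k, (∑ l, (transition (s x) u)⁻¹.val i l *
      Q (P t) ⟨x, s x⟩ l k) * (transition (s x) u).val k j := by
    intro t
    rw [← mul_transition (s x) u, Q_mul]
    simp only [Matrix.mul_apply]
  simp only [he]
  exact continuousOn_finsetSum _ fun k _ => (continuousOn_finsetSum _ fun l _ =>
    continuousOn_const.mul (hc l k)).mul continuousOn_const

/-- The solutions of `S' = -Q S`, as functions on the frame bundle. -/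
structure IsGaugeSolution (I : Set ℝ) (P : ℝ → SU2Structure M)
    (S : FrameBundle M → ℝ → GL (Fin 5) ℝ) : Prop where
  zero : ∀ u, S u 0 = 1
  not_mem : ∀ u, ∀ t ∉ I, S u t = 1
  deriv : ∀ u, ∀ t ∈ I, HasDerivAt (fun τ => (S u τ).val) (-Q (P t) u * (S u t).val) t

theorem exists_isGaugeSolution {I : Set ℝ} (hIo : IsOpen I) (hIc : I.OrdConnected)
    (h0 : (0 : ℝ) ∈ I) {P : ℝ → SU2Structure M} (hP : IsSmoothFamily I P)
    (hyp : ∀ t ∈ I, (P t).IsHypo) :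
    ∃ S : FrameBundle M → ℝ → GL (Fin 5) ℝ, IsGaugeSolution I P S := by
  choose S h1 h2 h3 using fun u => exists_GL_solution hIo hIc h0
    (A := fun t => -Q (P t) u) fun i j => (continuousOn_Q hP hyp u i j).neg
  exact ⟨S, h1, h2, h3⟩

namespace IsGaugeSolution

variable {I : Set ℝ} {P : ℝ → SU2Structure M} {S : FrameBundle M → ℝ → GL (Fin 5) ℝ}

/-- Both sides solve the equation with coefficient `-Q (u * g) = -g⁻¹ Q(u) g` and start at `1`, so
uniqueness applies. -/
theorem equivariant (hS : IsGaugeSolution I P S) (hIo : IsOpen I) (hIc : I.OrdConnected)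
    (h0 : (0 : ℝ) ∈ I) (hP : IsSmoothFamily I P) (hyp : ∀ t ∈ I, (P t).IsHypo)
    (u : FrameBundle M) (g : GL (Fin 5) ℝ) (t : ℝ) : S (u * g) t = g⁻¹ * S u t * g := by
  by_cases ht : t ∈ I
  · refine Units.ext ?_
    refine matrix_solution_unique (A := fun t => -Q (P t) (u * g))
      (S := fun t => (S (u * g) t).val) (T := fun t => (g⁻¹ * S u t * g).val) hIo hIc h0
      (fun i j => (continuousOn_Q hP hyp _ i j).neg) (by simp [hS.zero])
      (hS.deriv (u * g)) (fun τ hτ => ?_) ht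
    have h := hasDerivAt_matrix_mul (hasDerivAt_matrix_mul
      (hasDerivAt_matrix_const (g⁻¹ : GL (Fin 5) ℝ).val) (hS.deriv u τ hτ))
        (hasDerivAt_matrix_const g.val)
    refine HasDerivAt.congr_deriv (F := Fin 5 → Fin 5 → ℝ) h ?_
    have e : g.val * (g⁻¹ : GL (Fin 5) ℝ).val = 1 := g.mul_inv
    rw [Q_mul, Units.val_mul, Units.val_mul]
    simp only [zero_mul, mul_zero, add_zero, zero_add, neg_mul, mul_neg]
    congr 1
    calc _ = (g⁻¹ : GL (Fin 5) ℝ).val * Q (P τ) u * 1 * (S u τ).val * g.val := by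
          simp only [mul_assoc, one_mul]
      _ = _ := by rw [← e]; simp only [mul_assoc]
  · simp [hS.not_mem _ t ht]

/-- The solutions of `S' = -Q S` depend smoothly on time and on the frame. -/
theorem contMDiffOn (hS : IsGaugeSolution I P S) (hIo : IsOpen I) (hIc : I.OrdConnected)
    (h0 : (0 : ℝ) ∈ I) (hP : IsSmoothFamily I P) (hyp : ∀ t ∈ I, (P t).IsHypo) {U : Set M}
    (hU : IsOpen U) {s : ∀ x : M, (Fin 5 → ℝ) ≃L[ℝ] TangentSpace (𝓡 5) x}
    (hs : IsSmoothFrameOn U s) (i j : Fin 5) :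
    ContMDiffOn (𝓘(ℝ, ℝ).prod (𝓡 5)) 𝓘(ℝ, ℝ) ∞
      (fun p : ℝ × M => (S ⟨p.2, s p.2⟩ p.1).val i j) (I ×ˢ U) := by
  rintro ⟨t, x⟩ ⟨ht, hx⟩
  set φ := extChartAt (𝓡 5) x
  set V : Set E5 := φ.target ∩ φ.symm ⁻¹' U
  have hV : IsOpen V := (continuousOn_extChartAt_symm x).isOpen_inter_preimage (isOpen_target x) hU
  -- In the chart at `x` the base point is a parameter, and `y` solves a linear equation with smooth
  -- coefficient `A`.
  set y : ℝ × E5 → Fin 5 → Fin 5 → ℝ := fun q => (S ⟨φ.symm q.2, s (φ.symm q.2)⟩ q.1).val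
  set A : ℝ × E5 → (Fin 5 → Fin 5 → ℝ) →L[ℝ] (Fin 5 → Fin 5 → ℝ) := fun q =>
    leftMul (-Q (P q.1) ⟨φ.symm q.2, s (φ.symm q.2)⟩)
  have hA : ContDiffOn ℝ ∞ A (I ×ˢ V) :=
    leftMul.contDiff.comp_contDiffOn (contDiffOn_pi.2 fun k => contDiffOn_pi.2 fun l =>
      ((contDiffOn_Q hP hyp hU hs x k l).mono fun q hq => ⟨hq.2.1, hq.1, hq.2.2⟩).neg)
  have hy : ContDiffOn ℝ ∞ y (I ×ˢ V) := by
    refine contDiffOn_infty.2 fun n => ?_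
    refine LinearODE.contDiffOn_solution_nat hIo hIc h0 hV n (A := A)
      (c := (1 : Matrix (Fin 5) (Fin 5) ℝ)) (hA.of_le (by exact_mod_cast le_top)) ?_ ?_
    · intro z _
      exact congrArg Units.val (hS.zero _)
    · intro τ hτ z _
      exact hS.deriv ⟨φ.symm z, s (φ.symm z)⟩ τ hτ
  have hy' : ContMDiffOn (𝓘(ℝ, ℝ).prod 𝓘(ℝ, E5)) 𝓘(ℝ, ℝ) ∞ (fun q => y q i j) (I ×ˢ V) := by
    rw [chartedSpaceSelf_prod, ← modelWithCornersSelf_prod, contMDiffOn_iff_contDiffOn]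
    exact contDiffOn_pi.1 (contDiffOn_pi.1 hy i) j
  have hφ : ContMDiffOn (𝓘(ℝ, ℝ).prod (𝓡 5)) (𝓘(ℝ, ℝ).prod 𝓘(ℝ, E5)) ∞
      (fun p : ℝ × M => (p.1, φ p.2)) (I ×ˢ (φ.source ∩ U)) :=
    contMDiff_fst.contMDiffOn.prodMk ((contMDiffOn_extChartAt (n := ∞) (x := x)).comp
      contMDiff_snd.contMDiffOn fun p hp => by simpa [φ] using hp.2.1)
  have hc := hy'.comp hφ fun p hp => ⟨hp.1, φ.map_source hp.2.1, by
    simpa only [mem_preimage, φ.left_inv hp.2.1] using hp.2.2⟩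
  have hxs : x ∈ φ.source := mem_extChartAt_source x
  have hn : I ×ˢ (φ.source ∩ U) ∈ 𝓝 (t, x) :=
    (hIo.prod ((isOpen_extChartAt_source x).inter hU)).mem_nhds ⟨ht, hxs, hx⟩
  refine ((hc.contMDiffAt hn).congr_of_eventuallyEq ?_).contMDiffWithinAt
  filter_upwards [hn] with p hp
  simp only [Function.comp_apply, y]
  rw [φ.left_inv hp.2.1]

end IsGaugeSolution

end Hypo

end

/-! ### The evolution equations and the gauge equation -/

noncomputable section

namespace Hypo

variable {M : Type*} [TopologicalSpace M] [ChartedSpace (EuclideanSpace ℝ (Fin 5)) M]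
  [IsManifold (𝓡 5) ∞ M] {I : Set ℝ} {P : ℝ → SU2Structure M}

/-- Under the hypo evolution equations, a path of adapted frames moves by `-Q` up to
`su(2)`. -/
theorem lieAct_add_Q_eq_zero (hev : HypoEvolution I P) (hyp : ∀ t ∈ I, (P t).IsHypo) {t : ℝ}
    (ht : t ∈ I) {x : M} {u : (Fin 5 → ℝ) ≃L[ℝ] TangentSpace (𝓡 5) x}
    {v : ℝ → (Fin 5 → ℝ) ≃L[ℝ] TangentSpace (𝓡 5) x}
    (hv : ∀ᶠ τ in 𝓝 t, (⟨x, v τ⟩ : FrameBundle M) ∈ (P τ).carrier)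
    {X : Matrix (Fin 5) (Fin 5) ℝ}
    (hX : HasDerivAt (fun τ => (transition (v τ) u).val)
      (-(X * (transition (v t) u).val)) t) :
    lieAct (X + Q (P t) ⟨x, v t⟩) stdα = 0 ∧ lieAct (X + Q (P t) ⟨x, v t⟩) stdω₁ = 0 ∧
      lieAct (X + Q (P t) ⟨x, v t⟩) stdω₂ = 0 ∧ lieAct (X + Q (P t) ⟨x, v t⟩) stdω₃ = 0 := by
  have hvt := hv.self_of_nhds
  obtain ⟨-, e₁, e₂, e₃⟩ := lieAct_torsion (hyp t ht) hvt
  rw [← Q_eq (hyp t ht) hvt] at e₁ e₂ e₃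
  have key : ∀ {k : ℕ} (θ : (Fin 5 → ℝ) [⋀^Fin k]→L[ℝ] ℝ) (ξ : Form M k), SU2 ≤ stab θ →
      (∀ w, HasDerivAt (fun τ => (P τ).formOf θ x w) (ξ x w) t) →
      lieAct (Q (P t) ⟨x, v t⟩) θ = (⟨x, v t⟩ : FrameBundle M).pullback ξ →
      lieAct (X + Q (P t) ⟨x, v t⟩) θ = 0 := by
    intro k θ ξ hθ hξ hQ
    rw [lieAct_add, hQ]
    ext z
    have h := (hasDerivAt_formOf θ hθ hv hX fun i => v t (z i)).unique (hξ fun i => v t (z i))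
    simp only [ContinuousLinearEquiv.symm_apply_apply] at h
    rw [ContinuousAlternatingMap.add_apply, pullback_apply]
    exact (congrArg _ h.symm).trans (add_neg_cancel _)
  obtain ⟨h₁, h₂, h₃⟩ := hev t ht x
  have k₁ := key stdω₁ (-d (P t).α) SU2_le_stdω₁ h₁ e₁
  have k₂ := key stdψ₂ (-d (P t).ω₃) SU2_le_stdψ₂ h₂ e₂
  have k₃ := key stdψ₃ (d (P t).ω₂) SU2_le_stdψ₃ h₃ e₃
  -- The evolution equations control only three forms; membership in `su(2)` recovers `α`, `ω₂` and
  -- `ω₃` separately.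
  obtain ⟨-, kα, k₂', k₃'⟩ := lieAct_eq_zero k₁ k₂ k₃
  exact ⟨kα, k₁, k₂', k₃'⟩

/-- The gauge transformations `S' = -Q S` map adapted frames of `P 0` to adapted frames of
`P t`. -/
theorem IsGaugeSolution.mul_mem {S : FrameBundle M → ℝ → GL (Fin 5) ℝ}
    (hS : IsGaugeSolution I P S) (hIo : IsOpen I) (hIc : I.OrdConnected) (h0 : (0 : ℝ) ∈ I)
    (hP : IsSmoothFamily I P) (hyp : ∀ t ∈ I, (P t).IsHypo) (hev : HypoEvolution I P)
    {u : FrameBundle M} (hu : u ∈ (P 0).carrier) {t : ℝ} (ht : t ∈ I) :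
    u * S u t ∈ (P t).carrier := by
  have key : ∀ {k : ℕ} (θ : (Fin 5 → ℝ) [⋀^Fin k]→L[ℝ] ℝ), SU2 ≤ stab θ →
      (∀ Z, lieAct Z stdα = 0 ∧ lieAct Z stdω₁ = 0 ∧ lieAct Z stdω₂ = 0 ∧
        lieAct Z stdω₃ = 0 → lieAct Z θ = 0) →
      (u * S u t).pullback ((P t).formOf θ) = θ := by
    intro k θ hθ hZ
    ext w
    have hd : ∀ τ ∈ I, HasDerivAt
        (fun τ => (u * S u τ).pullback ((P τ).formOf θ) w) 0 τ := by
      intro τ hτ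
      obtain ⟨v, hv, X, hX⟩ := exists_transition_hasDerivAt hP hτ u.frame
      have hz := hZ _ (lieAct_add_Q_eq_zero hev hyp hτ hv hX)
      set T := Q (P τ) ⟨u.pt, v τ⟩ with hT
      -- Equivariance moves `Q` from the moving frame `v τ` to the fixed frame `u`, where the gauge
      -- equation is posed.
      have hTu : T * (transition (v τ) u.frame).val =
          (transition (v τ) u.frame).val * Q (P τ) u := by
        have h : Q (P τ) u = _ :=
          (congrArg _ (mul_transition (v τ) u.frame).symm).trans (Q_mul _ _ _)
        rw [h, ← mul_assoc, ← mul_assoc, ← Units.val_mul, mul_inv_cancel, Units.val_one, one_mul]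
      -- This is the path `v⁻¹ u S`, whose logarithmic derivative `-(X + T)` lies in `su(2)` and
      -- hence does not move `θ`.
      have hB : HasDerivAt (fun τ => (transition (v τ) u.frame * S u τ).val)
          (-((X + T) * (transition (v τ) u.frame * S u τ).val)) τ := by
        refine HasDerivAt.congr_deriv (F := Fin 5 → Fin 5 → ℝ)
          (hasDerivAt_matrix_mul hX (hS.deriv u τ hτ)) ?_
        rw [Units.val_mul, add_mul, ← mul_assoc T, hTu]
        simp only [mul_assoc, neg_mul, mul_neg, neg_add]
        rfl
      have h := hasDerivAt_form_mulVec θ hB w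
      rw [hz] at h
      refine (h.congr_deriv neg_zero).congr_of_eventuallyEq ?_
      filter_upwards [hv] with τ' hτ'
      rw [pullback_apply]
      refine (formOf_apply (P τ') θ hθ hτ' _).trans (congrArg θ (funext fun i => ?_))
      rw [Units.val_mul, ← Matrix.mulVec_mulVec, transition_mulVec]
      rfl
    have h := eq_of_hasDerivAt_zero hIo hIc h0 hd ht
    rw [h, hS.zero, frame_mul_one, (P 0).pullback_formOf θ hθ u hu]
  exact mem_of_pullback (key stdα SU2_le_stdα fun Z h => h.1)
    (key stdω₁ SU2_le_stdω₁ fun Z h => h.2.1) (key stdω₂ SU2_le_stdω₂ fun Z h => h.2.2.1)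
    (key stdω₃ SU2_le_stdω₃ fun Z h => h.2.2.2)

/-- The gauge transformation given by the solutions of `S' = -Q S` at time `t`. -/
theorem IsGaugeSolution.exists_gaugeTransformation {S : FrameBundle M → ℝ → GL (Fin 5) ℝ}
    (hS : IsGaugeSolution I P S) (hIo : IsOpen I) (hIc : I.OrdConnected) (h0 : (0 : ℝ) ∈ I)
    (hP : IsSmoothFamily I P) (hyp : ∀ t ∈ I, (P t).IsHypo) (t : ℝ) :
    ∃ s : GaugeTransformation M, ∀ u, s u = S u t := by
  refine ⟨⟨fun u => S u t, fun u g => hS.equivariant hIo hIc h0 hP hyp u g t, ?_⟩, fun _ => rfl⟩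
  intro U hU σ hσ i j
  by_cases ht : t ∈ I
  · exact (hS.contMDiffOn hIo hIc h0 hP hyp hU hσ i j).comp
      (f := fun x : M => (t, x)) (contMDiff_const.prodMk contMDiff_id).contMDiffOn
      fun x hx => ⟨ht, hx⟩
  · simp only [hS.not_mem _ t ht]
    exact contMDiffOn_const

/-- The solutions of `S' = -Q S` are the required gauge transformations. That they reach all of `P
t` follows from equivariance, since `SU(2)` acts transitively on the adapted frames at a point. -/
theorem exists_gauge_of_evolution (hIo : IsOpen I) (hIc : I.OrdConnected) (h0 : (0 : ℝ) ∈ I)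
    (hP : IsSmoothFamily I P) (hyp : ∀ t ∈ I, (P t).IsHypo) (hev : HypoEvolution I P) :
    ∃ s : ℝ → GaugeTransformation M, IsSmoothGaugeFamily I s ∧
        (∀ u : FrameBundle M, s 0 u = 1) ∧
        (∀ t ∈ I, (P t).carrier = {v | ∃ u ∈ (P 0).carrier, v = u * s t u}) ∧
        ∀ t ∈ I, ∀ u : FrameBundle M, ∃ s' : Matrix (Fin 5) (Fin 5) ℝ,
          HasDerivAt (fun τ => (s τ u : Matrix (Fin 5) (Fin 5) ℝ)) s' t ∧
            s' * (↑(s t u)⁻¹ : Matrix (Fin 5) (Fin 5) ℝ) = -Q (P t) u := by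
  obtain ⟨S, hS⟩ := exists_isGaugeSolution hIo hIc h0 hP hyp
  choose s hs using fun t => hS.exists_gaugeTransformation hIo hIc h0 hP hyp t
  refine ⟨s, ?_, ?_, ?_, ?_⟩
  · intro U hU σ hσ i j
    simp only [hs]
    exact hS.contMDiffOn hIo hIc h0 hP hyp hU hσ i j
  · intro u
    rw [hs, hS.zero]
  · intro t ht
    ext v
    simp only [hs]
    constructor
    · intro hv
      obtain ⟨u, hu, huv⟩ := (P 0).nonempty v.pt
      obtain ⟨g, hg, rfl⟩ := (P t).exists_mul _
        (hS.mul_mem hIo hIc h0 hP hyp hev hu ht) v hv huv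
      refine ⟨u * g, (P 0).mul_mem u hu g hg, ?_⟩
      -- `(u g) S(u g) = u g g⁻¹ S(u) g = u S(u) g`.
      rw [hS.equivariant hIo hIc h0 hP hyp, frame_mul_mul, frame_mul_mul]
      congr 1
      group
    · rintro ⟨u, hu, rfl⟩
      exact hS.mul_mem hIo hIc h0 hP hyp hev hu ht
  · intro t ht u
    simp only [hs]
    refine ⟨_, hS.deriv u t ht, ?_⟩
    rw [mul_assoc, ← Units.val_mul, mul_inv_cancel, Units.val_one, mul_one]

/-- The path `u s_t` is adapted and moves by `-Q`, so the derivatives of the defining forms are the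
action of `Q`, known from `lieAct_torsion`. -/
theorem evolution_of_gauge (hIo : IsOpen I) (hIc : I.OrdConnected) (h0 : (0 : ℝ) ∈ I)
    (hP : IsSmoothFamily I P) (hyp : ∀ t ∈ I, (P t).IsHypo) (s : ℝ → GaugeTransformation M)
    (hs0 : ∀ u : FrameBundle M, s 0 u = 1)
    (hsP : ∀ t ∈ I, (P t).carrier = {v | ∃ u ∈ (P 0).carrier, v = u * s t u})
    (hs : ∀ t ∈ I, ∀ u : FrameBundle M, ∃ s' : Matrix (Fin 5) (Fin 5) ℝ,
          HasDerivAt (fun τ => (s τ u : Matrix (Fin 5) (Fin 5) ℝ)) s' t ∧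
            s' * (↑(s t u)⁻¹ : Matrix (Fin 5) (Fin 5) ℝ) = -Q (P t) u) :
    HypoEvolution I P := by
  intro t ht x
  obtain ⟨u, hu, rfl⟩ := (P 0).nonempty x
  have hder : ∀ τ ∈ I, HasDerivAt (fun τ => (s τ u).val) (-Q (P τ) u * (s τ u).val) τ := by
    intro τ hτ
    obtain ⟨s', hs', e⟩ := hs τ hτ u
    rwa [← e, mul_assoc, ← Units.val_mul, inv_mul_cancel, Units.val_one, mul_one]
  -- The coframes along the path involve `s⁻¹`, so the derivative of the inverse is needed: it is
  -- `s⁻¹ Q(u)`.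
  obtain ⟨R, -, hR⟩ := exists_inverse_solution (A := fun t => -Q (P t) u) hIo hIc h0
    (fun i j => (continuousOn_Q hP hyp u i j).neg) (by rw [hs0]; rfl) hder
  have hRs : ∀ τ ∈ I, (s τ u)⁻¹.val = R τ := fun τ hτ =>
    (left_inv_eq_right_inv (hR τ hτ).1 (s τ u).mul_inv).symm
  set v : ℝ → (Fin 5 → ℝ) ≃L[ℝ] TangentSpace (𝓡 5) u.pt := fun τ =>
    (glEquiv (s τ u)).trans u.frame
  have hvP : ∀ τ ∈ I, (⟨u.pt, v τ⟩ : FrameBundle M) ∈ (P τ).carrier := by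
    intro τ hτ
    rw [hsP τ hτ]
    exact ⟨u, hu, rfl⟩
  have hv : ∀ᶠ τ in 𝓝 t, (⟨u.pt, v τ⟩ : FrameBundle M) ∈ (P τ).carrier := by
    filter_upwards [hIo.mem_nhds ht] with τ hτ using hvP τ hτ
  have htr : ∀ τ, transition (v τ) u.frame = (s τ u)⁻¹ := by
    intro τ
    rw [← transition_inv]
    refine congrArg _ (gl_ext fun w => ?_)
    rw [glEquiv_transition]
    exact u.frame.symm_apply_apply _
  have hQ : Q (P t) ⟨u.pt, v t⟩ = (s t u)⁻¹.val * Q (P t) u * (s t u).val := Q_mul (P t) u _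
  -- By equivariance `s⁻¹ Q(u) = Q(u s) s⁻¹`, which has the form `-X s⁻¹` with `X = -Q(u s)`.
  have hX : HasDerivAt (fun τ => (transition (v τ) u.frame).val)
      (-(-Q (P t) ⟨u.pt, v t⟩ * (transition (v t) u.frame).val)) t := by
    refine HasDerivAt.congr_of_eventuallyEq (F := Fin 5 → Fin 5 → ℝ) (f := R) ?_ ?_
    · refine HasDerivAt.congr_deriv (F := Fin 5 → Fin 5 → ℝ) (hR t ht).2 ?_
      rw [htr, hQ, ← hRs t ht, neg_mul, mul_assoc _ (s t u).val, ← Units.val_mul,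
        mul_inv_cancel, Units.val_one, mul_one, mul_neg]
    · filter_upwards [hIo.mem_nhds ht] with τ hτ
      rw [htr, hRs τ hτ]
  obtain ⟨-, e₁, e₂, e₃⟩ := lieAct_torsion (hyp t ht) (hvP t ht)
  rw [← Q_eq (hyp t ht) (hvP t ht)] at e₁ e₂ e₃
  have key : ∀ {k : ℕ} (θ : (Fin 5 → ℝ) [⋀^Fin k]→L[ℝ] ℝ) (ξ : Form M k), SU2 ≤ stab θ →
      lieAct (Q (P t) ⟨u.pt, v t⟩) θ = (⟨u.pt, v t⟩ : FrameBundle M).pullback ξ →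
      ∀ w, HasDerivAt (fun τ => (P τ).formOf θ u.pt w) (ξ u.pt w) t := by
    intro k θ ξ hθ hξ w
    have h := hasDerivAt_formOf θ hθ hv hX w
    rw [lieAct_neg, hξ, ContinuousAlternatingMap.neg_apply, neg_neg, pullback_apply] at h
    simpa only [ContinuousLinearEquiv.apply_symm_apply] using h
  exact ⟨key stdω₁ (-d (P t).α) SU2_le_stdω₁ e₁, key stdψ₂ (-d (P t).ω₃) SU2_le_stdψ₂ e₂,
    key stdψ₃ (d (P t).ω₂) SU2_le_stdψ₃ e₃⟩

end Hypo

end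

open Hypo in
theorem mainTheorem7 {M : Type*} [TopologicalSpace M]
    [ChartedSpace (EuclideanSpace ℝ (Fin 5)) M] [IsManifold (𝓡 5) ∞ M]
    (I : Set ℝ) (hIo : IsOpen I) (hIc : I.OrdConnected) (h0 : (0 : ℝ) ∈ I)
    (P : ℝ → SU2Structure M) (hP : IsSmoothFamily I P) (hyp : ∀ t ∈ I, (P t).IsHypo) :
    ((∀ t ∈ I, ∀ u ∈ (P t).carrier, Q (P t) u = ((P t).torsion u).matrix) ∧
      ∀ t ∈ I, ∀ (u : FrameBundle M) (g : GL (Fin 5) ℝ),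
        Q (P t) (u * g) = (↑g⁻¹ : Matrix (Fin 5) (Fin 5) ℝ) * Q (P t) u *
          (↑g : Matrix (Fin 5) (Fin 5) ℝ)) ∧
    (HypoEvolution I P ↔
      ∃ s : ℝ → GaugeTransformation M, IsSmoothGaugeFamily I s ∧
        (∀ u : FrameBundle M, s 0 u = 1) ∧
        (∀ t ∈ I, (P t).carrier = {v | ∃ u ∈ (P 0).carrier, v = u * s t u}) ∧
        ∀ t ∈ I, ∀ u : FrameBundle M, ∃ s' : Matrix (Fin 5) (Fin 5) ℝ,
          HasDerivAt (fun τ => (s τ u : Matrix (Fin 5) (Fin 5) ℝ)) s' t ∧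
            s' * (↑(s t u)⁻¹ : Matrix (Fin 5) (Fin 5) ℝ) = -Q (P t) u) := by
  refine ⟨⟨fun t ht u hu => Q_eq (hyp t ht) hu, fun t _ u g => Q_mul (P t) u g⟩,
    fun hev => exists_gauge_of_evolution hIo hIc h0 hP hyp hev, ?_⟩
  rintro ⟨s, -, hs0, hsP, hs⟩
  exact evolution_of_gauge hIo hIc h0 hP hyp s hs0 hsP hs
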